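/- Let $n\ge 2$ and let $\psi\in C^\infty([0,+\infty))$ satisfy $\psi>0$ on $(0,+\infty)$, $\psi'(0)=1$ and $\psi^{(2k)}(0)=0$ for all integers $k\ge 0$. Let $\mathbb{M}^n$ be the complete noncompact model manifold with pole $o$ and model function $\psi$, that is, $\mathbb{R}^n$ with $o=0$ and, in polar coordinates $(r,\theta)\in(0,+\infty)\times\mathbb{S}^{n-1}$, the metric $dr\otimes dr+\psi(r)^2\,\mathsf{g}_{\mathbb{S}^{n-1}}$; then $r=\mathrm{d}(x,o)$ is the distance to the pole, and the volume measure is $dV=\psi(r)^{n-1}\,dr\,dV_{\mathbb{S}^{n-1}}(\theta)$. Set $B_r=\{x:\mathrm{d}(x,o)<r\}$ and $G(r)=\int_0^r\psi(s)^{n-1}\,ds$. Let $\dot H^1(\mathbb{M}^n)$ be the space of functions $v\in L^2_{\mathrm{loc}}(\mathbb{M}^n)$ with weak gradient $\nabla v\in L^2(\mathbb{M}^n)$ for which there are $\varphi_k\in C_c^\infty(\mathbb{M}^n)$ with $\|\nabla\varphi_k-\nabla v\|_{L^2}\to0$ and $\varphi_k\to v$ in $L^2_{\mathrm{loc}}(\mathbb{M}^n)$.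 Let $\mathcal{L}_0(\mathbb{M}^n)$ be the set of measurable functions $v$ with $\mu_v(t):=V(\{|v|>t\})<+\infty$ for all $t>0$. The Schwarz rearrangement of $v\in\mathcal{L}_0(\mathbb{M}^n)$ is $v^\star(x):=v^*\big(V(B_{\mathrm{d}(x,o)})\big)$, where $v^*(s):=\sup\{t\ge0:\mu_v(t)>s\}$ (with $\sup\emptyset=0$). One says that $\mathbb{M}^n$ supports the radial Pólya–Szegő inequality if, for every $v\in\dot H^1(\mathbb{M}^n)\cap\mathcal{L}_0(\mathbb{M}^n)$ that is radial (i.e. depends, up to a null set, only on $\mathrm{d}(x,o)$), we have $v^\star\in\dot H^1(\mathbb{M}^n)\cap\mathcal{L}_0(\mathbb{M}^n)$ and $$\int_{\mathbb{M}^n}|\nabla v^\star|^2\,dV\le\int_{\mathbb{M}^n}|\nabla v|^2\,dV.$$ (1) Suppose that $$\psi(R)^{n-1}\le\psi(S)^{n-1}+\psi(T)^{n-1}\quad\text{for all }R,S,T>0\text{ such that }G(R)=G(S)-G(T).\qquad(*)$$ Then $\mathbb{M}^n$ supports the radial Pólya–Szegő inequality. (2) In particular, if $\psi$ is nondecreasing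 on $[0,+\infty)$, then $(*)$ holds, and $\mathbb{M}^n$ supports the radial Pólya–Szegő inequality. -/

import Mathlib

open scoped ContDiff

noncomputable section

namespace ModelManifold

open MeasureTheory Set Filter Topology

/-- A model function of a complete noncompact model manifold: `ψ` is smooth on `[0,∞)` (its values on
`(-∞,0)` are irrelevant and never used), positive on `(0,∞)`, with `ψ'(0) = 1` and with all
derivatives of even order (including `ψ` itself) vanishing at `0`. -/
structure IsModelFunction (ψ : ℝ → ℝ) : Prop where
  smooth : ContDiffOn ℝ ∞ ψ (Ici 0)
  pos : ∀ r : ℝ, 0 < r → 0 < ψ r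
  deriv_zero : derivWithin ψ (Ici 0) 0 = 1
  even_deriv_zero : ∀ k : ℕ, iteratedDerivWithin (2 * k) ψ (Ici 0) 0 = 0

/-- The underlying smooth manifold of the `n`-dimensional model manifold: `ℝⁿ` with its standard
smooth structure. The pole is `0`, and the polar coordinates of `x ≠ 0` are `r = ‖x‖`
(the geodesic distance to the pole) and `θ = x / ‖x‖`. Tangent spaces are identified with `ℝⁿ`. -/
abbrev M (n : ℕ) : Type := EuclideanSpace ℝ (Fin n)

variable {n : ℕ}

/-- The unit radial vector `x / ‖x‖`. -/
def radialVec (x : M n) : M n := ‖x‖⁻¹ • x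

/-- The differential at `x ≠ 0` of the polar coordinate `r = ‖x‖`, applied to `w`. -/
def dr (x w : M n) : ℝ := inner ℝ (radialVec x) w

/-- The differential at `x ≠ 0` of the polar coordinate `θ = x / ‖x‖`, applied to `w`
(a vector tangent to the unit sphere at `θ`, seen as a vector of `ℝⁿ`). -/
def dθ (x w : M n) : M n := ‖x‖⁻¹ • (w - dr x w • radialVec x)

open Classical in
/-- The metric `dr ⊗ dr + ψ(r)² g_{𝕊ⁿ⁻¹}`, which at the pole is the Euclidean inner product. -/
def metric (ψ : ℝ → ℝ) (x w z : M n) : ℝ :=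
  if x = 0 then inner ℝ w z
  else dr x w * dr x z + ψ ‖x‖ ^ 2 * inner ℝ (dθ x w) (dθ x z)

open Classical in
/-- The Riemannian gradient of a differentiable function: radial component `∂_r f`, spherical
component `ψ(r)⁻² ∇_θ f`. -/
def grad (ψ : ℝ → ℝ) (f : M n → ℝ) (x : M n) : M n :=
  if x = 0 then gradient f 0
  else dr x (gradient f x) • radialVec x
    + (‖x‖ / ψ ‖x‖) ^ 2 • (gradient f x - dr x (gradient f x) • radialVec x)

/-- The gradient is the vector representing the differential with respect to the metric. -/
theorem metric_grad {ψ : ℝ → ℝ} (hψ : IsModelFunction ψ) (f : M n → ℝ) (x w : M n) :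
    metric ψ x (grad ψ f x) w = fderiv ℝ f x w := by
  have hg : fderiv ℝ f x w = inner ℝ (gradient f x) w := by
    simp [gradient]
  rw [hg]
  by_cases hx : x = 0
  · subst hx
    simp [metric, grad]
  · have hr : ‖x‖ ≠ 0 := norm_ne_zero_iff.mpr hx
    have hp : ψ ‖x‖ ≠ 0 := (hψ.pos _ (norm_pos_iff.mpr hx)).ne'
    have hu : inner ℝ (radialVec x) (radialVec x) = (1 : ℝ) := by
      rw [real_inner_self_eq_norm_sq, radialVec, norm_smul, norm_inv, norm_norm,
        inv_mul_cancel₀ hr, one_pow]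
    simp only [metric, grad, if_neg hx, dθ, dr]
    generalize gradient f x = y
    generalize radialVec x = u at *
    simp only [inner_add_left, inner_add_right, inner_sub_left, inner_sub_right,
      inner_smul_left, inner_smul_right, hu, real_inner_comm u y, conj_trivial]
    field_simp
    ring

/-- The Riemannian volume measure `dV = ψ(r)ⁿ⁻¹ dr dV_{𝕊ⁿ⁻¹}(θ)`, transported to `ℝⁿ` by the polar
coordinates `(r, θ) ↦ rθ`; `volume.toSphere` is the surface measure of the unit sphere. -/
def vol (n : ℕ) (ψ : ℝ → ℝ) : Measure (M n) :=
  Measure.map (fun p : ℝ × Metric.sphere (0 : M n) 1 => p.1 • (p.2 : M n))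
    (((volume.restrict (Ioi (0 : ℝ))).withDensity
        (fun r => ENNReal.ofReal (ψ r ^ (n - 1)))).prod
      (volume : Measure (M n)).toSphere)

/-- `G(r) = ∫₀^r ψ(s)ⁿ⁻¹ ds`, the volume of the ball `B_r` up to the area of the unit sphere. -/
def G (n : ℕ) (ψ : ℝ → ℝ) (r : ℝ) : ℝ := ∫ s in (0 : ℝ)..r, ψ s ^ (n - 1)

/-- `φ ∈ C_c^∞`. -/
def IsTestFunction (φ : M n → ℝ) : Prop := ContDiff ℝ ∞ φ ∧ HasCompactSupport φ

/-- `W` is the weak gradient of `v`: the `1`-form `⟨W, ·⟩` dual to `W` is the weak differential of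
`v`. A differential does not involve the metric, so it is tested in the global chart:
`∫ v ∂_e φ dx = - ∫ ⟨W, e⟩ φ dx` for all test functions `φ` and all directions `e`. -/
def HasWeakGradient (ψ : ℝ → ℝ) (v : M n → ℝ) (W : M n → M n) : Prop :=
  LocallyIntegrable v ∧ LocallyIntegrable W ∧
    ∀ φ : M n → ℝ, IsTestFunction φ → ∀ e : M n,
      ∫ x, v x * fderiv ℝ φ x e = - ∫ x, metric ψ x (W x) e * φ x

/-- `∫ |W|² dV`, where `|W|` is the Riemannian norm of the vector field `W`. -/
def energy (ψ : ℝ → ℝ) (W : M n → M n) : ENNReal :=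
  ∫⁻ x, ENNReal.ofReal (metric ψ x (W x) (W x)) ∂(vol n ψ)

/-- The space `Ḣ¹`: functions `v ∈ L²_loc` with weak gradient in `L²` for which there are test
functions `φ_k` with `∇φ_k → ∇v` in `L²` and `φ_k → v` in `L²_loc`. -/
def MemHdot (ψ : ℝ → ℝ) (v : M n → ℝ) : Prop :=
  (∀ K : Set (M n), IsCompact K → MemLp v 2 ((vol n ψ).restrict K)) ∧
  ∃ W : M n → M n, HasWeakGradient ψ v W ∧ energy ψ W < ⊤ ∧
    ∃ φ : ℕ → M n → ℝ, (∀ k, IsTestFunction (φ k)) ∧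
      Tendsto (fun k => energy ψ (fun x => grad ψ (φ k) x - W x)) atTop (𝓝 0) ∧
      ∀ K : Set (M n), IsCompact K →
        Tendsto (fun k => eLpNorm (fun x => φ k x - v x) 2 ((vol n ψ).restrict K)) atTop (𝓝 0)

/-- The distribution function `μ_f(t) = V({|f| > t})`. -/
def distrib (ψ : ℝ → ℝ) (f : M n → ℝ) (t : ℝ) : ENNReal := vol n ψ {x | t < |f x|}

/-- `𝓛₀`: the measurable functions all of whose superlevel sets `{|f| > t}`, `t > 0`, have finite
volume. -/
def MemL0 (ψ : ℝ → ℝ) (f : M n → ℝ) : Prop :=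
  AEMeasurable f (vol n ψ) ∧ ∀ t : ℝ, 0 < t → distrib ψ f t < ⊤

/-- The one-dimensional rearrangement `f*(s) = sup {t ≥ 0 : μ_f(t) > s}` (with `sup ∅ = 0`). -/
def rearr (ψ : ℝ → ℝ) (f : M n → ℝ) (s : ENNReal) : ENNReal :=
  sSup {τ : ENNReal | ∃ t : ℝ, 0 ≤ t ∧ s < distrib ψ f t ∧ τ = ENNReal.ofReal t}

/-- The Schwarz rearrangement `f^⋆(x) = f*(V(B_{d(x,o)}))`. For `f ∈ 𝓛₀` the value of `f*` is finite
except possibly at the pole alone, where an infinite value is replaced by `0`. -/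
def schwarz (ψ : ℝ → ℝ) (f : M n → ℝ) (x : M n) : ℝ :=
  (rearr ψ f (vol n ψ (Metric.ball 0 ‖x‖))).toReal

/-- A (class of a) function is radial if, up to a null set, it depends only on `r = d(x,o)`. -/
def IsRadial (ψ : ℝ → ℝ) (v : M n → ℝ) : Prop :=
  ∃ f : ℝ → ℝ, v =ᵐ[vol n ψ] fun x => f ‖x‖

/-- The radial Pólya–Szegő inequality on the `n`-dimensional model manifold with model function `ψ`.
Weak gradients are unique up to null sets, and those of `v` and `v^⋆` exist by membership
in `Ḣ¹`. -/
def SupportsRadialPolyaSzego (n : ℕ) (ψ : ℝ → ℝ) : Prop :=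
  ∀ v : M n → ℝ, IsRadial ψ v → MemHdot ψ v → MemL0 ψ v →
    MemHdot ψ (schwarz ψ v) ∧ MemL0 ψ (schwarz ψ v) ∧
    ∀ W W' : M n → M n, HasWeakGradient ψ v W → HasWeakGradient ψ (schwarz ψ v) W' →
      energy ψ W' ≤ energy ψ W

/-- `ψ(R)ⁿ⁻¹ ≤ ψ(S)ⁿ⁻¹ + ψ(T)ⁿ⁻¹` whenever `R, S, T > 0` and `G(R) = G(S) - G(T)`. -/
def VolumeSubadditive (n : ℕ) (ψ : ℝ → ℝ) : Prop :=
  ∀ R S T : ℝ, 0 < R → 0 < S → 0 < T → G n ψ R = G n ψ S - G n ψ T →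
    ψ R ^ (n - 1) ≤ ψ S ^ (n - 1) + ψ T ^ (n - 1)

end ModelManifold

end

/-!
The inequality is one-dimensional. A radial function of `Ḣ¹` is, up to a null set, `F(r)` with `F`
locally absolutely continuous on `(0, ∞)`: the approximating test functions converge together with
their radial derivatives along almost every ray, and a ray can be chosen on which the radial
derivative carries at most the average energy (`exists_profile`). So, with `g = ψⁿ⁻¹` and
`u = |F|`, it has to be shown that the decreasing rearrangement of `u` with respect to the measure
`g(r) dr` has no more energy `∫ (∂_r u)² g dr` than `u`.

The hypothesis on `ψ` says that the perimeter of the ball whose volume is the difference of the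
volumes of two balls is at most the sum of the perimeters of the two balls. Applied at one boundary
point after another, it is an isoperimetric inequality: among finite unions of spherical shells of
given volume, the ball centred at the pole has the least perimeter (`profile_cellVol_le`). It also
forces infinite volume (`tendsto_cumVol`), so that balls of every volume exist. Approximating the
superlevel sets of `u` by finite unions of shells gives, if `ρ(t)` denotes the radius of the ball
with the volume of `{u > t}` and `q` an upper gradient of `u`,
`∫₀^∞ b(t) g(ρ(t)) dt ≤ ∫ b(u) q g dr` for all `b ≥ 0` (`lintegral_profile_le`).

Taking `b = y ∘ ρ`, the Cauchy–Schwarz inequality and equimeasurability bound the square of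
`∫₀^∞ y(ρ(t)) g(ρ(t)) dt` by `(∫ y² g dr) (∫ q² g dr)`. By duality the image of `dt` under `ρ` has
a density `p` on `(0, ∞)` with `∫ p² g dr ≤ ∫ q² g dr`, and since the rearrangement at `r` is the
length of `{t : ρ(t) > r}`, it equals `∫_r^∞ p` (`exists_rearrangement_density`).
This treats plateaus and non-monotone profiles without differentiating the distribution function.

Conversely, a function `∫_r^∞ p` of the radius with `∫ p² g dr < ∞` belongs to `Ḣ¹`
(`memHdot_of_ae_eq_tailInt`): `p` is approximated by smooth slopes supported in compact subsets of
`(0, ∞)`, whose primitives are test functions, and near the pole `g` is comparable to `rⁿ⁻¹`, which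
controls the primitives in `L²`.

If `ψ` is nondecreasing, then so is `ψⁿ⁻¹`, and `G(R) = G(S) - G(T)` forces `R < S`, whence the
subadditivity.
-/

open scoped ContDiff ENNReal
open MeasureTheory Set Filter Topology

noncomputable section

namespace ModelManifold

section

/-! ### Comparing measures on the line -/

/-- Finite measures on `ℝ` are ordered as soon as they are ordered on half-open intervals: the
difference of the distribution functions is itself a Stieltjes function. -/
theorem measure_le_of_Ioc_of_finite {μ ν : Measure ℝ} [IsFiniteMeasure μ] [IsFiniteMeasure ν]
    (h : ∀ a b, a < b → μ (Ioc a b) ≤ ν (Ioc a b)) : μ ≤ ν := by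
  have hsplit : ∀ (m : Measure ℝ) [IsFiniteMeasure m] (a b : ℝ), a ≤ b →
      m.real (Ioc a b) = m.real (Iic b) - m.real (Iic a) := by
    intro m _ a b hab
    rw [← Iic_sdiff_Iic, measureReal_sdiff (Iic_subset_Iic.2 hab) measurableSet_Iic]
  have hcont : ∀ (m : Measure ℝ) [IsFiniteMeasure m] (x : ℝ),
      ContinuousWithinAt (fun y => m.real (Iic y)) (Ici x) x := by
    intro m _ x
    rw [← continuousWithinAt_Ioi_iff_Ici]
    have h1 : Tendsto (m ∘ Iic) (𝓝[>] x) (𝓝 (m (⋂ r > x, Iic r))) :=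
      tendsto_measure_biInter_gt (fun r _ => measurableSet_Iic.nullMeasurableSet)
        (fun i j _ hij => Iic_subset_Iic.2 hij) ⟨x + 1, by simp, measure_ne_top _ _⟩
    have h2 : (⋂ r > x, Iic r) = Iic x := by
      ext y
      simpa only [mem_iInter, mem_Iic] using
        ⟨fun h => le_of_forall_gt_imp_ge_of_dense h, fun h r hr => h.trans hr.le⟩
    rw [h2] at h1
    exact (ENNReal.tendsto_toReal (measure_ne_top _ _)).comp h1
  let F : StieltjesFunction ℝ :=
    { toFun := fun y => ν.real (Iic y) - μ.real (Iic y)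
      mono' := by
        intro a b hab
        rcases hab.eq_or_lt with rfl | hlt
        · exact le_rfl
        have h1 := ENNReal.toReal_mono (measure_ne_top _ _) (h a b hlt)
        have h2 := hsplit μ a b hab
        have h3 := hsplit ν a b hab
        simp only [measureReal_def] at *
        linarith
      right_continuous' := fun x => (hcont ν x).sub (hcont μ x) }
  have hν : ν = μ + F.measure := by
    refine Measure.ext_of_Ioc _ _ fun a b hab => ?_
    have h2 := hsplit μ a b hab.le
    have h3 := hsplit ν a b hab.le
    have h1 : μ.real (Ioc a b) ≤ ν.real (Ioc a b) :=
      ENNReal.toReal_mono (measure_ne_top _ _) (h a b hab)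
    have hF : F b - F a = ν.real (Ioc a b) - μ.real (Ioc a b) := by
      change (ν.real (Iic b) - μ.real (Iic b)) - (ν.real (Iic a) - μ.real (Iic a)) = _
      linarith
    rw [Measure.add_apply, StieltjesFunction.measure_Ioc, hF,
      ← ofReal_measureReal (μ := μ), ← ENNReal.ofReal_add measureReal_nonneg (by linarith),
      add_sub_cancel, ofReal_measureReal]
  rw [hν]
  exact Measure.le_add_right le_rfl

/-- Locally finite measures on `ℝ` are ordered as soon as they are ordered on half-open
intervals. -/
theorem measure_le_of_Ioc {μ ν : Measure ℝ} [IsLocallyFiniteMeasure ν]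
    (h : ∀ a b, a < b → μ (Ioc a b) ≤ ν (Ioc a b)) : μ ≤ ν := by
  have hk : ∀ k : ℕ, μ.restrict (Ioc (-(k : ℝ)) k) ≤ ν.restrict (Ioc (-(k : ℝ)) k) := by
    intro k
    have hfin : ν (Ioc (-(k : ℝ)) k) < ⊤ := measure_Ioc_lt_top
    have hfin' : μ (Ioc (-(k : ℝ)) k) < ⊤ := by
      by_cases hk : -(k : ℝ) < k
      · exact (h _ _ hk).trans_lt hfin
      · rw [Ioc_eq_empty hk]; simp
    have : IsFiniteMeasure (μ.restrict (Ioc (-(k : ℝ)) k)) := ⟨by simpa using hfin'⟩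
    have : IsFiniteMeasure (ν.restrict (Ioc (-(k : ℝ)) k)) := ⟨by simpa using hfin⟩
    refine measure_le_of_Ioc_of_finite fun a b _ => ?_
    rw [Measure.restrict_apply measurableSet_Ioc, Measure.restrict_apply measurableSet_Ioc,
      Ioc_inter_Ioc]
    by_cases hlt : a ⊔ -(k : ℝ) < b ⊓ k
    · exact h _ _ hlt
    · rw [Ioc_eq_empty hlt]; simp
  have hmono : Monotone fun k : ℕ => Ioc (-(k : ℝ)) k := fun i j hij =>
    Ioc_subset_Ioc (neg_le_neg (by exact_mod_cast hij)) (by exact_mod_cast hij)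
  have hU : ⋃ k : ℕ, Ioc (-(k : ℝ)) k = univ := by
    refine eq_univ_of_forall fun x => ?_
    obtain ⟨k, hk⟩ := exists_nat_gt |x|
    exact mem_iUnion.2 ⟨k, (abs_lt.1 hk).1, (abs_lt.1 hk).2.le⟩
  refine Measure.le_iff.2 fun s hs => ?_
  have key : ∀ m : Measure ℝ, m s = ⨆ k : ℕ, m.restrict (Ioc (-(k : ℝ)) k) s := by
    intro m
    have hm : Monotone fun k : ℕ => s ∩ Ioc (-(k : ℝ)) k := fun i j hij =>
      inter_subset_inter_right s (hmono hij)
    have := hm.measure_iUnion (μ := m)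
    rw [← inter_iUnion, hU, inter_univ] at this
    rw [this]
    exact iSup_congr fun k => (Measure.restrict_apply hs).symm
  rw [key μ, key ν]
  exact iSup_mono fun k => hk k s

/-! ### Radial volume densities -/

/-- A radial volume density `g`, playing the role of `ψⁿ⁻¹`, extended by `0` to the negative
half-line. -/
structure IsDensity (g : ℝ → ℝ) : Prop where
  cont : Continuous g
  zero : ∀ r ≤ 0, g r = 0
  pos : ∀ r, 0 < r → 0 < g r

/-- The measure `g(r) dr`. -/
def radMeas (g : ℝ → ℝ) : Measure ℝ := volume.withDensity fun r => ENNReal.ofReal (g r)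

/-- The volume function `r ↦ ∫₀^r g`. -/
def cumVol (g : ℝ → ℝ) (r : ℝ) : ℝ := ∫ s in (0 : ℝ)..r, g s

/-- The radius enclosing a given volume: the inverse of `cumVol g` on `[0, ∞)`. -/
def radiusOf (g : ℝ → ℝ) : ℝ → ℝ := Function.invFunOn (cumVol g) (Ici 0)

/-- The inequality `g(R) ≤ g(S) + g(T)` whenever `∫₀^R g = ∫₀^S g - ∫₀^T g`. -/
def DensitySubadditive (g : ℝ → ℝ) : Prop :=
  ∀ R S T : ℝ, 0 < R → 0 < S → 0 < T → cumVol g R = cumVol g S - cumVol g T → g R ≤ g S + g T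

variable {g : ℝ → ℝ}

theorem IsDensity.nonneg (hg : IsDensity g) (r : ℝ) : 0 ≤ g r := by
  rcases le_or_gt r 0 with h | h
  · exact (hg.zero r h).ge
  · exact (hg.pos r h).le

theorem IsDensity.hasDerivAt (hg : IsDensity g) (r : ℝ) : HasDerivAt (cumVol g) (g r) r :=
  intervalIntegral.integral_hasDerivAt_right (hg.cont.intervalIntegrable _ _)
    (hg.cont.stronglyMeasurableAtFilter _ _) hg.cont.continuousAt

theorem IsDensity.continuous_cumVol (hg : IsDensity g) : Continuous (cumVol g) :=
  continuous_iff_continuousAt.2 fun r => (hg.hasDerivAt r).continuousAt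

@[simp] theorem cumVol_zero : cumVol g 0 = 0 := by simp [cumVol]

theorem IsDensity.strictMonoOn (hg : IsDensity g) : StrictMonoOn (cumVol g) (Ici 0) := by
  refine strictMonoOn_of_deriv_pos (convex_Ici 0) hg.continuous_cumVol.continuousOn ?_
  intro x hx
  rw [interior_Ici] at hx
  rw [(hg.hasDerivAt x).deriv]
  exact hg.pos x hx

theorem IsDensity.cumVol_sub (hg : IsDensity g) (a b : ℝ) :
    cumVol g b - cumVol g a = ∫ s in a..b, g s :=
  intervalIntegral.integral_interval_sub_left (hg.cont.intervalIntegrable _ _)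
    (hg.cont.intervalIntegrable _ _)

theorem IsDensity.monotone (hg : IsDensity g) : Monotone (cumVol g) := by
  intro a b hab
  have := intervalIntegral.integral_nonneg (μ := volume) hab fun u _ => hg.nonneg u
  rw [← hg.cumVol_sub] at this
  linarith

theorem IsDensity.cumVol_nonneg (hg : IsDensity g) {r : ℝ} (hr : 0 ≤ r) : 0 ≤ cumVol g r := by
  simpa using hg.monotone hr

theorem IsDensity.cumVol_pos (hg : IsDensity g) {r : ℝ} (hr : 0 < r) : 0 < cumVol g r := by
  simpa using hg.strictMonoOn self_mem_Ici hr.le hr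

theorem IsDensity.radMeas_Ioc (hg : IsDensity g) {a b : ℝ} (hab : a ≤ b) :
    radMeas g (Ioc a b) = ENNReal.ofReal (cumVol g b - cumVol g a) := by
  rw [hg.cumVol_sub, radMeas, withDensity_apply _ measurableSet_Ioc,
    intervalIntegral.integral_of_le hab, ofReal_integral_eq_lintegral_ofReal]
  · exact (hg.cont.intervalIntegrable a b).1
  · exact Eventually.of_forall fun x => hg.nonneg x

theorem IsDensity.radMeas_Iic_zero (hg : IsDensity g) : radMeas g (Iic 0) = 0 := by
  rw [radMeas, withDensity_apply _ measurableSet_Iic]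
  refine (setLIntegral_congr_fun measurableSet_Iic (g := fun _ => 0) ?_).trans (by simp)
  intro x hx
  simp [hg.zero x hx]

theorem IsDensity.radMeas_Iic (hg : IsDensity g) {b : ℝ} (hb : 0 ≤ b) :
    radMeas g (Iic b) = ENNReal.ofReal (cumVol g b) := by
  have h := hg.radMeas_Ioc hb
  rw [cumVol_zero, sub_zero] at h
  rw [← Iic_union_Ioc_eq_Iic hb]
  refine le_antisymm ((measure_union_le _ _).trans ?_) ?_
  · rw [hg.radMeas_Iic_zero, h, zero_add]
  · rw [← h]; exact measure_mono subset_union_right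

theorem IsDensity.ae_pos (hg : IsDensity g) : ∀ᵐ r ∂(radMeas g), 0 < r := by
  rw [ae_iff]
  simp only [not_lt]
  exact hg.radMeas_Iic_zero

theorem IsDensity.isLocallyFinite (hg : IsDensity g) : IsLocallyFiniteMeasure (radMeas g) := by
  refine ⟨fun x => ⟨Iic (|x| + 1), Iic_mem_nhds (by linarith [le_abs_self x]), ?_⟩⟩
  rw [hg.radMeas_Iic (by positivity)]
  exact ENNReal.ofReal_lt_top

theorem radMeas_absolutelyContinuous : radMeas g ≪ volume := withDensity_absolutelyContinuous _ _

theorem IsDensity.lintegral_radMeas (hg : IsDensity g) (f : ℝ → ℝ≥0∞) :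
    ∫⁻ r, f r ∂(radMeas g) = ∫⁻ r, ENNReal.ofReal (g r) * f r := by
  rw [radMeas, lintegral_withDensity_eq_lintegral_mul_non_measurable₀]
  · rfl
  · exact (hg.cont.measurable.ennreal_ofReal).aemeasurable
  · exact Eventually.of_forall fun x => ENNReal.ofReal_lt_top

instance : SFinite (radMeas g) := by unfold radMeas; infer_instance

theorem radiusOf_spec {s : ℝ} (h : ∃ r, 0 ≤ r ∧ cumVol g r = s) :
    0 ≤ radiusOf g s ∧ cumVol g (radiusOf g s) = s :=
  ⟨Function.invFunOn_mem (s := Ici 0) h, Function.invFunOn_eq (s := Ici 0) h⟩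

theorem IsDensity.radiusOf_cumVol (hg : IsDensity g) {r : ℝ} (hr : 0 ≤ r) :
    radiusOf g (cumVol g r) = r := by
  obtain ⟨h0, h1⟩ := radiusOf_spec (g := g) (s := cumVol g r) ⟨r, hr, rfl⟩
  exact hg.strictMonoOn.injOn h0 hr h1

theorem IsDensity.radiusOf_zero (hg : IsDensity g) : radiusOf g 0 = 0 := by
  simpa using hg.radiusOf_cumVol le_rfl

/-- `radiusOf g` is continuous at every interior point of the range of the volume function. -/
theorem IsDensity.continuousAt_radiusOf (hg : IsDensity g) {r : ℝ} (hr : 0 < r) :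
    ContinuousAt (radiusOf g) (cumVol g r) := by
  have hsub : cumVol g '' Ici 0 ∈ 𝓝 (cumVol g r) := by
    have h1 : Icc (cumVol g 0) (cumVol g (r + 1)) ⊆ cumVol g '' Icc 0 (r + 1) :=
      intermediate_value_Icc (by linarith) hg.continuous_cumVol.continuousOn
    refine mem_of_superset (Icc_mem_nhds ?_ ?_)
      (h1.trans (image_mono Icc_subset_Ici_self))
    · simpa using hg.cumVol_pos hr
    · exact hg.strictMonoOn hr.le (show (0 : ℝ) ≤ r + 1 by linarith) (by linarith)
  have hmono : StrictMonoOn (radiusOf g) (cumVol g '' Ici 0) := by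
    rintro _ ⟨a, ha, rfl⟩ _ ⟨b, hb, rfl⟩ hab
    rw [hg.radiusOf_cumVol ha, hg.radiusOf_cumVol hb]
    exact (hg.strictMonoOn.lt_iff_lt ha hb).1 hab
  refine hmono.continuousAt_of_image_mem_nhds hsub ?_
  rw [hg.radiusOf_cumVol hr.le]
  refine mem_of_superset (Ici_mem_nhds hr) fun x hx => ?_
  exact ⟨cumVol g x, ⟨x, hx, rfl⟩, hg.radiusOf_cumVol hx⟩

theorem IsDensity.hasDerivAt_radiusOf (hg : IsDensity g) {r : ℝ} (hr : 0 < r) :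
    HasDerivAt (radiusOf g) (g r)⁻¹ (cumVol g r) := by
  have hc := hg.continuousAt_radiusOf hr
  refine HasDerivAt.of_local_left_inverse (f := cumVol g) hc ?_ (hg.pos r hr).ne' ?_
  · rw [hg.radiusOf_cumVol hr.le]; exact hg.hasDerivAt r
  · have h1 : Icc (cumVol g 0) (cumVol g (r + 1)) ⊆ cumVol g '' Icc 0 (r + 1) :=
      intermediate_value_Icc (by linarith) hg.continuous_cumVol.continuousOn
    have h2 : Icc (cumVol g 0) (cumVol g (r + 1)) ∈ 𝓝 (cumVol g r) := by
      refine Icc_mem_nhds ?_ ?_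
      · simpa using hg.cumVol_pos hr
      · exact hg.strictMonoOn hr.le (show (0 : ℝ) ≤ r + 1 by linarith) (by linarith)
    filter_upwards [h2] with y hy
    obtain ⟨x, hx, rfl⟩ := h1 hy
    rw [hg.radiusOf_cumVol hx.1]

/-! ### Infinite volume and the subadditive isoperimetric profile -/

/-- If the volume were finite, equal to `L`, letting `S → ∞` in the subadditivity inequality would
make the profile `s ↦ g (radiusOf g s)` symmetric about `L / 2`. -/
theorem IsDensity.profile_le_of_tendsto (hg : IsDensity g) (hsub : DensitySubadditive g) {L : ℝ}
    (hL : Tendsto (cumVol g) atTop (𝓝 L)) {r t : ℝ} (hr : 0 < r) (ht : 0 < t)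
    (h : cumVol g r + cumVol g t = L) : g r ≤ g t := by
  by_contra! hlt
  set δ := (g r - g t) / 2 with hδ
  have hδ0 : 0 < δ := by rw [hδ]; linarith
  -- for large `S` the radius enclosing volume `V(S) - V(r)` is close to `t`
  have hlim : Tendsto (fun S => g (radiusOf g (cumVol g S - cumVol g r))) atTop (𝓝 (g t)) := by
    have h1 : Tendsto (fun S => cumVol g S - cumVol g r) atTop (𝓝 (cumVol g t)) := by
      have := hL.sub_const (cumVol g r)
      rwa [← h, add_sub_cancel_left] at this
    have h2 := (hg.continuousAt_radiusOf ht).tendsto.comp h1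
    rw [hg.radiusOf_cumVol ht.le] at h2
    exact (hg.cont.tendsto t).comp h2
  have hev : ∀ᶠ S in atTop, δ ≤ g S := by
    filter_upwards [hlim.eventually_lt_const (show g t < g t + δ by linarith),
      eventually_gt_atTop r] with S hS hrS
    have hS0 : 0 < S := hr.trans hrS
    have hpos : 0 < cumVol g S - cumVol g r := sub_pos.2 (hg.strictMonoOn hr.le hS0.le hrS)
    have hex : ∃ x, 0 ≤ x ∧ cumVol g x = cumVol g S - cumVol g r := by
      have h1 : Icc (cumVol g 0) (cumVol g S) ⊆ cumVol g '' Icc 0 S :=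
        intermediate_value_Icc hS0.le hg.continuous_cumVol.continuousOn
      obtain ⟨x, hx, hxe⟩ := h1 (show cumVol g S - cumVol g r ∈ _ from
        ⟨by simpa using hpos.le, by linarith [hg.cumVol_nonneg hr.le]⟩)
      exact ⟨x, hx.1, hxe⟩
    obtain ⟨h0, h1⟩ := radiusOf_spec hex
    have hT : 0 < radiusOf g (cumVol g S - cumVol g r) := by
      refine h0.lt_of_ne fun h' => ?_
      rw [← h', cumVol_zero] at h1
      linarith
    have := hsub r S _ hr hS0 hT (by rw [h1]; ring)
    linarith
  obtain ⟨S₀, hS₀⟩ := eventually_atTop.1 hev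
  have hgrow : ∀ S, S₀ ≤ S → δ * (S - S₀) ≤ cumVol g S - cumVol g S₀ := by
    intro S hS
    rw [hg.cumVol_sub]
    calc δ * (S - S₀) = ∫ _ in S₀..S, δ := by simp [mul_comm]
      _ ≤ ∫ s in S₀..S, g s := intervalIntegral.integral_mono_on hS (by simp)
        (hg.cont.intervalIntegrable _ _) fun x hx => hS₀ x hx.1
  have hinf : Tendsto (cumVol g) atTop atTop := by
    have h1 : Tendsto (fun S => δ * (S - S₀) + cumVol g S₀) atTop atTop :=
      tendsto_atTop_add_const_right _ _
        ((tendsto_atTop_add_const_right _ (-S₀) tendsto_id).const_mul_atTop hδ0)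
    refine tendsto_atTop_mono' _ ?_ h1
    filter_upwards [eventually_ge_atTop S₀] with S hS
    linarith [hgrow S hS]
  exact not_tendsto_nhds_of_tendsto_atTop hinf L hL

/-- A subadditive density has infinite volume: for a finite volume `L`, the function
`s ↦ radiusOf g s + radiusOf g (L - s)` would have zero derivative, hence be constant on `(0, L)`,
although radii are unbounded. -/
theorem IsDensity.tendsto_cumVol (hg : IsDensity g) (hsub : DensitySubadditive g) :
    Tendsto (cumVol g) atTop atTop := by
  rcases tendsto_atTop_of_monotone hg.monotone with h | ⟨L, hL⟩
  · exact h
  exfalso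
  have hlt : ∀ r, 0 ≤ r → cumVol g r < L := fun r hr =>
    (hg.strictMonoOn hr (show (0 : ℝ) ≤ r + 1 by linarith) (by linarith)).trans_le
      (hg.monotone.ge_of_tendsto hL _)
  have hsurj : ∀ s ∈ Ioo 0 L, ∃ r, 0 < r ∧ cumVol g r = s := by
    intro s hs
    obtain ⟨b, hb, hb0⟩ := ((hL.eventually_const_lt hs.2).and (eventually_ge_atTop 0)).exists
    obtain ⟨r, hr, hrs⟩ := intermediate_value_Icc hb0 hg.continuous_cumVol.continuousOn
      (show s ∈ Icc (cumVol g 0) (cumVol g b) from ⟨by simpa using hs.1.le, hb.le⟩)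
    refine ⟨r, hr.1.lt_of_ne fun h => ?_, hrs⟩
    rw [← h, cumVol_zero] at hrs
    exact hs.1.ne hrs
  have hder : ∀ s ∈ Ioo 0 L, HasDerivAt (fun s => radiusOf g s + radiusOf g (L - s)) 0 s := by
    intro s hs
    obtain ⟨r, hr, hrs⟩ := hsurj s hs
    obtain ⟨t, ht, hts⟩ := hsurj (L - s) ⟨by linarith [hs.2], by linarith [hs.1]⟩
    have heq : g r = g t := le_antisymm
      (hg.profile_le_of_tendsto hsub hL hr ht (by rw [hrs, hts]; ring))
      (hg.profile_le_of_tendsto hsub hL ht hr (by rw [hrs, hts]; ring))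
    have h1 := hg.hasDerivAt_radiusOf hr
    have h2 := hg.hasDerivAt_radiusOf ht
    rw [hrs] at h1
    rw [hts] at h2
    have h3 := h1.add (h2.comp s ((hasDerivAt_id s).const_sub L))
    rw [heq] at h3
    have h4 : (g t)⁻¹ + (g t)⁻¹ * -1 = 0 := by ring
    rw [h4] at h3
    exact h3
  have hconst : ∀ s ∈ Ioo 0 L, ∀ s' ∈ Ioo 0 L,
      radiusOf g s + radiusOf g (L - s) = radiusOf g s' + radiusOf g (L - s') := by
    intro s hs s' hs'
    exact (isOpen_Ioo).is_const_of_deriv_eq_zero (isPreconnected_Ioo)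
      (fun x hx => (hder x hx).differentiableAt.differentiableWithinAt)
      (fun x hx => (hder x hx).deriv) hs hs'
  have h1 : cumVol g 1 ∈ Ioo 0 L := ⟨hg.cumVol_pos one_pos, hlt 1 zero_le_one⟩
  set c := radiusOf g (cumVol g 1) + radiusOf g (L - cumVol g 1)
  have hr : 0 < |c| + 1 := by positivity
  have hmem : cumVol g (|c| + 1) ∈ Ioo 0 L := ⟨hg.cumVol_pos hr, hlt _ hr.le⟩
  obtain ⟨t, ht, hts⟩ := hsurj (L - cumVol g (|c| + 1))
    ⟨by linarith [hmem.2], by linarith [hmem.1]⟩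
  have := hconst _ hmem _ h1
  rw [← hts, hg.radiusOf_cumVol hr.le, hg.radiusOf_cumVol ht.le] at this
  have := le_abs_self c
  linarith

theorem IsDensity.radiusOf_spec' (hg : IsDensity g) (hV : Tendsto (cumVol g) atTop atTop) {s : ℝ}
    (hs : 0 ≤ s) : 0 ≤ radiusOf g s ∧ cumVol g (radiusOf g s) = s := by
  refine radiusOf_spec ?_
  obtain ⟨b, hb, hb0⟩ := ((hV.eventually_ge_atTop s).and (eventually_ge_atTop 0)).exists
  obtain ⟨r, hr, hrs⟩ := intermediate_value_Icc hb0 hg.continuous_cumVol.continuousOn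
    (show s ∈ Icc (cumVol g 0) (cumVol g b) from ⟨by simpa using hs, hb⟩)
  exact ⟨r, hr.1, hrs⟩

theorem IsDensity.radiusOf_pos (hg : IsDensity g) (hV : Tendsto (cumVol g) atTop atTop) {s : ℝ}
    (hs : 0 < s) : 0 < radiusOf g s := by
  obtain ⟨h0, h1⟩ := hg.radiusOf_spec' hV hs.le
  refine h0.lt_of_ne fun h => ?_
  rw [← h, cumVol_zero] at h1
  exact hs.ne h1

/-- Subadditivity in terms of the enclosed volumes, including the degenerate ones. -/
theorem IsDensity.profile_sub_le (hg : IsDensity g) (hsub : DensitySubadditive g) {A r : ℝ}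
    (hA : 0 ≤ A) (hr : 0 ≤ r) (hAr : A ≤ cumVol g r) :
    g (radiusOf g (cumVol g r - A)) ≤ g r + g (radiusOf g A) := by
  have hV := hg.tendsto_cumVol hsub
  rcases hA.eq_or_lt with rfl | hA
  · rw [sub_zero, hg.radiusOf_cumVol hr]
    linarith [hg.nonneg (radiusOf g 0)]
  rcases hAr.eq_or_lt with hAr | hAr
  · rw [hAr, sub_self, hg.radiusOf_zero, hg.zero 0 le_rfl]
    exact add_nonneg (hg.nonneg _) (hg.nonneg _)
  have hr' : 0 < r := by
    refine hr.lt_of_ne fun h => ?_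
    rw [← h, cumVol_zero] at hAr
    linarith
  refine hsub _ _ _ (hg.radiusOf_pos hV (sub_pos.2 hAr)) hr' (hg.radiusOf_pos hV hA) ?_
  rw [(hg.radiusOf_spec' hV (sub_pos.2 hAr).le).2, (hg.radiusOf_spec' hV hA.le).2]

end

/-! ### A coarea inequality on the half-line -/

section

variable {g : ℝ → ℝ}

/-- A continuous function going from below `c` to above `d` has an excursion inside `(c, d)`. -/
theorem exists_crossing {u : ℝ → ℝ} {x y c d : ℝ} (hxy : x ≤ y) (hu : ContinuousOn u (Icc x y))
    (hc : u x ≤ c) (hd : d ≤ u y) :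
    ∃ x' y', x ≤ x' ∧ x' ≤ y' ∧ y' ≤ y ∧ u x' ≤ c ∧ d ≤ u y' ∧ ∀ r ∈ Ioo x' y', u r ∈ Ioo c d := by
  have hS : IsCompact (Icc x y ∩ u ⁻¹' Ici d) :=
    isCompact_Icc.of_isClosed_subset (hu.preimage_isClosed_of_isClosed isClosed_Icc isClosed_Ici)
      inter_subset_left
  obtain ⟨y', hy', hleast⟩ := hS.exists_isLeast ⟨y, ⟨hxy, le_rfl⟩, hd⟩
  have hu' : ContinuousOn u (Icc x y') := hu.mono (Icc_subset_Icc_right hy'.1.2)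
  have hS' : IsCompact (Icc x y' ∩ u ⁻¹' Iic c) :=
    isCompact_Icc.of_isClosed_subset (hu'.preimage_isClosed_of_isClosed isClosed_Icc isClosed_Iic)
      inter_subset_left
  obtain ⟨x', hx', hgr⟩ := hS'.exists_isGreatest ⟨x, ⟨le_rfl, hy'.1.1⟩, hc⟩
  refine ⟨x', y', hx'.1.1, hx'.1.2, hy'.1.2, hx'.2, hy'.2, fun r hr => ⟨?_, ?_⟩⟩
  · by_contra! h
    exact absurd (hgr ⟨⟨hx'.1.1.trans hr.1.le, hr.2.le⟩, h⟩) (not_le.2 hr.1)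
  · by_contra! h
    exact absurd (hleast ⟨⟨hx'.1.1.trans hr.1.le, hr.2.le.trans hy'.1.2⟩, h⟩) (not_le.2 hr.2)

/-- `q` is an upper gradient of `u` on the open half-line. -/
structure IsUpperGradient (u : ℝ → ℝ) (q : ℝ → ℝ≥0∞) : Prop where
  meas_fun : Measurable u
  cont : ContinuousOn u (Ioi 0)
  meas : Measurable q
  finite : ∀ x y, 0 < x → ∫⁻ r in Ioc x y, q r ≠ ⊤
  le : ∀ x y, 0 < x → x ≤ y → ENNReal.ofReal |u y - u x| ≤ ∫⁻ r in Ioc x y, q r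

variable {u : ℝ → ℝ} {q : ℝ → ℝ≥0∞}

/-- Between `x` and `y`, all levels between `u x` and `u y` are crossed. -/
theorem IsUpperGradient.setLIntegral_levels_le (h : IsUpperGradient u q) {x y : ℝ} (hx : 0 < x)
    (hxy : x ≤ y) {b : ℝ → ℝ≥0∞} (hb : Measurable b) :
    ∫⁻ t in uIoc (u x) (u y), b t ≤ ∫⁻ r in Ioc x y, b (u r) * q r := by
  set m : Measure ℝ := ((volume.restrict (Ioc x y)).withDensity q).map u with hm
  have hfin : IsFiniteMeasure ((volume.restrict (Ioc x y)).withDensity q) :=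
    isFiniteMeasure_withDensity (h.finite x y hx)
  have hcont : ContinuousOn u (Icc x y) := h.cont.mono fun r hr => hx.trans_le hr.1
  have happly : ∀ s, MeasurableSet s → m s = ∫⁻ r in Ioc x y ∩ u ⁻¹' s, q r := by
    intro s hs
    rw [hm, Measure.map_apply h.meas_fun hs, withDensity_apply _ (h.meas_fun hs),
      Measure.restrict_restrict (h.meas_fun hs), inter_comm]
  -- any interval of levels between `u x` and `u y` is traversed by an excursion
  have hexc : ∀ c d, c < d → min (u x) (u y) ≤ c → d ≤ max (u x) (u y) →
      ENNReal.ofReal (d - c) ≤ ∫⁻ r in Ioc x y ∩ u ⁻¹' Ioc c d, q r := by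
    intro c d hcd hc hd
    have key : ∃ x' y', x ≤ x' ∧ x' ≤ y' ∧ y' ≤ y ∧ d - c ≤ |u y' - u x'| ∧
        ∀ r ∈ Ioo x' y', u r ∈ Ioo c d := by
      rcases le_total (u x) (u y) with hle | hle
      · rw [min_eq_left hle] at hc
        rw [max_eq_right hle] at hd
        obtain ⟨x', y', h1, h2, h3, h4, h5, h6⟩ := exists_crossing hxy hcont hc hd
        exact ⟨x', y', h1, h2, h3, (by linarith : d - c ≤ u y' - u x').trans (le_abs_self _), h6⟩
      · rw [min_eq_right hle] at hc
        rw [max_eq_left hle] at hd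
        obtain ⟨x', y', h1, h2, h3, h4, h5, h6⟩ := exists_crossing hxy hcont.neg
          (neg_le_neg hd) (neg_le_neg hc)
        refine ⟨x', y', h1, h2, h3, ?_, fun r hr => ?_⟩
        · have : d - c ≤ -(u y' - u x') := by
            simp only [Pi.neg_apply] at h4 h5
            linarith
          exact this.trans (neg_le_abs _)
        · have := h6 r hr
          simp only [Pi.neg_apply, mem_Ioo] at this
          exact ⟨by linarith [this.2], by linarith [this.1]⟩
    obtain ⟨x', y', h1, h2, h3, h4, h5⟩ := key
    calc ENNReal.ofReal (d - c) ≤ ENNReal.ofReal |u y' - u x'| := ENNReal.ofReal_le_ofReal h4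
      _ ≤ ∫⁻ r in Ioc x' y', q r := h.le x' y' (hx.trans_le h1) h2
      _ = ∫⁻ r in Ioo x' y', q r := setLIntegral_congr Ioo_ae_eq_Ioc.symm
      _ ≤ ∫⁻ r in Ioc x y ∩ u ⁻¹' Ioc c d, q r := lintegral_mono_set
        fun r (hr : r ∈ Ioo x' y') => show r ∈ Ioc x y ∩ u ⁻¹' Ioc c d from
          ⟨⟨h1.trans_lt hr.1, hr.2.le.trans h3⟩, Ioo_subset_Ioc_self (h5 r hr)⟩
  have hle : volume.restrict (uIoc (u x) (u y)) ≤ m := by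
    refine measure_le_of_Ioc fun c d _ => ?_
    rw [Measure.restrict_apply measurableSet_Ioc, uIoc, Ioc_inter_Ioc, Real.volume_Ioc,
      happly _ measurableSet_Ioc]
    rcases le_or_gt (d ⊓ max (u x) (u y)) (c ⊔ min (u x) (u y)) with hlt | hlt
    · rw [ENNReal.ofReal_of_nonpos (by linarith)]
      exact zero_le
    · refine (hexc _ _ hlt le_sup_right inf_le_right).trans (lintegral_mono_set ?_)
      exact inter_subset_inter_right _ (preimage_mono (Ioc_subset_Ioc le_sup_left inf_le_left))
  calc ∫⁻ t in uIoc (u x) (u y), b t ≤ ∫⁻ t, b t ∂m := lintegral_mono' hle le_rfl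
    _ = ∫⁻ r, b (u r) ∂((volume.restrict (Ioc x y)).withDensity q) :=
      lintegral_map hb h.meas_fun
    _ = ∫⁻ r in Ioc x y, b (u r) * q r := by
      refine (lintegral_withDensity_eq_lintegral_mul _ h.meas (hb.comp h.meas_fun)).trans ?_
      exact lintegral_congr fun r => mul_comm _ _

open Classical in
/-- The volume of the union of the cells `(rᵢ₋₁, rᵢ]`, `i ≤ j`, with `r₋₁ = 0`, that are selected by
`c`. -/
def cellVol (g : ℝ → ℝ) (r : ℕ → ℝ) (c : ℕ → Prop) : ℕ → ℝ
  | 0 => if c 0 then cumVol g (r 0) else 0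
  | j + 1 => cellVol g r c j + if c (j + 1) then cumVol g (r (j + 1)) - cumVol g (r j) else 0

theorem IsDensity.cellVol_mem (hg : IsDensity g) {r : ℕ → ℝ} (hr : Monotone r) (hr0 : 0 ≤ r 0)
    (c : ℕ → Prop) (j : ℕ) : cellVol g r c j ∈ Icc 0 (cumVol g (r j)) := by
  induction j with
  | zero =>
    have := hg.cumVol_nonneg hr0
    unfold cellVol
    split_ifs <;> simp [this]
  | succ j ih =>
    have := hg.monotone (hr (Nat.le_succ j))
    rw [Nat.succ_eq_add_one] at this
    unfold cellVol
    split_ifs <;> constructor <;> linarith [ih.1, ih.2]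

open Classical in
/-- Isoperimetric inequality for finite unions of cells: the subadditivity inequality is applied at
each boundary point in turn, to the union of the selected or of the unselected cells, whichever
does not touch that point from below. -/
theorem IsDensity.profile_cellVol_le (hg : IsDensity g) (hsub : DensitySubadditive g) {r : ℕ → ℝ}
    (hr : Monotone r) (hr0 : 0 ≤ r 0) (c : ℕ → Prop) (j : ℕ) :
    g (radiusOf g (if c j then cumVol g (r j) - cellVol g r c j else cellVol g r c j)) ≤
      ∑ i ∈ Finset.range j, if (c i ↔ c (i + 1)) then 0 else g (r i) := by
  induction j with
  | zero =>
    have h0 : (if c 0 then cumVol g (r 0) - cellVol g r c 0 else cellVol g r c 0) = 0 := by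
      unfold cellVol
      split_ifs <;> simp
    rw [h0, hg.radiusOf_zero, hg.zero 0 le_rfl]
    simp
  | succ j ih =>
    rw [Finset.sum_range_succ]
    have hmem := hg.cellVol_mem hr hr0 c j
    have hrj : 0 ≤ r j := hr0.trans (hr (Nat.zero_le j))
    have hsucc : cellVol g r c (j + 1) =
      cellVol g r c j + if c (j + 1) then cumVol g (r (j + 1)) - cumVol g (r j) else 0 := rfl
    by_cases h1 : c j <;> by_cases h2 : c (j + 1)
    · simp only [h1, h2, if_true, hsucc, iff_self, add_zero] at ih ⊢
      convert ih using 3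
      ring
    · simp only [h1, h2, if_true, if_false, hsucc, add_zero, iff_false, not_true_eq_false] at ih ⊢
      have := hg.profile_sub_le hsub (A := cumVol g (r j) - cellVol g r c j) (r := r j)
        (by linarith [hmem.2]) hrj (by linarith [hmem.1])
      rw [sub_sub_cancel] at this
      linarith
    · simp only [h1, h2, if_true, if_false, hsucc, iff_true] at ih ⊢
      have := hg.profile_sub_le hsub (A := cellVol g r c j) (r := r j) hmem.1 hrj hmem.2
      have e : cumVol g (r (j + 1)) - (cellVol g r c j + (cumVol g (r (j + 1)) - cumVol g (r j)))
        = cumVol g (r j) - cellVol g r c j := by ring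
      rw [e]
      linarith
    · simp only [h1, h2, if_false, hsucc, add_zero, iff_self, if_true] at ih ⊢
      exact ih

/-- Upper bound for the volume of selected cells contained in a set `A`, up to the first cell. -/
theorem IsDensity.cellVol_le (hg : IsDensity g) {r : ℕ → ℝ} (hr : Monotone r) (hr0 : 0 ≤ r 0)
    (c : ℕ → Prop) {A : Set ℝ} (j : ℕ)
    (hA : ∀ i < j, c (i + 1) → Ioc (r i) (r (i + 1)) ⊆ A) :
    ENNReal.ofReal (cellVol g r c j) ≤
      ENNReal.ofReal (cumVol g (r 0)) + radMeas g (A ∩ Ioc (r 0) (r j)) := by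
  induction j with
  | zero =>
    refine le_add_right (ENNReal.ofReal_le_ofReal ?_)
    exact (hg.cellVol_mem hr hr0 c 0).2
  | succ j ih =>
    specialize ih fun i hi => hA i (hi.trans (Nat.lt_succ_self j))
    have hle := hr (Nat.le_succ j)
    rw [Nat.succ_eq_add_one] at hle
    unfold cellVol
    by_cases h : c (j + 1)
    · rw [if_pos h, ENNReal.ofReal_add (hg.cellVol_mem hr hr0 c j).1
        (sub_nonneg.2 (hg.monotone hle)), ← hg.radMeas_Ioc hle]
      refine (add_le_add_left ih _).trans ?_
      rw [add_assoc]
      refine add_le_add_right ?_ _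
      rw [← measure_union _ measurableSet_Ioc]
      · refine measure_mono (union_subset (inter_subset_inter_right _
          (Ioc_subset_Ioc_right hle)) (subset_inter (hA j (Nat.lt_succ_self j) h)
          (Ioc_subset_Ioc_left (hr (Nat.zero_le j)))))
      · refine Disjoint.mono_left inter_subset_right ?_
        exact Ioc_disjoint_Ioc_of_le le_rfl
    · rw [if_neg h, add_zero]
      exact ih.trans (add_le_add_right (measure_mono (inter_subset_inter_right _
        (Ioc_subset_Ioc_right hle))) _)

/-- Lower bound for the volume of selected cells covering a set `A`, up to the first cell. -/
theorem IsDensity.le_cellVol (hg : IsDensity g) {r : ℕ → ℝ} (hr : Monotone r) (hr0 : 0 ≤ r 0)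
    (c : ℕ → Prop) {A : Set ℝ} (j : ℕ)
    (hA : ∀ i < j, ∀ x ∈ Ioc (r i) (r (i + 1)), x ∈ A → c (i + 1)) :
    radMeas g (A ∩ Iic (r j)) ≤
      ENNReal.ofReal (cumVol g (r 0)) + ENNReal.ofReal (cellVol g r c j) := by
  induction j with
  | zero =>
    refine le_add_right ((measure_mono inter_subset_right).trans (hg.radMeas_Iic hr0).le)
  | succ j ih =>
    specialize ih fun i hi => hA i (hi.trans (Nat.lt_succ_self j))
    have hle := hr (Nat.le_succ j)
    rw [Nat.succ_eq_add_one] at hle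
    unfold cellVol
    have hsplit : A ∩ Iic (r (j + 1)) ⊆ (A ∩ Iic (r j)) ∪ (A ∩ Ioc (r j) (r (j + 1))) := by
      rw [← inter_union_distrib_left, Iic_union_Ioc_eq_Iic hle]
    refine (measure_mono hsplit).trans ((measure_union_le _ _).trans ?_)
    by_cases h : c (j + 1)
    · rw [if_pos h, ENNReal.ofReal_add (hg.cellVol_mem hr hr0 c j).1
        (sub_nonneg.2 (hg.monotone hle)), ← hg.radMeas_Ioc hle, ← add_assoc]
      exact add_le_add ih (measure_mono inter_subset_right)
    · have hemp : A ∩ Ioc (r j) (r (j + 1)) = ∅ := by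
        refine eq_empty_of_forall_notMem fun x hx => ?_
        exact h (hA j (Nat.lt_succ_self j) x hx.2 hx.1)
      rw [if_neg h, add_zero, hemp, measure_empty, add_zero]
      exact ih

/-- Partitions of `[a, b]` on whose cells `u` oscillates by at most `ε` and `g` is almost
constant. -/
theorem IsDensity.exists_partition (hg : IsDensity g) (hu : ContinuousOn u (Ioi 0)) {a b ε : ℝ}
    (ha : 0 < a) (hab : a < b) (hε : 0 < ε) :
    ∃ (K : ℕ) (r : ℕ → ℝ), Monotone r ∧ r 0 = a ∧ r K = b ∧
      ∀ i < K, ∀ s ∈ Icc (r i) (r (i + 1)),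
        |u s - u (r (i + 1))| < ε ∧ g (r i) ≤ (1 + ε) * g s := by
  have hu' : ContinuousOn u (Icc a b) := hu.mono fun r hr => ha.trans_le hr.1
  obtain ⟨x₀, hx₀, hmin⟩ := isCompact_Icc.exists_isMinOn (nonempty_Icc.2 hab.le)
    (hg.cont.continuousOn (s := Icc a b))
  have hm : 0 < g x₀ := hg.pos _ (ha.trans_le hx₀.1)
  obtain ⟨δ₁, hδ₁, h1⟩ := Metric.uniformContinuousOn_iff.1
    (isCompact_Icc.uniformContinuousOn_of_continuous hu') ε hε
  obtain ⟨δ₂, hδ₂, h2⟩ := Metric.uniformContinuousOn_iff.1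
    (isCompact_Icc.uniformContinuousOn_of_continuous (hg.cont.continuousOn (s := Icc a b)))
    (ε * g x₀) (by positivity)
  obtain ⟨K, hK⟩ := exists_nat_gt ((b - a) / min δ₁ δ₂)
  have hδ : 0 < min δ₁ δ₂ := lt_min hδ₁ hδ₂
  have hK0 : (0 : ℝ) < K := lt_of_le_of_lt (div_nonneg (by linarith) hδ.le) hK
  set h := (b - a) / K with hh
  have hh0 : 0 < h := div_pos (by linarith) hK0
  have hhδ : h < min δ₁ δ₂ := by
    rw [div_lt_iff₀ hδ] at hK
    rw [hh, div_lt_iff₀ hK0]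
    linarith
  refine ⟨K, fun i => a + i * h, fun i j hij => ?_, by simp, ?_, fun i hi s hs => ?_⟩
  · have : (i : ℝ) ≤ j := by exact_mod_cast hij
    have := mul_le_mul_of_nonneg_right this hh0.le
    simpa using this
  · simp only [hh]
    field_simp
    ring
  · have hi' : ((i : ℝ) + 1) ≤ K := by exact_mod_cast hi
    have hKh : (K : ℝ) * h = b - a := by rw [hh]; field_simp
    have hi1 : ((i : ℝ) + 1) * h ≤ b - a := hKh ▸ mul_le_mul_of_nonneg_right hi' hh0.le
    have hi0 : 0 ≤ (i : ℝ) * h := by positivity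
    push_cast at hs ⊢
    have e : ((i : ℝ) + 1) * h = i * h + h := by ring
    have hsab : s ∈ Icc a b := ⟨by linarith [hs.1], by linarith [hs.2]⟩
    constructor
    · have := h1 s hsab (a + (i + 1) * h) ⟨by linarith, by linarith⟩ (by
        rw [Real.dist_eq, abs_lt]
        constructor <;> linarith [hs.1, hs.2, hhδ.trans_le (min_le_left δ₁ δ₂)])
      rwa [Real.dist_eq] at this
    · have := h2 (a + i * h) ⟨by linarith, by linarith⟩ s hsab (by
        rw [Real.dist_eq, abs_lt]
        constructor <;> linarith [hs.1, hs.2, hhδ.trans_le (min_le_right δ₁ δ₂)])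
      rw [Real.dist_eq] at this
      have h3 : g x₀ ≤ g s := hmin hsab
      nlinarith [(abs_lt.1 this).2]

/-- The radius of the ball with the same volume as the superlevel set `{u > t}`. -/
def levelRadius (g u : ℝ → ℝ) (t : ℝ) : ℝ := radiusOf g (radMeas g {r | t < u r}).toReal

/-- The perimeter, weighted by `g`, of the union of the cells `(rᵢ₋₁, rᵢ]` with `u (rᵢ) > t`. -/
def cellPerimeter (g u : ℝ → ℝ) (r : ℕ → ℝ) (K : ℕ) (t : ℝ) : ℝ≥0∞ :=
  ∑ i ∈ Finset.range K, indicator {t | ¬ (t < u (r i) ↔ t < u (r (i + 1)))}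
    (fun _ => ENNReal.ofReal (g (r i))) t

theorem measurableSet_levels (x y : ℝ) : MeasurableSet {t : ℝ | ¬ (t < x ↔ t < y)} := by
  have : {t : ℝ | ¬ (t < x ↔ t < y)} = Ico (min x y) (max x y) := by
    ext t
    simp only [mem_ofPred_eq, mem_Ico, min_le_iff, lt_max_iff]
    constructor
    · intro h
      by_cases h1 : t < x <;> by_cases h2 : t < y <;> simp_all
    · rintro ⟨h1 | h1, h2 | h2⟩ <;> simp [h2, not_lt.2 h1] <;> linarith
  rw [this]
  exact measurableSet_Ico

theorem levels_ae_le (x y : ℝ) : {t : ℝ | ¬ (t < x ↔ t < y)} ≤ᵐ[volume] uIoc x y := by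
  have h1 : {t : ℝ | ¬ (t < x ↔ t < y)} ⊆ Ico (min x y) (max x y) := by
    intro t h
    simp only [mem_ofPred_eq, mem_Ico, min_le_iff, lt_max_iff] at *
    by_cases h1 : t < x <;> by_cases h2 : t < y <;> simp_all
  exact h1.eventuallyLE.trans (Ico_ae_eq_Ioc (a := min x y) (b := max x y)).le

theorem measurable_cellPerimeter (r : ℕ → ℝ) (K : ℕ) : Measurable (cellPerimeter g u r K) := by
  unfold cellPerimeter
  exact Finset.measurable_sum _ fun i _ =>
    measurable_const.indicator (measurableSet_levels _ _)

/-- Coarea inequality for the approximation of the superlevel sets by cells. -/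
theorem IsUpperGradient.lintegral_cellPerimeter_le (h : IsUpperGradient u q) (hg : IsDensity g)
    {r : ℕ → ℝ} (hr : Monotone r) (hr0 : 0 < r 0) {K : ℕ} {ε : ℝ} (hε : 0 ≤ ε)
    (hK : ∀ i < K, ∀ s ∈ Icc (r i) (r (i + 1)), g (r i) ≤ (1 + ε) * g s)
    {b : ℝ → ℝ≥0∞} (hb : Measurable b) :
    ∫⁻ t, b t * cellPerimeter g u r K t ≤
      ENNReal.ofReal (1 + ε) * ∫⁻ s, b (u s) * q s ∂(radMeas g) := by
  have hF : Measurable fun s => b (u s) * q s := (hb.comp h.meas_fun).mul h.meas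
  have hcell : ∀ i < K, ∫⁻ t, b t * indicator {t | ¬ (t < u (r i) ↔ t < u (r (i + 1)))}
      (fun _ => ENNReal.ofReal (g (r i))) t ≤ ENNReal.ofReal (1 + ε) *
        ∫⁻ s in Ioc (r i) (r (i + 1)), ENNReal.ofReal (g s) * (b (u s) * q s) := by
    intro i hi
    have h0 : 0 < r i := hr0.trans_le (hr (Nat.zero_le i))
    have hle := hr (Nat.le_succ i)
    calc ∫⁻ t, b t * indicator {t | ¬ (t < u (r i) ↔ t < u (r (i + 1)))}
          (fun _ => ENNReal.ofReal (g (r i))) t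
        = ∫⁻ t in {t | ¬ (t < u (r i) ↔ t < u (r (i + 1)))}, b t * ENNReal.ofReal (g (r i)) := by
          rw [← lintegral_indicator (measurableSet_levels _ _)]
          refine lintegral_congr fun t => ?_
          by_cases ht : t ∈ {t | ¬ (t < u (r i) ↔ t < u (r (i + 1)))}
          · rw [indicator_of_mem ht, indicator_of_mem ht]
          · rw [indicator_of_notMem ht, indicator_of_notMem ht, mul_zero]
      _ = (∫⁻ t in {t | ¬ (t < u (r i) ↔ t < u (r (i + 1)))}, b t) * ENNReal.ofReal (g (r i)) :=
          lintegral_mul_const _ hb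
      _ ≤ (∫⁻ t in uIoc (u (r i)) (u (r (i + 1))), b t) * ENNReal.ofReal (g (r i)) := by
          refine mul_le_mul_left ?_ _
          exact lintegral_mono' (Measure.restrict_mono_ae (levels_ae_le _ _)) le_rfl
      _ ≤ (∫⁻ s in Ioc (r i) (r (i + 1)), b (u s) * q s) * ENNReal.ofReal (g (r i)) := by
          refine mul_le_mul_left ?_ _
          exact h.setLIntegral_levels_le h0 hle hb
      _ = ∫⁻ s in Ioc (r i) (r (i + 1)), (b (u s) * q s) * ENNReal.ofReal (g (r i)) :=
          (lintegral_mul_const _ hF).symm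
      _ ≤ ∫⁻ s in Ioc (r i) (r (i + 1)),
            ENNReal.ofReal (1 + ε) * (ENNReal.ofReal (g s) * (b (u s) * q s)) := by
          refine setLIntegral_mono' measurableSet_Ioc fun s hs => ?_
          rw [mul_comm, ← mul_assoc (ENNReal.ofReal (1 + ε)), ← ENNReal.ofReal_mul (by linarith)]
          refine mul_le_mul_left (ENNReal.ofReal_le_ofReal ?_) _
          exact hK i hi s (Ioc_subset_Icc_self hs)
      _ = _ := lintegral_const_mul _ (hg.cont.measurable.ennreal_ofReal.mul hF)
  have hsum : ∀ j ≤ K, ∑ i ∈ Finset.range j, ∫⁻ t, b t *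
      indicator {t | ¬ (t < u (r i) ↔ t < u (r (i + 1)))} (fun _ => ENNReal.ofReal (g (r i))) t ≤
      ENNReal.ofReal (1 + ε) *
        ∫⁻ s in Ioc (r 0) (r j), ENNReal.ofReal (g s) * (b (u s) * q s) := by
    intro j
    induction j with
    | zero => simp
    | succ j ih =>
      intro hj
      rw [Finset.sum_range_succ, ← Ioc_union_Ioc_eq_Ioc (hr (Nat.zero_le j)) (hr (Nat.le_succ j)),
        lintegral_union measurableSet_Ioc (Ioc_disjoint_Ioc_of_le le_rfl), mul_add]
      exact add_le_add (ih (by omega)) (hcell j (by omega))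
  calc ∫⁻ t, b t * cellPerimeter g u r K t
      = ∑ i ∈ Finset.range K, ∫⁻ t, b t * indicator {t | ¬ (t < u (r i) ↔ t < u (r (i + 1)))}
          (fun _ => ENNReal.ofReal (g (r i))) t := by
        simp only [cellPerimeter, Finset.mul_sum]
        exact lintegral_finsetSum _ fun i _ =>
          hb.mul (measurable_const.indicator (measurableSet_levels _ _))
    _ ≤ _ := hsum K le_rfl
    _ ≤ ENNReal.ofReal (1 + ε) * ∫⁻ s, b (u s) * q s ∂(radMeas g) := by
        rw [hg.lintegral_radMeas]
        gcongr
        exact Measure.restrict_le_self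

/-- The perimeter of the union of cells bounds the perimeter of the ball with the same volume. -/
theorem IsDensity.profile_le_cellPerimeter (hg : IsDensity g) (hsub : DensitySubadditive g)
    {r : ℕ → ℝ} (hr : Monotone r) (hr0 : 0 ≤ r 0) {K : ℕ} {t : ℝ} (hK : u (r K) ≤ t) :
    ENNReal.ofReal (g (radiusOf g (cellVol g r (fun i => t < u (r i)) K))) ≤
      cellPerimeter g u r K t := by
  classical
  have h1 := hg.profile_cellVol_le hsub hr hr0 (fun i => t < u (r i)) K
  rw [if_neg (not_lt.2 hK)] at h1
  refine (ENNReal.ofReal_le_ofReal h1).trans (le_of_eq ?_)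
  rw [ENNReal.ofReal_sum_of_nonneg, cellPerimeter]
  · refine Finset.sum_congr rfl fun i _ => ?_
    by_cases h : (t < u (r i) ↔ t < u (r (i + 1)))
    · rw [if_pos h, indicator_of_notMem (by simpa using h), ENNReal.ofReal_zero]
    · rw [if_neg h, indicator_of_mem (by simpa using h)]
  · intro i _
    split_ifs
    · exact le_rfl
    · exact hg.nonneg _

theorem IsDensity.radMeas_Ioi (hg : IsDensity g) (hV : Tendsto (cumVol g) atTop atTop) (c : ℝ) :
    radMeas g (Ioi c) = ⊤ := by
  refine ENNReal.eq_top_of_forall_nnreal_le fun M => ?_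
  obtain ⟨b, hb, hcb⟩ := ((hV.eventually_ge_atTop (M + cumVol g c)).and
    (eventually_ge_atTop c)).exists
  calc (M : ℝ≥0∞) ≤ ENNReal.ofReal (cumVol g b - cumVol g c) := by
        rw [← ENNReal.ofReal_coe_nnreal]
        exact ENNReal.ofReal_le_ofReal (by linarith)
    _ = radMeas g (Ioc c b) := (hg.radMeas_Ioc hcb).symm
    _ ≤ _ := measure_mono Ioc_subset_Ioi_self

/-- The inequality between perimeters integrated over the levels `t > α > 0`. Superlevel sets are
approximated by unions of cells of finer and finer partitions of `[ε, β]`, where `u β ≤ α`: at every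
level which is not a plateau their volumes converge, and Fatou's lemma applies. -/
theorem IsUpperGradient.lintegral_profile_le_of_pos (h : IsUpperGradient u q) (hg : IsDensity g)
    (hsub : DensitySubadditive g) (hfin : ∀ t, 0 < t → radMeas g {r | t < u r} ≠ ⊤) {α : ℝ}
    (hα : 0 < α) {b : ℝ → ℝ≥0∞} (hb : Measurable b) :
    ∫⁻ t in Ioi α, b t * ENNReal.ofReal (g (levelRadius g u t)) ≤
      ∫⁻ r, b (u r) * q r ∂(radMeas g) := by
  have hV := hg.tendsto_cumVol hsub
  set ε : ℕ → ℝ := fun N => 1 / ((N : ℝ) + 1) with hεdef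
  have hε : ∀ N, 0 < ε N := fun N => by positivity
  have hεlim : Tendsto ε atTop (𝓝 0) := tendsto_one_div_add_atTop_nhds_zero_nat
  have hε1 : ∀ N, ε N ≤ 1 := fun N => by
    rw [hεdef]
    simp only
    rw [div_le_one (by positivity)]
    linarith [(Nat.cast_nonneg N : (0 : ℝ) ≤ N)]
  have hεanti : Antitone ε := fun i j hij => one_div_le_one_div_of_le (by positivity)
    (by exact_mod_cast Nat.succ_le_succ hij)
  -- arbitrarily far points where `u ≤ α`, since the volume is infinite
  have hfar : ∀ N : ℕ, ∃ x : ℝ, (N : ℝ) + 1 < x ∧ u x ≤ α := by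
    intro N
    by_contra! hcon
    refine hfin α hα (top_le_iff.1 ?_)
    rw [← hg.radMeas_Ioi hV ((N : ℝ) + 1)]
    exact measure_mono fun x hx => hcon x hx
  choose β hβN hβ using hfar
  have hpart := fun N : ℕ => hg.exists_partition h.cont (hε N)
    ((hε1 N).trans_lt (lt_of_le_of_lt (by linarith [(Nat.cast_nonneg N : (0 : ℝ) ≤ N)]) (hβN N)))
    (hε N)
  choose K r hmono hr0 hrK hcell using hpart
  have hr0' : ∀ N, 0 < r N 0 := fun N => (hr0 N).symm ▸ hε N
  set b' : ℝ → ℝ≥0∞ := indicator (Ioi α) b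
  have hb' : Measurable b' := hb.indicator measurableSet_Ioi
  have hbb' : ∀ t, b' t ≤ b t := fun t => indicator_le_self _ _ t
  set X := ∫⁻ r, b (u r) * q r ∂(radMeas g)
  have hbound : ∀ N, ∫⁻ t, b' t * cellPerimeter g u (r N) (K N) t ≤
      ENNReal.ofReal (1 + ε N) * X := by
    intro N
    refine (h.lintegral_cellPerimeter_le hg (hmono N) (hr0' N) (hε N).le
      (fun i hi s hs => (hcell N i hi s hs).2) hb').trans ?_
    gcongr
    exact lintegral_mono fun s => mul_le_mul_left (hbb' _) _
  -- the volumes of the unions of cells converge to the volume of the superlevel set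
  have hvol : ∀ t, α < t → radMeas g {r | u r = t} = 0 →
      Tendsto (fun N => cellVol g (r N) (fun i => t < u (r N i)) (K N)) atTop
        (𝓝 (radMeas g {r | t < u r}).toReal) := by
    intro t ht hnull
    have ht0 := hα.trans ht
    have hcv0 : Tendsto (fun N => ENNReal.ofReal (cumVol g (r N 0))) atTop (𝓝 0) := by
      have h1 : Tendsto (fun N => cumVol g (r N 0)) atTop (𝓝 0) := by
        simp only [hr0]
        have := (hg.continuous_cumVol.tendsto 0).comp hεlim
        rwa [cumVol_zero] at this
      simpa using ENNReal.tendsto_ofReal h1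
    have hup : Tendsto (fun N => ENNReal.ofReal (cumVol g (r N 0)) +
        radMeas g {x | t - ε N < u x}) atTop (𝓝 (radMeas g {r | t < u r})) := by
      have h1 : Tendsto (fun N => radMeas g {x | t - ε N < u x}) atTop
          (𝓝 (radMeas g (⋂ N, {x | t - ε N < u x}))) := by
        refine tendsto_measure_iInter_atTop
          (fun N => (measurableSet_lt measurable_const h.meas_fun).nullMeasurableSet)
          (fun i j hij x hx => ?_) ?_
        · have := hεanti hij
          simp only [mem_ofPred_eq] at hx ⊢
          linarith
        · obtain ⟨N, hN⟩ := (hεlim.eventually_lt_const ht0).exists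
          exact ⟨N, hfin _ (by linarith)⟩
      have h2 : radMeas g (⋂ N, {x | t - ε N < u x}) = radMeas g {r | t < u r} := by
        have hset : (⋂ N, {x | t - ε N < u x}) ⊆ {r | t < u r} ∪ {r | u r = t} := by
          intro x hx
          simp only [mem_iInter, mem_ofPred_eq] at hx
          have : t ≤ u x := by
            have := ge_of_tendsto' (hεlim.const_add (u x)) (fun N => (by linarith [hx N] :
              t ≤ u x + ε N))
            simpa using this
          rcases this.eq_or_lt with h' | h'
          · exact Or.inr h'.symm
          · exact Or.inl h'
        refine le_antisymm ((measure_mono hset).trans ((measure_union_le _ _).trans ?_)) ?_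
        · rw [hnull, add_zero]
        · refine measure_mono fun x hx => mem_iInter.2 fun N => ?_
          have : t < u x := hx
          simp only [mem_ofPred_eq]
          linarith [hε N]
      rw [h2] at h1
      simpa using hcv0.add h1
    have hlow : Tendsto (fun N : ℕ => radMeas g ({x | t + ε N < u x} ∩ Iic (N : ℝ)) -
        ENNReal.ofReal (cumVol g (r N 0))) atTop (𝓝 (radMeas g {r | t < u r})) := by
      have h1 : Tendsto (fun N : ℕ => radMeas g ({x | t + ε N < u x} ∩ Iic (N : ℝ))) atTop
          (𝓝 (radMeas g (⋃ N : ℕ, {x | t + ε N < u x} ∩ Iic (N : ℝ)))) := by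
        refine tendsto_measure_iUnion_atTop fun i j hij x hx => ⟨?_, ?_⟩
        · have := hεanti hij
          have h3 := hx.1
          simp only [mem_ofPred_eq] at h3 ⊢
          linarith
        · exact Iic_subset_Iic.2 (by exact_mod_cast hij) hx.2
      have h2 : (⋃ N : ℕ, {x | t + ε N < u x} ∩ Iic (N : ℝ)) = {r | t < u r} := by
        ext x
        simp only [mem_iUnion, mem_inter_iff, mem_ofPred_eq, mem_Iic]
        constructor
        · rintro ⟨N, h3, _⟩
          linarith [hε N]
        · intro hx
          obtain ⟨N, h3, h4⟩ := ((hεlim.eventually_lt_const (sub_pos.2 hx)).and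
            (tendsto_natCast_atTop_atTop.eventually_ge_atTop x)).exists
          exact ⟨N, by linarith, h4⟩
      rw [h2] at h1
      have := ENNReal.Tendsto.sub h1 hcv0 (Or.inr ENNReal.zero_ne_top)
      simpa using this
    have hconv : Tendsto (fun N => ENNReal.ofReal
        (cellVol g (r N) (fun i => t < u (r N i)) (K N))) atTop
        (𝓝 (radMeas g {r | t < u r})) := by
      refine tendsto_of_tendsto_of_tendsto_of_le_of_le hlow hup (fun N => ?_) (fun N => ?_)
      · simp only
        refine tsub_le_iff_left.2 ?_
        refine le_trans (measure_mono (inter_subset_inter_right _ (Iic_subset_Iic.2 ?_)))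
          (hg.le_cellVol (hmono N) (hr0' N).le _ (K N) (A := {x | t + ε N < u x}) ?_)
        · rw [hrK]
          linarith [hβN N]
        · intro i hi x hx hxA
          have := (hcell N i hi x (Ioc_subset_Icc_self hx)).1
          simp only [mem_ofPred_eq] at hxA
          linarith [(abs_lt.1 this).2]
      · refine (hg.cellVol_le (hmono N) (hr0' N).le _ (K N) (A := {x | t - ε N < u x}) ?_).trans
          (add_le_add_right (measure_mono inter_subset_left) _)
        intro i hi hc x hx
        have := (hcell N i hi x (Ioc_subset_Icc_self hx)).1
        simp only [mem_ofPred_eq]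
        linarith [(abs_lt.1 this).1]
    have := (ENNReal.tendsto_toReal (hfin t ht0)).comp hconv
    refine this.congr fun N => ?_
    exact ENNReal.toReal_ofReal (hg.cellVol_mem (hmono N) (hr0' N).le _ _).1
  have hcount : {t : ℝ | 0 < radMeas g {r | u r = t}}.Countable :=
    Measure.countable_meas_level_set_pos h.meas_fun
  have hlim : ∀ᵐ t, b' t * ENNReal.ofReal (g (levelRadius g u t)) ≤
      liminf (fun N => b' t * cellPerimeter g u (r N) (K N) t) atTop := by
    filter_upwards [hcount.ae_notMem volume] with t htc
    by_cases ht : α < t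
    · have hnull : radMeas g {r | u r = t} = 0 := by simpa using htc
      have h1 := hvol t ht hnull
      rcases (ENNReal.toReal_nonneg : 0 ≤ (radMeas g {r | t < u r}).toReal).eq_or_lt with h0 | h0
      · rw [levelRadius, ← h0, hg.radiusOf_zero, hg.zero 0 le_rfl, ENNReal.ofReal_zero, mul_zero]
        exact zero_le
      · have h3 := hg.radiusOf_spec' hV h0.le
        have hR := hg.radiusOf_pos hV h0
        have h4 := hg.continuousAt_radiusOf hR
        rw [h3.2] at h4
        have h5 := ENNReal.tendsto_ofReal ((hg.cont.tendsto _).comp (h4.tendsto.comp h1))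
        have h6 := ENNReal.Tendsto.const_mul h5 (a := b' t)
          (Or.inl (by simpa using hg.pos _ hR))
        rw [levelRadius, ← h6.liminf_eq]
        refine liminf_le_liminf (Eventually.of_forall fun N => mul_le_mul_right ?_ _)
        exact hg.profile_le_cellPerimeter hsub (hmono N) (hr0' N).le
          (by rw [hrK]; exact (hβ N).trans ht.le)
    · have : b' t = 0 := indicator_of_notMem (by simpa using ht) _
      simp [this]
  calc ∫⁻ t in Ioi α, b t * ENNReal.ofReal (g (levelRadius g u t))
      = ∫⁻ t, b' t * ENNReal.ofReal (g (levelRadius g u t)) := by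
        rw [← lintegral_indicator measurableSet_Ioi]
        refine lintegral_congr fun t => ?_
        exact indicator_mul_left _ _ _
    _ ≤ ∫⁻ t, liminf (fun N => b' t * cellPerimeter g u (r N) (K N) t) atTop :=
        lintegral_mono_ae hlim
    _ ≤ liminf (fun N => ∫⁻ t, b' t * cellPerimeter g u (r N) (K N) t) atTop :=
        lintegral_liminf_le fun N => hb'.mul (measurable_cellPerimeter _ _)
    _ ≤ liminf (fun N => ENNReal.ofReal (1 + ε N) * X) atTop :=
        liminf_le_liminf (Eventually.of_forall hbound)
    _ = X := by
        have h1 : Tendsto (fun N => ENNReal.ofReal (1 + ε N)) atTop (𝓝 1) := by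
          simpa using ENNReal.tendsto_ofReal (hεlim.const_add 1)
        have h2 := ENNReal.Tendsto.mul_const h1 (b := X) (Or.inl one_ne_zero)
        rw [one_mul] at h2
        exact h2.liminf_eq

/-- Coarea inequality combined with the isoperimetric inequality: integrating the perimeters of the
balls with the volumes of the superlevel sets of `u` gives at most the integral of an upper
gradient of `u`. -/
theorem IsUpperGradient.lintegral_profile_le (h : IsUpperGradient u q) (hg : IsDensity g)
    (hsub : DensitySubadditive g) (hfin : ∀ t, 0 < t → radMeas g {r | t < u r} ≠ ⊤)
    {b : ℝ → ℝ≥0∞} (hb : Measurable b) :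
    ∫⁻ t in Ioi 0, b t * ENNReal.ofReal (g (levelRadius g u t)) ≤
      ∫⁻ r, b (u r) * q r ∂(radMeas g) := by
  have hU : Ioi (0 : ℝ) = ⋃ N : ℕ, Ioi (1 / ((N : ℝ) + 1)) := by
    ext t
    simp only [mem_Ioi, mem_iUnion]
    exact ⟨exists_nat_one_div_lt, fun ⟨N, hN⟩ => lt_trans (by positivity) hN⟩
  have hdir : Directed (· ⊆ ·) fun N : ℕ => Ioi (1 / ((N : ℝ) + 1)) := by
    refine Monotone.directed_le fun i j hij => Ioi_subset_Ioi ?_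
    exact one_div_le_one_div_of_le (by positivity) (by exact_mod_cast Nat.succ_le_succ hij)
  rw [hU, setLIntegral_iUnion_of_directed _ hdir]
  exact iSup_le fun N => h.lintegral_profile_le_of_pos hg hsub hfin (by positivity) hb

end

/-! ### The rearrangement of a function on the half-line -/

section

variable {g : ℝ → ℝ} {u : ℝ → ℝ} {q : ℝ → ℝ≥0∞}

/-- Cauchy–Schwarz inequality for the lower Lebesgue integral. -/
theorem sq_lintegral_mul_le {α : Type*} [MeasurableSpace α] (μ : Measure α) {f k : α → ℝ≥0∞}
    (hf : AEMeasurable f μ) (hk : AEMeasurable k μ) :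
    (∫⁻ x, f x * k x ∂μ) ^ 2 ≤ (∫⁻ x, f x ^ 2 ∂μ) * ∫⁻ x, k x ^ 2 ∂μ := by
  have h := ENNReal.lintegral_mul_le_Lp_mul_Lq μ Real.HolderConjugate.two_two hf hk
  simp only [Pi.mul_apply, ENNReal.rpow_two] at h
  have h2 : ∀ x : ℝ≥0∞, (x ^ (1 / 2 : ℝ)) ^ 2 = x := fun x => by
    rw [← ENNReal.rpow_two, ← ENNReal.rpow_mul]
    norm_num
  calc _ ≤ ((∫⁻ x, f x ^ 2 ∂μ) ^ (1 / 2 : ℝ) * (∫⁻ x, k x ^ 2 ∂μ) ^ (1 / 2 : ℝ)) ^ 2 := by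
        gcongr
    _ = _ := by rw [mul_pow, h2, h2]

theorem IsDensity.measurable_levelRadius (hg : IsDensity g)
    (hV : Tendsto (cumVol g) atTop atTop) (u : ℝ → ℝ) : Measurable (levelRadius g u) := by
  have h1 : Monotone fun s => radiusOf g (max s 0) := by
    intro a b hab
    obtain ⟨h1, h2⟩ := hg.radiusOf_spec' hV (le_max_right a 0)
    obtain ⟨h3, h4⟩ := hg.radiusOf_spec' hV (le_max_right b 0)
    rw [← hg.strictMonoOn.le_iff_le h1 h3, h2, h4]
    exact max_le_max_right 0 hab
  have h2 : Antitone fun t => radMeas g {r | t < u r} := fun a b hab =>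
    measure_mono fun r hr => lt_of_le_of_lt hab hr
  have h3 := h1.measurable.comp h2.measurable.ennreal_toReal
  convert h3 using 1
  funext t
  simp [levelRadius, ENNReal.toReal_nonneg]

theorem IsDensity.levelRadius_spec (hg : IsDensity g) (hV : Tendsto (cumVol g) atTop atTop)
    (u : ℝ → ℝ) (t : ℝ) : 0 ≤ levelRadius g u t ∧
      cumVol g (levelRadius g u t) = (radMeas g {r | t < u r}).toReal :=
  hg.radiusOf_spec' hV ENNReal.toReal_nonneg

theorem IsDensity.ofReal_cumVol_lt_iff (hg : IsDensity g) (hV : Tendsto (cumVol g) atTop atTop)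
    {t : ℝ} (hfin : radMeas g {r | t < u r} ≠ ⊤) {r : ℝ} (hr : 0 ≤ r) :
    ENNReal.ofReal (cumVol g r) < radMeas g {r | t < u r} ↔ r < levelRadius g u t := by
  obtain ⟨h1, h2⟩ := hg.levelRadius_spec hV u t
  rw [← hg.strictMonoOn.lt_iff_lt hr h1, h2, ← ENNReal.ofReal_toReal hfin,
    ENNReal.ofReal_lt_ofReal_iff_of_nonneg (hg.cumVol_nonneg hr),
    ENNReal.toReal_ofReal ENNReal.toReal_nonneg]

/-- Equimeasurability: away from the levels of plateaus, composing `u` with the radii of its own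
superlevel sets does not increase the volume of intervals. Compactness allows restricting to sets of
levels that have a least and a greatest element. -/
theorem IsDensity.radMeas_levels_le (hg : IsDensity g) (hV : Tendsto (cumVol g) atTop atTop)
    (hu : Measurable u) (hfin : ∀ t, 0 < t → radMeas g {r | t < u r} ≠ ⊤) {J : Set ℝ}
    (hJ : MeasurableSet J) (hJ0 : ∀ t ∈ J, 0 < t ∧ radMeas g {r | u r = t} = 0) {a b : ℝ}
    (hab : a ≤ b) (hJab : ∀ t ∈ J, levelRadius g u t ∈ Icc a b) :
    radMeas g (u ⁻¹' J) ≤ radMeas g (Ioc a b) := by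
  have hlevel : ∀ t, 0 < t → radMeas g {r | t < u r} =
      ENNReal.ofReal (cumVol g (levelRadius g u t)) := fun t ht => by
    rw [(hg.levelRadius_spec hV u t).2, ENNReal.ofReal_toReal (hfin t ht)]
  have hJU : J = ⋃ k : ℕ, J ∩ Ioi (1 / ((k : ℝ) + 1)) := by
    ext t
    simp only [mem_iUnion, mem_inter_iff, mem_Ioi]
    exact ⟨fun h => (exists_nat_one_div_lt (hJ0 t h).1).imp fun k hk => ⟨h, hk⟩,
      fun ⟨_, h, _⟩ => h⟩
  have hmono : Monotone fun k : ℕ => u ⁻¹' (J ∩ Ioi (1 / ((k : ℝ) + 1))) := fun i j hij =>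
    preimage_mono (inter_subset_inter_right _ (Ioi_subset_Ioi
      (one_div_le_one_div_of_le (by positivity) (by exact_mod_cast Nat.succ_le_succ hij))))
  rw [hJU, preimage_iUnion, hmono.measure_iUnion]
  refine iSup_le fun k => ?_
  set α : ℝ := 1 / ((k : ℝ) + 1)
  have hα : 0 < α := by positivity
  set π : Measure ℝ := ((radMeas g).map u).restrict (Ioi α) with hπ
  have hπfin : IsFiniteMeasure π := ⟨by
    rw [hπ, Measure.restrict_apply_univ, Measure.map_apply hu measurableSet_Ioi]
    exact (hfin α hα).lt_top⟩
  have hπJ : π J = radMeas g (u ⁻¹' (J ∩ Ioi α)) := by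
    rw [hπ, Measure.restrict_apply hJ, Measure.map_apply hu (hJ.inter measurableSet_Ioi)]
  rw [← hπJ]
  by_contra! hlt
  obtain ⟨K, hKJ, hK, hlt'⟩ := hJ.exists_lt_isCompact_of_ne_top (measure_ne_top π J) hlt
  have hKne : K.Nonempty := by
    rw [nonempty_iff_ne_empty]
    rintro rfl
    simp at hlt'
  obtain ⟨s, hsK, hs⟩ := hK.exists_isLeast hKne
  obtain ⟨s', hsK', hs'⟩ := hK.exists_isGreatest hKne
  have hs0 := hJ0 s (hKJ hsK)
  have hs0' := hJ0 s' (hKJ hsK')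
  have hR := hJab s (hKJ hsK)
  have hR' := hJab s' (hKJ hsK')
  refine absurd hlt' (not_lt.2 ?_)
  calc π K ≤ (radMeas g).map u K := Measure.restrict_apply_le _ _
    _ = radMeas g (u ⁻¹' K) := Measure.map_apply hu hK.measurableSet
    _ ≤ radMeas g ({r | u r = s} ∪ ({r | s < u r} \ {r | s' < u r})) := by
        refine measure_mono fun r hr => ?_
        rcases (hs hr).eq_or_lt with h | h
        · exact Or.inl h.symm
        · exact Or.inr ⟨h, not_lt.2 (hs' hr)⟩
    _ ≤ radMeas g {r | u r = s} + radMeas g ({r | s < u r} \ {r | s' < u r}) :=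
        measure_union_le _ _
    _ = radMeas g {r | s < u r} - radMeas g {r | s' < u r} := by
        have hsub : {r | s' < u r} ⊆ {r | s < u r} := fun r hr => by
          rw [mem_ofPred_eq] at hr ⊢
          exact lt_of_le_of_lt (hs hsK') hr
        rw [hs0.2, zero_add, measure_sdiff hsub
          (measurableSet_lt measurable_const hu).nullMeasurableSet (hfin s' hs0'.1)]
    _ = ENNReal.ofReal (cumVol g (levelRadius g u s) - cumVol g (levelRadius g u s')) := by
        rw [hlevel s hs0.1, hlevel s' hs0'.1, ENNReal.ofReal_sub _
          (hg.cumVol_nonneg (hg.levelRadius_spec hV u s').1)]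
    _ ≤ ENNReal.ofReal (cumVol g b - cumVol g a) := by
        refine ENNReal.ofReal_le_ofReal (sub_le_sub (hg.monotone hR.2) (hg.monotone hR'.1))
    _ = radMeas g (Ioc a b) := (hg.radMeas_Ioc hab).symm

/-- The set of positive levels `t` such that `{u = t}` is null. -/
def nullLevels (g u : ℝ → ℝ) : Set ℝ := {t | 0 < t ∧ radMeas g {r | u r = t} = 0}

theorem countable_plateaus (hu : Measurable u) :
    {t : ℝ | 0 < radMeas g {r | u r = t}}.Countable :=
  Measure.countable_meas_level_set_pos hu

theorem measurableSet_nullLevels (hu : Measurable u) : MeasurableSet (nullLevels g u) := by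
  have : nullLevels g u = Ioi 0 \ {t : ℝ | 0 < radMeas g {r | u r = t}} := by
    ext t
    simp [nullLevels]
  rw [this]
  exact measurableSet_Ioi.diff (countable_plateaus hu).measurableSet

/-- Away from plateaus, `r ↦ levelRadius g u (u r)` transports `g(r) dr` below itself. -/
theorem IsDensity.lintegral_comp_levelRadius_le (hg : IsDensity g)
    (hV : Tendsto (cumVol g) atTop atTop) (hu : Measurable u)
    (hfin : ∀ t, 0 < t → radMeas g {r | t < u r} ≠ ⊤) {y : ℝ → ℝ≥0∞} (hy : Measurable y) :
    ∫⁻ r in u ⁻¹' nullLevels g u, y (levelRadius g u (u r)) ∂(radMeas g) ≤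
      ∫⁻ r, y r ∂(radMeas g) := by
  have hR := hg.measurable_levelRadius hV u
  have hN := measurableSet_nullLevels (g := g) hu
  have hloc := hg.isLocallyFinite
  have hRu : Measurable fun r => levelRadius g u (u r) := hR.comp hu
  have hle : ((radMeas g).restrict (u ⁻¹' nullLevels g u)).map (fun r => levelRadius g u (u r)) ≤
      radMeas g := by
    refine measure_le_of_Ioc fun a b hab => ?_
    rw [Measure.map_apply hRu measurableSet_Ioc,
      Measure.restrict_apply (hRu measurableSet_Ioc)]
    refine le_trans (le_of_eq ?_) (hg.radMeas_levels_le hV hu hfin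
      (J := nullLevels g u ∩ levelRadius g u ⁻¹' Ioc a b) (hN.inter (hR measurableSet_Ioc))
      (fun t ht => ht.1) hab.le fun t ht => Ioc_subset_Icc_self ht.2)
    rw [inter_comm]
    rfl
  calc _ = ∫⁻ r, y r ∂(((radMeas g).restrict (u ⁻¹' nullLevels g u)).map
        (fun r => levelRadius g u (u r))) := (lintegral_map hy hRu).symm
    _ ≤ _ := lintegral_mono' hle le_rfl

/-- The estimate behind the Pólya–Szegő inequality: by the coarea and Cauchy–Schwarz inequalities
and equimeasurability, the measure of levels transported by `levelRadius g u` is bounded by duality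
in terms of the energy of `u`. -/
theorem IsUpperGradient.sq_lintegral_levelRadius_le (h : IsUpperGradient u q) (hg : IsDensity g)
    (hsub : DensitySubadditive g) (hfin : ∀ t, 0 < t → radMeas g {r | t < u r} ≠ ⊤)
    {y : ℝ → ℝ≥0∞} (hy : Measurable y) :
    (∫⁻ t in Ioi 0, y (levelRadius g u t) * ENNReal.ofReal (g (levelRadius g u t))) ^ 2 ≤
      (∫⁻ r, y r ^ 2 ∂(radMeas g)) * ∫⁻ r, q r ^ 2 ∂(radMeas g) := by
  have hV := hg.tendsto_cumVol hsub
  have hR := hg.measurable_levelRadius hV u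
  have hN := measurableSet_nullLevels (g := g) h.meas_fun
  set b : ℝ → ℝ≥0∞ := indicator (nullLevels g u) fun t => y (levelRadius g u t)
  have hb : Measurable b := (hy.comp hR).indicator hN
  have h1 : ∫⁻ t in Ioi 0, y (levelRadius g u t) * ENNReal.ofReal (g (levelRadius g u t)) =
      ∫⁻ t in Ioi 0, b t * ENNReal.ofReal (g (levelRadius g u t)) := by
    refine lintegral_congr_ae ?_
    filter_upwards [ae_restrict_mem measurableSet_Ioi,
      ae_restrict_of_ae ((countable_plateaus (g := g) h.meas_fun).ae_notMem volume)] with t ht htc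
    have : t ∈ nullLevels g u := ⟨ht, by simpa using htc⟩
    simp only [b, indicator_of_mem this]
  have h2 : ∫⁻ r, b (u r) ^ 2 ∂(radMeas g) ≤ ∫⁻ r, y r ^ 2 ∂(radMeas g) := by
    refine le_trans (le_of_eq ?_) (hg.lintegral_comp_levelRadius_le hV h.meas_fun hfin
      (hy.pow_const 2))
    rw [← lintegral_indicator (h.meas_fun hN)]
    refine lintegral_congr fun r => ?_
    by_cases hr : u r ∈ nullLevels g u
    · rw [indicator_of_mem (show r ∈ u ⁻¹' nullLevels g u from hr)]
      simp only [b, indicator_of_mem hr]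
    · rw [indicator_of_notMem (show r ∉ u ⁻¹' nullLevels g u from hr)]
      simp only [b, indicator_of_notMem hr]
      norm_num
  rw [h1]
  calc _ ≤ (∫⁻ r, b (u r) * q r ∂(radMeas g)) ^ 2 := by
        exact pow_le_pow_left' (h.lintegral_profile_le hg hsub hfin hb) 2
    _ ≤ (∫⁻ r, b (u r) ^ 2 ∂(radMeas g)) * ∫⁻ r, q r ^ 2 ∂(radMeas g) :=
        sq_lintegral_mul_le _ (hb.comp h.meas_fun).aemeasurable h.meas.aemeasurable
    _ ≤ _ := by gcongr

/-- The rearrangement is finite away from the origin. -/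
theorem IsDensity.volume_levels_lt_top (hg : IsDensity g)
    (hu : Measurable u) (hfin : ∀ t, 0 < t → radMeas g {r | t < u r} ≠ ⊤) {r : ℝ} (hr : 0 < r) :
    volume {t : ℝ | 0 < t ∧ ENNReal.ofReal (cumVol g r) < radMeas g {r | t < u r}} < ⊤ := by
  have hlim : Tendsto (fun k : ℕ => radMeas g {r | (k : ℝ) < u r}) atTop
      (𝓝 (radMeas g (⋂ k : ℕ, {r | (k : ℝ) < u r}))) := by
    refine tendsto_measure_iInter_atTop
      (fun k => (measurableSet_lt measurable_const hu).nullMeasurableSet)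
      (fun i j hij x hx => ?_) ⟨1, hfin _ (by norm_num)⟩
    exact lt_of_le_of_lt (Nat.cast_le.2 hij) (mem_ofPred_eq ▸ hx)
  have hemp : (⋂ k : ℕ, {r | (k : ℝ) < u r}) = ∅ := by
    refine eq_empty_of_forall_notMem fun x hx => ?_
    obtain ⟨k, hk⟩ := exists_nat_gt (u x)
    exact absurd (mem_iInter.1 hx k) (not_lt.2 hk.le)
  rw [hemp, measure_empty] at hlim
  obtain ⟨k, hk⟩ := (hlim.eventually_lt_const
    (ENNReal.ofReal_pos.2 (hg.cumVol_pos hr))).exists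
  refine lt_of_le_of_lt (measure_mono (t := Ioc 0 (k : ℝ)) fun t ht => ⟨ht.1, ?_⟩)
    measure_Ioc_lt_top
  by_contra! hlt
  refine absurd (ht.2.trans_le (measure_mono fun x hx => ?_)) (not_lt.2 hk.le)
  exact hlt.trans hx

/-- One-dimensional Pólya–Szegő inequality: the decreasing rearrangement of `u` with respect to
`g(r) dr` is `r ↦ ∫_r^∞ p` with `∫ p² g ≤ ∫ q² g` for every upper gradient `q` of `u`. -/
theorem IsUpperGradient.exists_rearrangement_density (h : IsUpperGradient u q) (hg : IsDensity g)
    (hsub : DensitySubadditive g) (hfin : ∀ t, 0 < t → radMeas g {r | t < u r} ≠ ⊤) :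
    ∃ p : ℝ → ℝ≥0∞, Measurable p ∧ (∀ r, 0 < r → ∫⁻ s in Ioi r, p s ≠ ⊤) ∧
      (∀ r, 0 < r → volume {t : ℝ | 0 < t ∧
        ENNReal.ofReal (cumVol g r) < radMeas g {r | t < u r}} = ∫⁻ s in Ioi r, p s) ∧
      ∫⁻ r, p r ^ 2 ∂(radMeas g) ≤ ∫⁻ r, q r ^ 2 ∂(radMeas g) := by
  have hV := hg.tendsto_cumVol hsub
  have hR := hg.measurable_levelRadius hV u
  set E := ∫⁻ r, q r ^ 2 ∂(radMeas g)
  set ν : Measure ℝ := ((volume.restrict (Ioi (0 : ℝ))).map (levelRadius g u)).restrict (Ioi 0)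
    with hν
  have hνIoi : ∀ r, 0 < r → ν (Ioi r) = volume {t : ℝ | 0 < t ∧
      ENNReal.ofReal (cumVol g r) < radMeas g {r | t < u r}} := by
    intro r hr
    rw [hν, Measure.restrict_apply measurableSet_Ioi, Ioi_inter_Ioi, sup_of_le_left hr.le,
      Measure.map_apply hR measurableSet_Ioi, Measure.restrict_apply (hR measurableSet_Ioi)]
    congr 1
    ext t
    constructor
    · rintro ⟨h1, h2⟩
      exact ⟨h2, (hg.ofReal_cumVol_lt_iff hV (hfin t h2) hr.le).2 h1⟩
    · rintro ⟨h1, h2⟩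
      exact ⟨(hg.ofReal_cumVol_lt_iff hV (hfin t h1) hr.le).1 h2, h1⟩
  have hνfin : ∀ r, 0 < r → ν (Ioi r) < ⊤ := fun r hr => by
    rw [hνIoi r hr]
    exact hg.volume_levels_lt_top h.meas_fun hfin hr
  have hν0 : ν (Iic 0) = 0 := by
    rw [hν, Measure.restrict_apply measurableSet_Iic, Iic_inter_Ioi, Ioc_self, measure_empty]
  have hdual : ∀ y : ℝ → ℝ≥0∞, Measurable y →
      (∫⁻ r, y r * ENNReal.ofReal (g r) ∂ν) ^ 2 ≤ (∫⁻ r, y r ^ 2 ∂(radMeas g)) * E := by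
    intro y hy
    refine le_trans ?_ (h.sq_lintegral_levelRadius_le hg hsub hfin hy)
    refine pow_le_pow_left' ?_ 2
    calc ∫⁻ r, y r * ENNReal.ofReal (g r) ∂ν
        ≤ ∫⁻ r, y r * ENNReal.ofReal (g r) ∂((volume.restrict (Ioi (0 : ℝ))).map
          (levelRadius g u)) := lintegral_mono' Measure.restrict_le_self le_rfl
      _ = _ := lintegral_map (hy.mul hg.cont.measurable.ennreal_ofReal) hR
  have hac : ν ≪ volume := by
    refine Measure.AbsolutelyContinuous.mk fun N hNm hN => ?_
    have h1 := hdual (indicator N 1) (measurable_one.indicator hNm)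
    have h2 : ∫⁻ r, indicator N (1 : ℝ → ℝ≥0∞) r ^ 2 ∂(radMeas g) = 0 := by
      have h3 : ∀ᵐ r ∂(radMeas g), r ∉ N :=
        (measure_eq_zero_iff_ae_notMem.1 (radMeas_absolutelyContinuous hN))
      rw [lintegral_congr_ae (g := fun _ => 0)]
      · simp
      · filter_upwards [h3] with r hr
        simp [indicator_of_notMem hr]
    rw [h2, zero_mul, nonpos_iff_eq_zero, sq_eq_zero_iff] at h1
    replace h1 := (lintegral_eq_zero_iff
      ((measurable_one.indicator hNm).mul hg.cont.measurable.ennreal_ofReal)).1 h1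
    have h3 : ∀ᵐ r ∂ν, r ∉ Iic (0 : ℝ) := measure_eq_zero_iff_ae_notMem.1 hν0
    rw [measure_eq_zero_iff_ae_notMem]
    filter_upwards [h1, h3] with r hr1 hr3 hrN
    have : 0 < g r := hg.pos r (by simpa using hr3)
    simp [indicator_of_mem hrN] at hr1
    linarith
  have hσ : SigmaFinite ν := by
    refine ⟨⟨{ set := fun k : ℕ => Iic 0 ∪ Ioi (1 / ((k : ℝ) + 1)), set_mem := fun _ => trivial,
               finite := fun k => ?_, spanning := ?_ }⟩⟩
    · refine (measure_union_le _ _).trans_lt ?_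
      rw [hν0, zero_add]
      exact hνfin _ (by positivity)
    · refine eq_univ_of_forall fun r => ?_
      rcases le_or_gt r 0 with hr | hr
      · exact mem_iUnion.2 ⟨0, Or.inl hr⟩
      · obtain ⟨k, hk⟩ := exists_nat_one_div_lt hr
        exact mem_iUnion.2 ⟨k, Or.inr hk⟩
  set p := ν.rnDeriv volume
  have hp : Measurable p := Measure.measurable_rnDeriv _ _
  have hpν : volume.withDensity p = ν := Measure.withDensity_rnDeriv_eq ν volume hac
  have hpIoi : ∀ r, ν (Ioi r) = ∫⁻ s in Ioi r, p s := fun r => by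
    rw [← hpν, withDensity_apply _ measurableSet_Ioi]
  refine ⟨p, hp, fun r hr => hpIoi r ▸ (hνfin r hr).ne, fun r hr => by
    rw [← hpIoi, hνIoi r hr], ?_⟩
  -- duality is used with truncations of `p`, whose energy is finite
  set y : ℕ → ℝ → ℝ≥0∞ := fun k => indicator (Ioc (1 / ((k : ℝ) + 1)) k) fun r => min (p r) k
  have hy : ∀ k, Measurable (y k) := fun k =>
    (hp.min measurable_const).indicator measurableSet_Ioc
  have hyp : ∀ k r, y k r ≤ p r := fun k r =>
    (indicator_le_self _ _ r).trans (min_le_left _ _)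
  have hbound : ∀ k, ∫⁻ r, y k r ^ 2 ∂(radMeas g) ≤ E := by
    intro k
    set X := ∫⁻ r, y k r ^ 2 ∂(radMeas g)
    have hX : X ≠ ⊤ := by
      have h1 : X ≤ ∫⁻ r, indicator (Ioc (1 / ((k : ℝ) + 1)) k) (fun _ => (k : ℝ≥0∞) ^ 2) r
          ∂(radMeas g) := by
        refine lintegral_mono fun r => ?_
        by_cases hr : r ∈ Ioc (1 / ((k : ℝ) + 1)) (k : ℝ)
        · simp only [y, indicator_of_mem hr]
          gcongr
          exact min_le_right _ _
        · simp only [y, indicator_of_notMem hr]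
          norm_num
      refine (h1.trans_lt ?_).ne
      rw [lintegral_indicator measurableSet_Ioc, setLIntegral_const]
      have := hg.isLocallyFinite
      exact ENNReal.mul_lt_top (by simp) measure_Ioc_lt_top
    have h1 : X ≤ ∫⁻ r, y k r * ENNReal.ofReal (g r) ∂ν := by
      rw [← hpν]
      refine le_trans ?_ (lintegral_withDensity_eq_lintegral_mul _ hp
        ((hy k).mul hg.cont.measurable.ennreal_ofReal)).ge
      refine (hg.lintegral_radMeas _).trans_le (lintegral_mono fun r => ?_)
      simp only [Pi.mul_apply]
      rw [mul_comm, sq, mul_assoc]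
      gcongr
      exact hyp k r
    have h2 : X * X ≤ X * E := by
      rw [← sq]
      exact (pow_le_pow_left' h1 2).trans (hdual _ (hy k))
    by_cases hX0 : X = 0
    · rw [hX0]; exact zero_le
    · exact (ENNReal.mul_le_mul_iff_right hX0 hX).1 h2
  have hlim : ∀ᵐ r ∂(radMeas g), p r ^ 2 = liminf (fun k => y k r ^ 2) atTop := by
    filter_upwards [hg.ae_pos] with r hr
    have h1 : Tendsto (fun k : ℕ => min (p r) (k : ℝ≥0∞)) atTop (𝓝 (p r)) := by
      have := (tendsto_const_nhds (x := p r)).min ENNReal.tendsto_nat_nhds_top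
      simpa using this
    have h2 : Tendsto (fun k : ℕ => y k r) atTop (𝓝 (p r)) := by
      refine h1.congr' ?_
      filter_upwards [tendsto_one_div_add_atTop_nhds_zero_nat.eventually_lt_const hr,
        tendsto_natCast_atTop_atTop.eventually_ge_atTop r] with k hk1 hk2
      have hk : r ∈ Ioc (1 / ((k : ℝ) + 1)) (k : ℝ) := ⟨hk1, hk2⟩
      simp only [y, indicator_of_mem hk]
    have h3 : Tendsto (fun k : ℕ => y k r ^ 2) atTop (𝓝 (p r ^ 2)) :=
      ((ENNReal.continuous_pow 2).tendsto _).comp h2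
    exact h3.liminf_eq.symm
  calc ∫⁻ r, p r ^ 2 ∂(radMeas g) = ∫⁻ r, liminf (fun k => y k r ^ 2) atTop ∂(radMeas g) :=
        lintegral_congr_ae hlim
    _ ≤ liminf (fun k => ∫⁻ r, y k r ^ 2 ∂(radMeas g)) atTop :=
        lintegral_liminf_le fun k => (hy k).pow_const 2
    _ ≤ E := by
        refine liminf_le_of_frequently_le' (Eventually.of_forall hbound).frequently

end

/-! ### Polar coordinates -/

section

variable {n : ℕ} {ψ : ℝ → ℝ}

/-- The density `ψⁿ⁻¹`, extended by `0` to the negative half-line. -/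
def dens (n : ℕ) (ψ : ℝ → ℝ) (r : ℝ) : ℝ := ψ (max r 0) ^ (n - 1)

/-- The surface measure of the unit sphere of `ℝⁿ`. -/
abbrev sph (n : ℕ) : Measure (Metric.sphere (0 : M n) 1) := (volume : Measure (M n)).toSphere

theorem IsModelFunction.map_zero (hψ : IsModelFunction ψ) : ψ 0 = 0 := by
  simpa using hψ.even_deriv_zero 0

theorem IsModelFunction.isDensity (hψ : IsModelFunction ψ) (hn : 2 ≤ n) :
    IsDensity (dens n ψ) where
  cont := (hψ.smooth.continuousOn.comp_continuous (continuous_id.max continuous_const)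
    fun r => le_max_right r 0).pow _
  zero r hr := by
    rw [dens, max_eq_right hr, hψ.map_zero, zero_pow (by omega)]
  pos r hr := by
    rw [dens, max_eq_left hr.le]
    exact pow_pos (hψ.pos r hr) _

theorem dens_of_pos {r : ℝ} (hr : 0 ≤ r) : dens n ψ r = ψ r ^ (n - 1) := by
  rw [dens, max_eq_left hr]

theorem cumVol_dens {r : ℝ} (hr : 0 ≤ r) : cumVol (dens n ψ) r = G n ψ r := by
  refine intervalIntegral.integral_congr fun s hs => ?_
  rw [uIcc_of_le hr] at hs
  exact dens_of_pos hs.1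

theorem VolumeSubadditive.densitySubadditive (h : VolumeSubadditive n ψ) :
    DensitySubadditive (dens n ψ) := by
  intro R S T hR hS hT hRST
  rw [cumVol_dens hR.le, cumVol_dens hS.le, cumVol_dens hT.le] at hRST
  rw [dens_of_pos hR.le, dens_of_pos hS.le, dens_of_pos hT.le]
  exact h R S T hR hS hT hRST

/-- If `ψ` is nondecreasing then `G(R) = G(S) - G(T)` forces `R < S`. -/
theorem IsModelFunction.volumeSubadditive (hψ : IsModelFunction ψ) (hn : 2 ≤ n)
    (hmono : MonotoneOn ψ (Ici 0)) : VolumeSubadditive n ψ := by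
  intro R S T hR hS hT h
  have hg := hψ.isDensity hn
  rw [← cumVol_dens hR.le, ← cumVol_dens hS.le, ← cumVol_dens hT.le] at h
  have hlt : cumVol (dens n ψ) R < cumVol (dens n ψ) S := by
    linarith [hg.cumVol_pos hT]
  have hRS : R < S := (hg.strictMonoOn.lt_iff_lt hR.le hS.le).1 hlt
  have h1 : ψ R ^ (n - 1) ≤ ψ S ^ (n - 1) :=
    pow_le_pow_left₀ (hψ.pos R hR).le (hmono hR.le hS.le hRS.le) _
  have h2 := pow_pos (hψ.pos T hT) (n - 1)
  linarith

theorem withDensity_restrict_eq (hψ : IsModelFunction ψ) (hn : 2 ≤ n) :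
    (volume.restrict (Ioi (0 : ℝ))).withDensity (fun r => ENNReal.ofReal (ψ r ^ (n - 1))) =
      radMeas (dens n ψ) := by
  rw [radMeas, ← restrict_withDensity measurableSet_Ioi, restrict_withDensity' ,
    ← withDensity_indicator measurableSet_Ioi]
  congr 1
  funext r
  by_cases hr : 0 < r
  · rw [indicator_of_mem (show r ∈ Ioi (0 : ℝ) from hr), dens_of_pos hr.le]
  · rw [indicator_of_notMem (show r ∉ Ioi (0 : ℝ) from hr),
      (hψ.isDensity hn).zero r (not_lt.1 hr), ENNReal.ofReal_zero]

theorem measurable_polar : Measurable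
    fun p : ℝ × Metric.sphere (0 : M n) 1 => p.1 • (p.2 : M n) := by
  fun_prop

theorem vol_eq_map (hψ : IsModelFunction ψ) (hn : 2 ≤ n) :
    vol n ψ = Measure.map (fun p : ℝ × Metric.sphere (0 : M n) 1 => p.1 • (p.2 : M n))
      ((radMeas (dens n ψ)).prod (sph n)) := by
  rw [vol, withDensity_restrict_eq hψ hn]

/-- Integration in polar coordinates, spheres first. -/
theorem lintegral_vol (hψ : IsModelFunction ψ) (hn : 2 ≤ n) {F : M n → ℝ≥0∞} (hF : Measurable F) :
    ∫⁻ x, F x ∂(vol n ψ) =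
      ∫⁻ r, ∫⁻ θ : Metric.sphere (0 : M n) 1, F (r • (θ : M n)) ∂(sph n) ∂(radMeas (dens n ψ)) := by
  have hF' : Measurable fun p : ℝ × Metric.sphere (0 : M n) 1 => F (p.1 • (p.2 : M n)) :=
    hF.comp measurable_polar
  rw [vol_eq_map hψ hn, lintegral_map hF measurable_polar, lintegral_prod _ hF'.aemeasurable]

/-- Integration in polar coordinates, rays first. -/
theorem lintegral_vol' (hψ : IsModelFunction ψ) (hn : 2 ≤ n) {F : M n → ℝ≥0∞} (hF : Measurable F) :
    ∫⁻ x, F x ∂(vol n ψ) =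
      ∫⁻ θ : Metric.sphere (0 : M n) 1, ∫⁻ r, F (r • (θ : M n)) ∂(radMeas (dens n ψ)) ∂(sph n) := by
  have hF' : Measurable fun p : ℝ × Metric.sphere (0 : M n) 1 => F (p.1 • (p.2 : M n)) :=
    hF.comp measurable_polar
  rw [vol_eq_map hψ hn, lintegral_map hF measurable_polar, lintegral_prod_symm _ hF'.aemeasurable]

theorem norm_polar {r : ℝ} (hr : 0 ≤ r) (θ : Metric.sphere (0 : M n) 1) :
    ‖r • (θ : M n)‖ = r := by
  rw [norm_smul, Real.norm_of_nonneg hr, norm_eq_of_mem_sphere, mul_one]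

theorem lintegral_vol_norm (hψ : IsModelFunction ψ) (hn : 2 ≤ n) {F : ℝ → ℝ≥0∞}
    (hF : Measurable F) :
    ∫⁻ x, F ‖x‖ ∂(vol n ψ) = sph n univ * ∫⁻ r, F r ∂(radMeas (dens n ψ)) := by
  rw [lintegral_vol hψ hn (F := fun x => F ‖x‖) (hF.comp measurable_norm),
    ← lintegral_const_mul _ hF]
  refine lintegral_congr_ae ?_
  filter_upwards [(hψ.isDensity hn).ae_pos] with r hr
  simp only [norm_polar hr.le, lintegral_const, mul_comm]

theorem vol_norm_preimage (hψ : IsModelFunction ψ) (hn : 2 ≤ n) {s : Set ℝ}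
    (hs : MeasurableSet s) :
    vol n ψ {x | ‖x‖ ∈ s} = sph n univ * radMeas (dens n ψ) s := by
  have h := lintegral_vol_norm hψ hn (F := indicator s 1) (measurable_one.indicator hs)
  rw [lintegral_indicator_one hs] at h
  rw [← h, ← lintegral_indicator_one (show MeasurableSet {x : M n | ‖x‖ ∈ s} from
    measurable_norm hs)]
  rfl

theorem sph_ne_zero (hn : 2 ≤ n) : sph n univ ≠ 0 := by
  have : Nonempty (Fin n) := ⟨⟨0, by omega⟩⟩
  rw [Measure.measure_univ_ne_zero]
  exact Measure.toSphere_ne_zero _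

/-- An almost sure property of the radius holds almost everywhere on the manifold. -/
theorem ae_vol_norm (hψ : IsModelFunction ψ) (hn : 2 ≤ n) {p : ℝ → Prop}
    (h : ∀ᵐ r ∂(radMeas (dens n ψ)), p r) : ∀ᵐ x ∂(vol n ψ), p ‖x‖ := by
  obtain ⟨N, hN, hNm, hN0⟩ := exists_measurable_superset_of_null (ae_iff.1 h)
  rw [ae_iff]
  refine measure_mono_null (t := {x | ‖x‖ ∈ N}) (fun x hx => hN hx) ?_
  rw [vol_norm_preimage hψ hn hNm, hN0, mul_zero]

/-- A property holding almost everywhere on the manifold holds almost everywhere on almost every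
ray. -/
theorem ae_ae_polar (hψ : IsModelFunction ψ) (hn : 2 ≤ n) {p : M n → Prop}
    (h : ∀ᵐ x ∂(vol n ψ), p x) :
    ∀ᵐ θ : Metric.sphere (0 : M n) 1 ∂(sph n),
      ∀ᵐ r ∂(radMeas (dens n ψ)), p (r • (θ : M n)) := by
  obtain ⟨N, hN, hNm, hN0⟩ := exists_measurable_superset_of_null (ae_iff.1 h)
  have h1 := lintegral_vol' hψ hn (F := indicator N 1) (measurable_one.indicator hNm)
  rw [lintegral_indicator_one hNm, hN0] at h1
  have hF : Measurable fun p : ℝ × Metric.sphere (0 : M n) 1 =>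
      indicator N (1 : M n → ℝ≥0∞) (p.1 • (p.2 : M n)) :=
    (measurable_one.indicator hNm).comp measurable_polar
  have h2 := (lintegral_eq_zero_iff hF.lintegral_prod_left').1 h1.symm
  filter_upwards [h2] with θ hθ
  have h3 := (lintegral_eq_zero_iff (hF.comp (measurable_id.prodMk measurable_const))).1 hθ
  filter_upwards [h3] with r hr
  by_contra hp
  have : r • (θ : M n) ∈ N := hN hp
  simp [this] at hr

/-- Lebesgue measure in polar coordinates. -/
theorem lintegral_volume_polar (hn : 2 ≤ n) {F : M n → ℝ≥0∞} (hF : Measurable F) :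
    ∫⁻ x, F x = ∫⁻ r in Ioi (0 : ℝ), ENNReal.ofReal (r ^ (n - 1)) *
      ∫⁻ θ : Metric.sphere (0 : M n) 1, F (r • (θ : M n)) ∂(sph n) := by
  have : Nonempty (Fin n) := ⟨⟨0, by omega⟩⟩
  have hmp := (volume : Measure (M n)).measurePreserving_homeomorphUnitSphereProd
  have hF' : Measurable fun p : Metric.sphere (0 : M n) 1 × Ioi (0 : ℝ) =>
      F ((p.2 : ℝ) • (p.1 : M n)) := hF.comp (by fun_prop)
  calc ∫⁻ x, F x = ∫⁻ x in ({0}ᶜ : Set (M n)), F x := by rw [restrict_compl_singleton]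
    _ = ∫⁻ x : ({0}ᶜ : Set (M n)), F x ∂(Measure.comap Subtype.val volume) := by
        rw [lintegral_subtype_comap (measurableSet_singleton _).compl]
    _ = ∫⁻ x : ({0}ᶜ : Set (M n)), F ((homeomorphUnitSphereProd (M n) x).2.1 •
          ((homeomorphUnitSphereProd (M n) x).1 : M n)) ∂(Measure.comap Subtype.val volume) := by
        refine lintegral_congr fun x => ?_
        rw [← homeomorphUnitSphereProd_symm_apply_coe, Homeomorph.symm_apply_apply]
    _ = ∫⁻ p : Metric.sphere (0 : M n) 1 × Ioi (0 : ℝ), F ((p.2 : ℝ) • (p.1 : M n))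
          ∂((sph n).prod (Measure.volumeIoiPow (Module.finrank ℝ (M n) - 1))) :=
        hmp.lintegral_comp hF'
    _ = ∫⁻ r : Ioi (0 : ℝ), ∫⁻ θ : Metric.sphere (0 : M n) 1, F ((r : ℝ) • (θ : M n)) ∂(sph n)
          ∂(Measure.volumeIoiPow (n - 1)) := by
        rw [lintegral_prod_symm _ hF'.aemeasurable, finrank_euclideanSpace_fin]
    _ = ∫⁻ r : Ioi (0 : ℝ), ENNReal.ofReal ((r : ℝ) ^ (n - 1)) *
          ∫⁻ θ : Metric.sphere (0 : M n) 1, F ((r : ℝ) • (θ : M n)) ∂(sph n)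
          ∂(Measure.comap Subtype.val volume) := by
        rw [Measure.volumeIoiPow]
        exact lintegral_withDensity_eq_lintegral_mul _
          (measurable_subtype_coe.pow_const _).ennreal_ofReal hF'.lintegral_prod_left'
    _ = _ := lintegral_subtype_comap measurableSet_Ioi (fun r : ℝ => ENNReal.ofReal (r ^ (n - 1)) *
          ∫⁻ θ : Metric.sphere (0 : M n) 1, F (r • (θ : M n)) ∂(sph n))

/-- The Riemannian volume has density `(ψ(r)/r)ⁿ⁻¹` with respect to Lebesgue measure. -/
theorem vol_eq_withDensity (hψ : IsModelFunction ψ) (hn : 2 ≤ n) :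
    vol n ψ = (volume : Measure (M n)).withDensity
      fun x => ENNReal.ofReal (dens n ψ ‖x‖ / ‖x‖ ^ (n - 1)) := by
  have hg := hψ.isDensity hn
  have hw : Measurable fun x : M n => ENNReal.ofReal (dens n ψ ‖x‖ / ‖x‖ ^ (n - 1)) :=
    ((hg.cont.measurable.comp measurable_norm).div (measurable_norm.pow_const _)).ennreal_ofReal
  ext s hs
  have hind : Measurable (indicator s (1 : M n → ℝ≥0∞)) := measurable_one.indicator hs
  have h1 : (volume : Measure (M n)).withDensity
      (fun x => ENNReal.ofReal (dens n ψ ‖x‖ / ‖x‖ ^ (n - 1))) s =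
      ∫⁻ x : M n, ENNReal.ofReal (dens n ψ ‖x‖ / ‖x‖ ^ (n - 1)) * indicator s 1 x := by
    rw [withDensity_apply _ hs, ← lintegral_indicator hs]
    refine lintegral_congr fun x => ?_
    by_cases hx : x ∈ s <;> simp [hx]
  rw [h1, ← lintegral_indicator_one hs, lintegral_vol hψ hn hind,
    lintegral_volume_polar hn
      (F := fun x => ENNReal.ofReal (dens n ψ ‖x‖ / ‖x‖ ^ (n - 1)) * indicator s 1 x) (hw.mul hind),
    hg.lintegral_radMeas,
    ← lintegral_indicator measurableSet_Ioi]
  refine lintegral_congr fun r => ?_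
  by_cases hr : 0 < r
  · rw [indicator_of_mem (show r ∈ Ioi (0 : ℝ) from hr)]
    have h2 : ∀ θ : Metric.sphere (0 : M n) 1,
        ENNReal.ofReal (dens n ψ ‖r • (θ : M n)‖ / ‖r • (θ : M n)‖ ^ (n - 1)) *
          indicator s (1 : M n → ℝ≥0∞) (r • (θ : M n)) =
        ENNReal.ofReal (dens n ψ r / r ^ (n - 1)) *
          indicator s (1 : M n → ℝ≥0∞) (r • (θ : M n)) := fun θ => by rw [norm_polar hr.le]
    have hind' : Measurable fun θ : Metric.sphere (0 : M n) 1 =>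
        indicator s (1 : M n → ℝ≥0∞) (r • (θ : M n)) := hind.comp (by fun_prop)
    rw [lintegral_congr h2, lintegral_const_mul _ hind', ← mul_assoc,
      ← ENNReal.ofReal_mul (by positivity), mul_div_cancel₀]
    positivity
  · rw [indicator_of_notMem (show r ∉ Ioi (0 : ℝ) from hr), hg.zero r (not_lt.1 hr),
      ENNReal.ofReal_zero, zero_mul]

theorem vol_absolutelyContinuous (hψ : IsModelFunction ψ) (hn : 2 ≤ n) :
    vol n ψ ≪ (volume : Measure (M n)) := by
  rw [vol_eq_withDensity hψ hn]
  exact withDensity_absolutelyContinuous _ _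

/-- On bounded intervals `ψ(r)` is comparable to `r`. -/
theorem IsModelFunction.exists_bounds (hψ : IsModelFunction ψ) {R : ℝ} (hR : 0 < R) :
    ∃ c C : ℝ, 0 < c ∧ ∀ r ∈ Ioc 0 R, c * r ≤ ψ r ∧ ψ r ≤ C * r := by
  have hd : HasDerivWithinAt ψ 1 (Ici 0) 0 := by
    have := (hψ.smooth.differentiableOn (by simp) 0 self_mem_Ici).hasDerivWithinAt
    rwa [hψ.deriv_zero] at this
  set κ : ℝ → ℝ := Function.update (slope ψ 0) 0 1
  have hκ : ∀ r, 0 < r → κ r = ψ r / r := fun r hr => by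
    simp only [κ, Function.update_of_ne hr.ne', slope_def_field, hψ.map_zero, sub_zero]
  have hcont : ContinuousOn κ (Icc 0 R) := by
    intro r hr
    rcases hr.1.eq_or_lt with rfl | hr0
    · refine ContinuousWithinAt.mono ?_ (Icc_subset_Ici_self)
      rw [continuousWithinAt_update_same]
      exact hasDerivWithinAt_iff_tendsto_slope.1 hd
    · refine ContinuousAt.continuousWithinAt ?_
      have h1 : ContinuousAt (fun r => ψ r / r) r :=
        (hψ.smooth.continuousOn.continuousAt (Ici_mem_nhds hr0)).div continuousAt_id hr0.ne'
      refine h1.congr ?_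
      filter_upwards [Ioi_mem_nhds hr0] with s hs
      exact (hκ s hs).symm
  have hpos : ∀ r ∈ Icc 0 R, 0 < κ r := by
    intro r hr
    rcases hr.1.eq_or_lt with rfl | hr0
    · simp [κ]
    · rw [hκ r hr0]
      exact div_pos (hψ.pos r hr0) hr0
  have hne : (Icc 0 R).Nonempty := nonempty_Icc.2 hR.le
  obtain ⟨a, ha, hamin⟩ := isCompact_Icc.exists_isMinOn hne hcont
  obtain ⟨b, hb, hbmax⟩ := isCompact_Icc.exists_isMaxOn hne hcont
  refine ⟨κ a, κ b, hpos a ha, fun r hr => ?_⟩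
  have h1 : κ a ≤ κ r := hamin (Ioc_subset_Icc_self hr)
  have h2 : κ r ≤ κ b := hbmax (Ioc_subset_Icc_self hr)
  rw [hκ r hr.1] at h1 h2
  exact ⟨(le_div_iff₀ hr.1).1 h1, (div_le_iff₀ hr.1).1 h2⟩

/-- On bounded sets Lebesgue measure is dominated by the Riemannian volume. -/
theorem exists_volume_le_vol (hψ : IsModelFunction ψ) (hn : 2 ≤ n) {R : ℝ} (hR : 0 < R) :
    ∃ C : ℝ≥0∞, C ≠ ⊤ ∧ ∀ K : Set (M n), K ⊆ Metric.closedBall 0 R →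
      (volume : Measure (M n)).restrict K ≤ C • (vol n ψ).restrict K := by
  obtain ⟨c, C, hc, hb⟩ := hψ.exists_bounds hR
  have hg := hψ.isDensity hn
  have : Nonempty (Fin n) := ⟨⟨0, by omega⟩⟩
  refine ⟨(ENNReal.ofReal (c ^ (n - 1)))⁻¹, by simp [pow_pos hc], fun K hK => ?_⟩
  have hc0 : ENNReal.ofReal (c ^ (n - 1)) ≠ 0 := by simp [pow_pos hc]
  have hball : ENNReal.ofReal (c ^ (n - 1)) •
      (volume : Measure (M n)).restrict (Metric.closedBall 0 R) ≤
      (vol n ψ).restrict (Metric.closedBall 0 R) := by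
    rw [vol_eq_withDensity hψ hn, restrict_withDensity Metric.isClosed_closedBall.measurableSet,
      ← withDensity_const]
    refine withDensity_mono ?_
    have h0 : ∀ᵐ x : M n, x ≠ 0 := by
      simp [ae_iff]
    filter_upwards [ae_restrict_mem Metric.isClosed_closedBall.measurableSet,
      ae_restrict_of_ae h0] with x hx hx0
    have hx0' : 0 < ‖x‖ := norm_pos_iff.2 hx0
    refine ENNReal.ofReal_le_ofReal ?_
    rw [dens_of_pos hx0'.le, ← div_pow]
    refine pow_le_pow_left₀ hc.le ?_ _
    rw [le_div_iff₀ hx0']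
    exact (hb ‖x‖ ⟨hx0', by simpa using hx⟩).1
  have hK' : ENNReal.ofReal (c ^ (n - 1)) • (volume : Measure (M n)).restrict K ≤
      (vol n ψ).restrict K := by
    refine Measure.le_iff.2 fun s hs => ?_
    have h := Measure.restrict_mono_measure hball K
    rw [Measure.restrict_smul, Measure.restrict_restrict_of_subset hK,
      Measure.restrict_restrict_of_subset hK] at h
    exact h s
  calc (volume : Measure (M n)).restrict K
      = (ENNReal.ofReal (c ^ (n - 1)))⁻¹ • (ENNReal.ofReal (c ^ (n - 1)) •
          (volume : Measure (M n)).restrict K) := by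
        rw [smul_smul, ENNReal.inv_mul_cancel hc0 ENNReal.ofReal_ne_top, one_smul]
    _ ≤ _ := by gcongr

theorem vol_lt_top_of_isCompact (hψ : IsModelFunction ψ) (hn : 2 ≤ n) {K : Set (M n)}
    (hK : IsCompact K) : vol n ψ K < ⊤ := by
  obtain ⟨R, hR⟩ := hK.isBounded.subset_closedBall 0
  have h1 : K ⊆ {x : M n | ‖x‖ ∈ Iic (max R 0)} := fun x hx => by
    have := hR hx
    simp only [Metric.mem_closedBall, dist_zero_right] at this
    exact this.trans (le_max_left _ _)
  refine (measure_mono h1).trans_lt ?_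
  rw [vol_norm_preimage hψ hn measurableSet_Iic,
    (hψ.isDensity hn).radMeas_Iic (le_max_right _ _)]
  exact ENNReal.mul_lt_top (measure_lt_top _ _) ENNReal.ofReal_lt_top

/-- Convergence in mean square on a compact set for the Riemannian volume implies convergence in
mean for Lebesgue measure. -/
theorem tendsto_setLIntegral_of_sq (hψ : IsModelFunction ψ) (hn : 2 ≤ n) {K : Set (M n)}
    (hK : IsCompact K) {Y : ℕ → M n → ℝ≥0∞} (hY : ∀ k, AEMeasurable (Y k))
    (h : Tendsto (fun k => ∫⁻ x in K, Y k x ^ 2 ∂(vol n ψ)) atTop (𝓝 0)) :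
    Tendsto (fun k => ∫⁻ x in K, Y k x) atTop (𝓝 0) := by
  obtain ⟨R, hR⟩ := hK.isBounded.subset_closedBall 0
  obtain ⟨C, hC, hle⟩ := exists_volume_le_vol (ψ := ψ) hψ hn (show 0 < max R 1 by positivity)
  have hKR : K ⊆ Metric.closedBall 0 (max R 1) :=
    hR.trans (Metric.closedBall_subset_closedBall (le_max_left _ _))
  have hsq : ∀ k, (∫⁻ x in K, Y k x) ^ 2 ≤
      volume K * (C * ∫⁻ x in K, Y k x ^ 2 ∂(vol n ψ)) := by
    intro k
    have h1 := sq_lintegral_mul_le (volume.restrict K) (f := fun _ => 1) aemeasurable_const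
      (hY k).restrict
    simp only [one_mul, one_pow, lintegral_const, Measure.restrict_apply_univ] at h1
    refine h1.trans ?_
    gcongr
    rw [← smul_eq_mul, ← lintegral_smul_measure]
    exact lintegral_mono' (hle K hKR) le_rfl
  have hlim : Tendsto (fun k => volume K * (C * ∫⁻ x in K, Y k x ^ 2 ∂(vol n ψ))) atTop (𝓝 0) := by
    have h1 := ENNReal.Tendsto.const_mul (a := C) h (Or.inr hC)
    have h2 := ENNReal.Tendsto.const_mul (a := volume K) h1 (Or.inr hK.measure_lt_top.ne)
    simpa using h2
  have hsq0 : Tendsto (fun k => (∫⁻ x in K, Y k x) ^ 2) atTop (𝓝 0) :=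
    tendsto_of_tendsto_of_tendsto_of_le_of_le tendsto_const_nhds hlim (fun _ => zero_le) hsq
  have hroot := (ENNReal.continuous_rpow_const (y := (1 / 2 : ℝ))).tendsto 0 |>.comp hsq0
  rw [ENNReal.zero_rpow_of_pos (by norm_num)] at hroot
  refine hroot.congr fun k => ?_
  rw [Function.comp_apply, ← ENNReal.rpow_two, ← ENNReal.rpow_mul]
  norm_num

end

/-! ### The metric and uniqueness of weak gradients -/

section

variable {n : ℕ} {ψ : ℝ → ℝ}

theorem dr_sub (x w z : M n) : dr x (w - z) = dr x w - dr x z := inner_sub_right _ _ _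

theorem dr_add (x w z : M n) : dr x (w + z) = dr x w + dr x z := inner_add_right _ _ _

theorem dr_smul (x : M n) (c : ℝ) (z : M n) : dr x (c • z) = c * dr x z :=
  inner_smul_right _ _ _

theorem dθ_add (x w z : M n) : dθ x (w + z) = dθ x w + dθ x z := by
  simp only [dθ, dr_add]
  module

theorem dθ_smul (x : M n) (c : ℝ) (z : M n) : dθ x (c • z) = c • dθ x z := by
  simp only [dθ, dr_smul]
  module

theorem metric_add_right (ψ : ℝ → ℝ) (x w z z' : M n) :
    metric ψ x w (z + z') = metric ψ x w z + metric ψ x w z' := by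
  unfold metric
  split_ifs
  · exact inner_add_right _ _ _
  · rw [dr_add, dθ_add, inner_add_right]
    ring

theorem metric_smul_right (ψ : ℝ → ℝ) (x w : M n) (c : ℝ) (z : M n) :
    metric ψ x w (c • z) = c * metric ψ x w z := by
  unfold metric
  split_ifs
  · exact inner_smul_right _ _ _
  · rw [dr_smul, dθ_smul, inner_smul_right]
    ring

theorem metric_comm (ψ : ℝ → ℝ) (x w z : M n) : metric ψ x w z = metric ψ x z w := by
  unfold metric
  split_ifs
  · exact real_inner_comm _ _
  · rw [real_inner_comm (dθ x w), mul_comm (dr x w)]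

/-- The metric at `x`, with its first argument fixed, as a linear form. -/
def metricForm (ψ : ℝ → ℝ) (x w : M n) : M n →ₗ[ℝ] ℝ where
  toFun := metric ψ x w
  map_add' := metric_add_right ψ x w
  map_smul' c z := metric_smul_right ψ x w c z

theorem norm_radialVec {x : M n} (hx : x ≠ 0) : ‖radialVec x‖ = 1 := by
  rw [radialVec, norm_smul, norm_inv, norm_norm, inv_mul_cancel₀ (norm_ne_zero_iff.2 hx)]

theorem norm_radialVec_le (x : M n) : ‖radialVec x‖ ≤ 1 := by
  by_cases hx : x = 0
  · simp [radialVec, hx]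
  · exact (norm_radialVec hx).le

theorem dr_radialVec {x : M n} (hx : x ≠ 0) : dr x (radialVec x) = 1 := by
  rw [dr, real_inner_self_eq_norm_sq, norm_radialVec hx, one_pow]

theorem abs_dr_le (x w : M n) : |dr x w| ≤ ‖w‖ :=
  (abs_real_inner_le_norm _ _).trans (mul_le_of_le_one_left (norm_nonneg _) (norm_radialVec_le x))

theorem metric_radial (ψ : ℝ → ℝ) (x : M n) (c : ℝ) (z : M n) :
    metric ψ x (c • radialVec x) z = c * dr x z := by
  by_cases hx : x = 0
  · simp [metric, hx, radialVec, dr]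
  · rw [metric, if_neg hx, dr_smul, dr_radialVec hx, dθ_smul, dθ, dr_radialVec hx]
    simp

theorem metric_radial_self (ψ : ℝ → ℝ) {x : M n} (hx : x ≠ 0) (c : ℝ) :
    metric ψ x (c • radialVec x) (c • radialVec x) = c ^ 2 := by
  rw [metric_radial, dr_smul, dr_radialVec hx]
  ring

theorem sq_dr_le_metric (ψ : ℝ → ℝ) {x : M n} (hx : x ≠ 0) (w : M n) :
    dr x w ^ 2 ≤ metric ψ x w w := by
  rw [metric, if_neg hx, real_inner_self_eq_norm_sq]
  nlinarith [mul_nonneg (sq_nonneg (ψ ‖x‖)) (sq_nonneg ‖dθ x w‖)]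

theorem exists_abs_metric_le (hψ : IsModelFunction ψ) {R : ℝ} (hR : 0 < R) :
    ∃ C : ℝ, ∀ x : M n, ‖x‖ ≤ R → ∀ w z, |metric ψ x w z| ≤ C * ‖w‖ * ‖z‖ := by
  obtain ⟨c, C, hc, hb⟩ := hψ.exists_bounds hR
  refine ⟨1 + 4 * C ^ 2, fun x hxR w z => ?_⟩
  by_cases hx : x = 0
  · rw [metric, if_pos hx]
    have h1 := abs_real_inner_le_norm w z
    have h2 : 0 ≤ 4 * C ^ 2 * (‖w‖ * ‖z‖) := by positivity
    linarith
  · have hr : 0 < ‖x‖ := norm_pos_iff.2 hx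
    have hθ : ∀ w : M n, ψ ‖x‖ * ‖dθ x w‖ ≤ 2 * C * ‖w‖ := by
      intro w
      have h1 : ‖w - dr x w • radialVec x‖ ≤ 2 * ‖w‖ := by
        refine (norm_sub_le _ _).trans ?_
        rw [norm_smul, norm_radialVec hx, Real.norm_eq_abs, mul_one]
        linarith [abs_dr_le x w]
      have h2 := (hb ‖x‖ ⟨hr, hxR⟩).2
      have h3 := hψ.pos ‖x‖ hr
      rw [dθ, norm_smul, norm_inv, norm_norm]
      have h4 : ψ ‖x‖ * ‖x‖⁻¹ ≤ C := by
        rw [← div_eq_mul_inv, div_le_iff₀ hr]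
        exact h2
      calc ψ ‖x‖ * (‖x‖⁻¹ * ‖w - dr x w • radialVec x‖)
          = (ψ ‖x‖ * ‖x‖⁻¹) * ‖w - dr x w • radialVec x‖ := by ring
        _ ≤ C * (2 * ‖w‖) := by
            refine mul_le_mul h4 h1 (norm_nonneg _) (le_trans (by positivity) h4)
        _ = 2 * C * ‖w‖ := by ring
    rw [metric, if_neg hx]
    have h1 : |dr x w * dr x z| ≤ ‖w‖ * ‖z‖ := by
      rw [abs_mul]
      exact mul_le_mul (abs_dr_le x w) (abs_dr_le x z) (abs_nonneg _) (norm_nonneg _)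
    have h2 : |ψ ‖x‖ ^ 2 * inner ℝ (dθ x w) (dθ x z)| ≤ (2 * C * ‖w‖) * (2 * C * ‖z‖) := by
      rw [abs_mul, abs_of_nonneg (sq_nonneg _)]
      have hp := (hψ.pos ‖x‖ hr).le
      calc ψ ‖x‖ ^ 2 * |inner ℝ (dθ x w) (dθ x z)|
          ≤ ψ ‖x‖ ^ 2 * (‖dθ x w‖ * ‖dθ x z‖) := by
            gcongr
            exact abs_real_inner_le_norm _ _
        _ = (ψ ‖x‖ * ‖dθ x w‖) * (ψ ‖x‖ * ‖dθ x z‖) := by ring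
        _ ≤ _ := mul_le_mul (hθ w) (hθ z) (by positivity) (le_trans (by positivity) (hθ w))
    calc _ ≤ |dr x w * dr x z| + |ψ ‖x‖ ^ 2 * inner ℝ (dθ x w) (dθ x z)| := abs_add_le _ _
      _ ≤ _ := by linarith

theorem IsModelFunction.continuous_norm (hψ : IsModelFunction ψ) :
    Continuous fun x : M n => ψ ‖x‖ :=
  hψ.smooth.continuousOn.comp_continuous _root_.continuous_norm fun x => norm_nonneg x

theorem measurable_radialVec : Measurable (radialVec (n := n)) := by
  unfold radialVec
  fun_prop

theorem measurable_dr {W : M n → M n} (hW : Measurable W) : Measurable fun x => dr x (W x) :=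
  measurable_radialVec.inner hW

theorem measurable_metric (hψ : IsModelFunction ψ) {W Z : M n → M n} (hW : Measurable W)
    (hZ : Measurable Z) : Measurable fun x => metric ψ x (W x) (Z x) := by
  have hθ : ∀ {W : M n → M n}, Measurable W → Measurable fun x => dθ x (W x) := fun hW =>
    measurable_norm.inv.smul (hW.sub ((measurable_dr hW).smul measurable_radialVec))
  unfold metric
  refine Measurable.ite (measurableSet_singleton 0) (hW.inner hZ) ?_
  exact ((measurable_dr hW).mul (measurable_dr hZ)).add
    ((hψ.continuous_norm.measurable.pow_const 2).mul ((hθ hW).inner (hθ hZ)))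

theorem locallyIntegrable_metric (hψ : IsModelFunction ψ) {W : M n → M n}
    (hW : LocallyIntegrable W) (e : M n) : LocallyIntegrable fun x => metric ψ x (W x) e := by
  have hmeas : AEStronglyMeasurable (fun x => metric ψ x (W x) e) volume := by
    have h1 := hW.aestronglyMeasurable.aemeasurable
    refine ((measurable_metric (Z := fun _ => e) hψ h1.measurable_mk measurable_const).aemeasurable.congr
      ?_).aestronglyMeasurable
    filter_upwards [h1.ae_eq_mk] with x hx
    rw [hx]
  rw [locallyIntegrable_iff] at hW ⊢
  intro K hK
  obtain ⟨R, hR⟩ := hK.isBounded.subset_closedBall 0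
  obtain ⟨C, hC⟩ := exists_abs_metric_le (n := n) hψ (show 0 < max R 1 by positivity)
  refine Integrable.mono' (((hW K hK).norm.const_mul C).mul_const ‖e‖) hmeas.restrict ?_
  filter_upwards [ae_restrict_mem hK.measurableSet] with x hx
  refine hC x ?_ _ _
  have := hR hx
  simp only [Metric.mem_closedBall, dist_zero_right] at this
  exact this.trans (le_max_left _ _)

/-- Weak gradients are unique up to null sets. -/
theorem HasWeakGradient.ae_metric_eq (hψ : IsModelFunction ψ) {v : M n → ℝ} {W W' : M n → M n}
    (h : HasWeakGradient ψ v W) (h' : HasWeakGradient ψ v W') :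
    ∀ᵐ x, metric ψ x (W x) (W x) = metric ψ x (W' x) (W' x) := by
  have key : ∀ e : M n, ∀ᵐ x, metric ψ x (W x) e - metric ψ x (W' x) e = 0 := by
    intro e
    have h1 := locallyIntegrable_metric hψ h.2.1 e
    have h2 := locallyIntegrable_metric hψ h'.2.1 e
    refine ae_eq_zero_of_integral_contDiff_smul_eq_zero (h1.sub h2) fun φ hφ hφc => ?_
    have i1 := h1.integrable_smul_left_of_hasCompactSupport hφ.continuous hφc
    have i2 := h2.integrable_smul_left_of_hasCompactSupport hφ.continuous hφc
    have e1 := h.2.2 φ ⟨hφ, hφc⟩ e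
    have e2 := h'.2.2 φ ⟨hφ, hφc⟩ e
    rw [e1] at e2
    have e3 := neg_injective e2
    simp only [smul_sub]
    rw [integral_sub i1 i2]
    simp only [smul_eq_mul, mul_comm (φ _)]
    rw [e3, sub_self]
  have hall : ∀ᵐ x, ∀ i, metric ψ x (W x) (EuclideanSpace.basisFun (Fin n) ℝ i) -
      metric ψ x (W' x) (EuclideanSpace.basisFun (Fin n) ℝ i) = 0 :=
    ae_all_iff.2 fun i => key _
  filter_upwards [hall] with x hx
  have hform : metricForm ψ x (W x) = metricForm ψ x (W' x) := by
    refine (EuclideanSpace.basisFun (Fin n) ℝ).toBasis.ext fun i => ?_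
    rw [OrthonormalBasis.coe_toBasis]
    exact sub_eq_zero.1 (hx i)
  have hz : ∀ z, metric ψ x (W x) z = metric ψ x (W' x) z := fun z =>
    LinearMap.congr_fun hform z
  rw [hz, metric_comm, hz]

theorem HasWeakGradient.energy_eq (hψ : IsModelFunction ψ) (hn : 2 ≤ n) {v : M n → ℝ}
    {W W' : M n → M n} (h : HasWeakGradient ψ v W) (h' : HasWeakGradient ψ v W') :
    energy ψ W = energy ψ W' := by
  refine lintegral_congr_ae ?_
  filter_upwards [(vol_absolutelyContinuous hψ hn).ae_le (h.ae_metric_eq hψ h')] with x hx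
  rw [hx]

/-- A field that is locally square integrable for the Riemannian volume is locally integrable. -/
theorem locallyIntegrable_of_sq {E : Type*} [NormedAddCommGroup E] (hψ : IsModelFunction ψ)
    (hn : 2 ≤ n) {F : M n → E} (hF : AEStronglyMeasurable F volume)
    (h : ∀ K : Set (M n), IsCompact K → ∫⁻ x in K, ‖F x‖ₑ ^ 2 ∂(vol n ψ) < ⊤) :
    LocallyIntegrable F := by
  rw [locallyIntegrable_iff]
  intro K hK
  refine ⟨hF.restrict, ?_⟩
  obtain ⟨R, hR⟩ := hK.isBounded.subset_closedBall 0
  obtain ⟨C, hC, hle⟩ := exists_volume_le_vol (ψ := ψ) hψ hn (show 0 < max R 1 by positivity)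
  have hKR : K ⊆ Metric.closedBall 0 (max R 1) :=
    hR.trans (Metric.closedBall_subset_closedBall (le_max_left _ _))
  have h1 := sq_lintegral_mul_le (volume.restrict K) (f := fun _ => 1) aemeasurable_const
    hF.enorm.restrict
  simp only [one_mul, one_pow, lintegral_const, Measure.restrict_apply_univ] at h1
  have h2 : ∫⁻ x in K, ‖F x‖ₑ ^ 2 ≤ C * ∫⁻ x in K, ‖F x‖ₑ ^ 2 ∂(vol n ψ) := by
    rw [← smul_eq_mul, ← lintegral_smul_measure]
    exact lintegral_mono' (hle K hKR) le_rfl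
  have h3 : (∫⁻ x in K, ‖F x‖ₑ) ^ 2 < ⊤ := h1.trans_lt
    (ENNReal.mul_lt_top hK.measure_lt_top (h2.trans_lt (ENNReal.mul_lt_top hC.lt_top (h K hK))))
  rw [HasFiniteIntegral]
  by_contra hcon
  rw [not_lt, top_le_iff] at hcon
  rw [hcon] at h3
  simp at h3

end

/-! ### Smooth approximation of radial primitives -/

section

variable {n : ℕ} {ψ : ℝ → ℝ} {g : ℝ → ℝ}

/-- A square integrable function supported in `(a, b]` is approximated in mean square by smooth
functions supported in a slightly larger compact subinterval of `(0, ∞)`. -/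
theorem exists_smooth_approx {τ : ℝ → ℝ} (hτ : MemLp τ 2 volume) {a b : ℝ} (ha : 0 < a)
    (hsupp : ∀ r, r ∉ Ioc a b → τ r = 0) {δ : ℝ≥0∞} (hδ : δ ≠ 0) :
    ∃ Q : ℝ → ℝ, ContDiff ℝ ∞ Q ∧ (∀ r, r ∉ Icc (a / 2) (b + 1) → Q r = 0) ∧
      ∫⁻ r, ‖Q r - τ r‖ₑ ^ 2 ≤ δ := by
  obtain ⟨ε, hε, hεδ⟩ : ∃ ε : ℝ, 0 < ε ∧ ENNReal.ofReal ε ^ 2 ≤ δ := by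
    rcases eq_or_ne δ ⊤ with rfl | hδt
    · exact ⟨1, one_pos, le_top⟩
    · refine ⟨Real.sqrt δ.toReal, Real.sqrt_pos.2 (ENNReal.toReal_pos hδ hδt), ?_⟩
      rw [← ENNReal.ofReal_pow (Real.sqrt_nonneg _), Real.sq_sqrt ENNReal.toReal_nonneg,
        ENNReal.ofReal_toReal hδt]
  obtain ⟨Q₀, -, hQ₀, hQτ⟩ := hτ.exist_eLpNorm_sub_le (by norm_num) (by norm_num) hε
  set χ : ℝ → ℝ := fun r =>
    Real.smoothTransition ((r - a / 2) / (a / 2)) * Real.smoothTransition (b + 1 - r) with hχ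
  have hχs : ContDiff ℝ ∞ χ := by
    refine ContDiff.mul (Real.smoothTransition.contDiff.comp ?_)
      (Real.smoothTransition.contDiff.comp ?_) <;> fun_prop
  have hχ0 : ∀ r, 0 ≤ χ r := fun r =>
    mul_nonneg (Real.smoothTransition.nonneg _) (Real.smoothTransition.nonneg _)
  have hχ1 : ∀ r, χ r ≤ 1 := fun r =>
    mul_le_one₀ (Real.smoothTransition.le_one _) (Real.smoothTransition.nonneg _)
      (Real.smoothTransition.le_one _)
  have hχone : ∀ r ∈ Ioc a b, χ r = 1 := fun r hr => by
    simp only [hχ]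
    rw [Real.smoothTransition.one_of_one_le, Real.smoothTransition.one_of_one_le, one_mul]
    · linarith [hr.2]
    · rw [le_div_iff₀ (by positivity)]
      linarith [hr.1]
  refine ⟨fun r => χ r * Q₀ r, hχs.mul hQ₀, fun r hr => ?_, ?_⟩
  · have : χ r = 0 := by
      simp only [hχ]
      by_cases h1 : r < a / 2
      · rw [Real.smoothTransition.zero_of_nonpos, zero_mul]
        exact div_nonpos_of_nonpos_of_nonneg (by linarith) (by positivity)
      · rw [Real.smoothTransition.zero_of_nonpos (x := b + 1 - r), mul_zero]
        by_contra! h2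
        exact hr ⟨not_lt.1 h1, by linarith⟩
    simp only [this, zero_mul]
  · have h1 : ∀ r, ‖χ r * Q₀ r - τ r‖ₑ ^ 2 ≤ ‖(τ - Q₀) r‖ₑ ^ 2 := by
      intro r
      have h2 : χ r * Q₀ r - τ r = χ r * (Q₀ r - τ r) := by
        by_cases hr : r ∈ Ioc a b
        · rw [hχone r hr, one_mul, one_mul]
        · rw [hsupp r hr, sub_zero, sub_zero]
      rw [h2, enorm_mul, Pi.sub_apply, ← enorm_neg (τ r - Q₀ r), neg_sub]
      refine pow_le_pow_left' (mul_le_of_le_one_left' ?_) 2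
      rw [Real.enorm_of_nonneg (hχ0 r)]
      exact ENNReal.ofReal_le_one.2 (hχ1 r)
    refine (lintegral_mono h1).trans ?_
    have h2 := eLpNorm_nnreal_pow_eq_lintegral (f := τ - Q₀) (μ := volume) (p := 2) (by norm_num)
    simp only [NNReal.coe_ofNat, ENNReal.coe_ofNat, ENNReal.rpow_two] at h2
    rw [← h2]
    exact (pow_le_pow_left' hQτ 2).trans hεδ

/-- A function on the half-line with finite energy `∫ P² g` and finite tails `∫_r^∞ P`. -/
structure IsRadialSlope (g P : ℝ → ℝ) : Prop where
  meas : Measurable P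
  nonneg : ∀ r, 0 ≤ P r
  tail : ∀ r, 0 < r → IntegrableOn P (Ioi r)
  energy : ∫⁻ r, ENNReal.ofReal (P r) ^ 2 ∂(radMeas g) ≠ ⊤

variable {P : ℝ → ℝ}

/-- The nonincreasing function with slope `-P` that vanishes at infinity. -/
def tailInt (P : ℝ → ℝ) (r : ℝ) : ℝ := ∫ s in Ioi r, P s

theorem IsRadialSlope.tailInt_nonneg (h : IsRadialSlope g P) (r : ℝ) : 0 ≤ tailInt P r :=
  integral_nonneg fun s => h.nonneg s

theorem IsRadialSlope.tailInt_anti (h : IsRadialSlope g P) {r s : ℝ} (hr : 0 < r) (hrs : r ≤ s) :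
    tailInt P s ≤ tailInt P r :=
  setIntegral_mono_set (h.tail r hr) (Eventually.of_forall fun s => h.nonneg s)
    (Ioi_subset_Ioi hrs).eventuallyLE

theorem IsRadialSlope.tailInt_sub (h : IsRadialSlope g P) {r s : ℝ} (hr : 0 < r) (hrs : r ≤ s) :
    tailInt P r - tailInt P s = ∫ t in Ioc r s, P t := by
  rw [tailInt, tailInt, ← Ioc_union_Ioi_eq_Ioi hrs, setIntegral_union (Ioc_disjoint_Ioi le_rfl)
    measurableSet_Ioi ((h.tail r hr).mono_set Ioc_subset_Ioi_self) (h.tail s (hr.trans_le hrs))]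
  ring

theorem IsRadialSlope.measurable_tailInt (h : IsRadialSlope g P) :
    Measurable (tailInt P) := by
  have h1 : Antitone fun r => ∫⁻ s in Ioi r, ENNReal.ofReal (P s) := fun r s hrs =>
    lintegral_mono_set (Ioi_subset_Ioi hrs)
  have h2 : tailInt P = fun r => (∫⁻ s in Ioi r, ENNReal.ofReal (P s)).toReal := by
    funext r
    exact integral_eq_lintegral_of_nonneg_ae (Eventually.of_forall fun s => h.nonneg s)
      h.meas.aestronglyMeasurable
  rw [h2]
  exact h1.measurable.ennreal_toReal

theorem IsRadialSlope.tendsto_tailInt (h : IsRadialSlope g P) :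
    Tendsto (tailInt P) atTop (𝓝 0) := by
  have h1 := intervalIntegral_tendsto_integral_Ioi 1 (h.tail 1 one_pos) tendsto_id
  have h2 : Tendsto (fun r => tailInt P 1 - ∫ t in (1 : ℝ)..r, P t) atTop (𝓝 0) := by
    have := h1.const_sub (tailInt P 1)
    simpa [tailInt] using this
  refine h2.congr' ?_
  filter_upwards [eventually_ge_atTop 1] with r hr
  rw [intervalIntegral.integral_of_le hr, ← h.tailInt_sub one_pos hr]
  ring

theorem IsRadialSlope.lintegral_Ioc_le (h : IsRadialSlope g P) (hg : IsDensity g) {a b m : ℝ}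
    (hm : ∀ r ∈ Ioc a b, m ≤ g r) :
    ENNReal.ofReal m * ∫⁻ r in Ioc a b, ENNReal.ofReal (P r) ^ 2 ≤
      ∫⁻ r, ENNReal.ofReal (P r) ^ 2 ∂(radMeas g) := by
  rw [hg.lintegral_radMeas, ← lintegral_const_mul _ (h.meas.ennreal_ofReal.pow_const 2)]
  calc _ ≤ ∫⁻ r in Ioc a b, ENNReal.ofReal (g r) * ENNReal.ofReal (P r) ^ 2 := by
        refine setLIntegral_mono' measurableSet_Ioc fun r hr => ?_
        gcongr
        exact hm r hr
    _ ≤ _ := lintegral_mono' Measure.restrict_le_self le_rfl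

theorem IsDensity.exists_bounds (hg : IsDensity g) {a b : ℝ} (ha : 0 < a) (hab : a ≤ b) :
    ∃ m C : ℝ, 0 < m ∧ 0 < C ∧ ∀ r ∈ Icc a b, m ≤ g r ∧ g r ≤ C := by
  obtain ⟨x, hx, hmin⟩ := isCompact_Icc.exists_isMinOn (nonempty_Icc.2 hab)
    (hg.cont.continuousOn (s := Icc a b))
  obtain ⟨y, hy, hmax⟩ := isCompact_Icc.exists_isMaxOn (nonempty_Icc.2 hab)
    (hg.cont.continuousOn (s := Icc a b))
  exact ⟨g x, g y, hg.pos _ (ha.trans_le hx.1), hg.pos _ (ha.trans_le hy.1),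
    fun r hr => ⟨hmin hr, hmax hr⟩⟩

/-- Approximation of a slope by smooth slopes with compact support in `(0, ∞)`, in energy and with
control of the primitives vanishing at infinity. -/
theorem IsRadialSlope.exists_approx (h : IsRadialSlope g P) (hg : IsDensity g) {ε : ℝ}
    (hε : 0 < ε) :
    ∃ (Q : ℝ → ℝ) (a b : ℝ), ContDiff ℝ ∞ Q ∧ 0 < a ∧ a ≤ b ∧ (∀ r, r ∉ Icc a b → Q r = 0) ∧
      ∫⁻ r, ‖Q r - P r‖ₑ ^ 2 ∂(radMeas g) ≤ ENNReal.ofReal ε ∧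
      ∀ r, 0 < r → |tailInt Q r - tailInt P r| ≤ ε + indicator (Iio ε) (tailInt P) r := by
  set E : Set ℝ → ℝ≥0∞ := fun s => ∫⁻ r in s, ENNReal.ofReal (P r) ^ 2 ∂(radMeas g)
  -- truncation near the pole and near infinity
  have hε8 : ENNReal.ofReal (ε / 8) ≠ 0 := by simpa using hε
  have hpole : ∃ a, 0 < a ∧ a < ε ∧ a < 1 ∧ E (Iic a) ≤ ENNReal.ofReal (ε / 8) := by
    have hmeas : Tendsto (fun k : ℕ => radMeas g (Iic (1 / ((k : ℝ) + 1)))) atTop (𝓝 0) := by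
      have h1 : Tendsto (fun k : ℕ => ENNReal.ofReal (cumVol g (1 / ((k : ℝ) + 1)))) atTop
          (𝓝 (ENNReal.ofReal (cumVol g 0))) :=
        ENNReal.tendsto_ofReal ((hg.continuous_cumVol.tendsto 0).comp
          tendsto_one_div_add_atTop_nhds_zero_nat)
      rw [cumVol_zero, ENNReal.ofReal_zero] at h1
      refine h1.congr fun k => ?_
      rw [hg.radMeas_Iic (by positivity)]
    have h2 := tendsto_setLIntegral_zero h.energy hmeas
    have hlim := tendsto_one_div_add_atTop_nhds_zero_nat (𝕜 := ℝ)
    obtain ⟨k, ⟨hk1, hk2⟩, hk3⟩ := ((h2.eventually_le_const (pos_iff_ne_zero.2 hε8)).and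
      (hlim.eventually_lt_const hε)).and (hlim.eventually_lt_const one_pos) |>.exists
    exact ⟨_, by positivity, hk2, hk3, hk1⟩
  obtain ⟨a, ha, haε, ha1, hEa⟩ := hpole
  have hinf : ∃ b, 1 < b ∧ tailInt P b ≤ ε / 2 ∧ E (Ioi b) ≤ ENNReal.ofReal (ε / 8) := by
    have hanti : Antitone fun k : ℕ => Ioi (k : ℝ) := fun i j hij =>
      Ioi_subset_Ioi (by exact_mod_cast hij)
    have h1 : Tendsto (fun k : ℕ => E (Ioi (k : ℝ))) atTop (𝓝 0) := by
      have h2 := tendsto_measure_iInter_atTop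
        (μ := (radMeas g).withDensity fun r => ENNReal.ofReal (P r) ^ 2)
        (s := fun k : ℕ => Ioi (k : ℝ)) (fun k => measurableSet_Ioi.nullMeasurableSet) hanti
        ⟨0, by
          rw [withDensity_apply _ measurableSet_Ioi]
          exact ((lintegral_mono' Measure.restrict_le_self le_rfl).trans_lt
            h.energy.lt_top).ne⟩
      have hemp : (⋂ k : ℕ, Ioi (k : ℝ)) = ∅ := by
        refine eq_empty_of_forall_notMem fun x hx => ?_
        obtain ⟨k, hk⟩ := exists_nat_gt x
        exact absurd (mem_iInter.1 hx k) (not_lt.2 hk.le)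
      rw [hemp, measure_empty] at h2
      refine h2.congr fun k => ?_
      exact withDensity_apply _ measurableSet_Ioi
    obtain ⟨k, ⟨hk1, hk2⟩, hk3⟩ := ((h1.eventually_le_const (pos_iff_ne_zero.2 hε8)).and
      ((h.tendsto_tailInt.comp tendsto_natCast_atTop_atTop).eventually_le_const
        (half_pos hε))).and (tendsto_natCast_atTop_atTop.eventually_gt_atTop (1 : ℝ)) |>.exists
    exact ⟨k, hk3, hk2, hk1⟩
  obtain ⟨b, hb1, hPb, hEb⟩ := hinf
  have hab : a ≤ b := (ha1.trans hb1).le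
  obtain ⟨m, C', hm, hC', hmb⟩ := hg.exists_bounds ha hab
  obtain ⟨m', C, hm', hC, hCb⟩ := hg.exists_bounds (half_pos ha) (show a / 2 ≤ b + 1 by linarith)
  set τ : ℝ → ℝ := indicator (Ioc a b) P
  have hτm : Measurable τ := h.meas.indicator measurableSet_Ioc
  have hτ : MemLp τ 2 volume := by
    rw [memLp_indicator_iff_restrict measurableSet_Ioc]
    refine ⟨h.meas.aestronglyMeasurable, ?_⟩
    have h1 := h.lintegral_Ioc_le hg fun r hr => (hmb r (Ioc_subset_Icc_self hr)).1
    have h2 : ∫⁻ r in Ioc a b, ENNReal.ofReal (P r) ^ 2 ≠ ⊤ := by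
      intro htop
      rw [htop, ENNReal.mul_top (by simpa using hm), top_le_iff] at h1
      exact h.energy h1
    have h3 := eLpNorm_nnreal_pow_eq_lintegral (f := P) (μ := volume.restrict (Ioc a b)) (p := 2)
      (by norm_num)
    simp only [NNReal.coe_ofNat, ENNReal.coe_ofNat, ENNReal.rpow_two] at h3
    have h4 : ∫⁻ r in Ioc a b, ‖P r‖ₑ ^ 2 = ∫⁻ r in Ioc a b, ENNReal.ofReal (P r) ^ 2 :=
      lintegral_congr fun r => by rw [Real.enorm_of_nonneg (h.nonneg r)]
    rw [h4] at h3
    by_contra hcon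
    rw [not_lt, top_le_iff] at hcon
    rw [hcon] at h3
    exact h2 (by rw [← h3]; rfl)
  -- the tolerance for the smooth approximation of the truncated slope
  set δ : ℝ := min (ε / (8 * C)) ((ε / 2) ^ 2 / (b + 1))
  have hδ : 0 < δ := lt_min (by positivity) (by positivity)
  obtain ⟨Q, hQ, hQ0, hQτ⟩ := exists_smooth_approx hτ ha
    (fun r hr => indicator_of_notMem hr _) (δ := ENNReal.ofReal δ) (by simpa using hδ)
  have hQm : Measurable Q := hQ.continuous.measurable
  have hQτ0 : ∀ r, r ∉ Icc (a / 2) (b + 1) → Q r - τ r = 0 := fun r hr => by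
    rw [hQ0 r hr, zero_sub, neg_eq_zero]
    exact indicator_of_notMem (fun h' => hr ⟨by linarith [h'.1], by linarith [h'.2]⟩) _
  have hQc : HasCompactSupport Q := HasCompactSupport.intro (isCompact_Icc (a := a / 2)
    (b := b + 1)) hQ0
  have hQi : Integrable Q := hQ.continuous.integrable_of_hasCompactSupport hQc
  have hτi : Integrable τ := (integrable_indicator_iff measurableSet_Ioc).2
    ((h.tail a ha).mono_set Ioc_subset_Ioi_self)
  refine ⟨Q, a / 2, b + 1, hQ, half_pos ha, by linarith, hQ0, ?_, ?_⟩
  · have hsplit : ∀ r, ‖Q r - P r‖ₑ ^ 2 ≤ 2 * ‖Q r - τ r‖ₑ ^ 2 + 2 * ‖τ r - P r‖ₑ ^ 2 := by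
      intro r
      rw [← mul_add]
      have h1 : ‖Q r - P r‖ₑ ≤ ‖Q r - τ r‖ₑ + ‖τ r - P r‖ₑ := by
        refine le_trans (le_of_eq ?_) (enorm_add_le _ _)
        congr 1
        ring
      refine (pow_le_pow_left' h1 2).trans ?_
      have := ENNReal.rpow_add_le_mul_rpow_add_rpow ‖Q r - τ r‖ₑ ‖τ r - P r‖ₑ
        (one_le_two : (1 : ℝ) ≤ 2)
      norm_num at this
      exact this
    have h1 : ∫⁻ r, ‖Q r - τ r‖ₑ ^ 2 ∂(radMeas g) ≤ ENNReal.ofReal (ε / 8) := by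
      calc ∫⁻ r, ‖Q r - τ r‖ₑ ^ 2 ∂(radMeas g)
          ≤ ∫⁻ r, ENNReal.ofReal C * ‖Q r - τ r‖ₑ ^ 2 := by
            rw [hg.lintegral_radMeas]
            refine lintegral_mono fun r => ?_
            by_cases hr : r ∈ Icc (a / 2) (b + 1)
            · exact mul_le_mul_left (ENNReal.ofReal_le_ofReal (hCb r hr).2) _
            · simp [hQτ0 r hr]
        _ = ENNReal.ofReal C * ∫⁻ r, ‖Q r - τ r‖ₑ ^ 2 :=
            lintegral_const_mul _ ((hQm.sub hτm).enorm.pow_const 2)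
        _ ≤ ENNReal.ofReal C * ENNReal.ofReal δ := by gcongr
        _ = ENNReal.ofReal (C * δ) := (ENNReal.ofReal_mul hC.le).symm
        _ ≤ ENNReal.ofReal (ε / 8) := by
            refine ENNReal.ofReal_le_ofReal ?_
            calc C * δ ≤ C * (ε / (8 * C)) := by gcongr; exact min_le_left _ _
              _ = ε / 8 := by field_simp
    have h2 : ∫⁻ r, ‖τ r - P r‖ₑ ^ 2 ∂(radMeas g) ≤ ENNReal.ofReal (ε / 8) +
        ENNReal.ofReal (ε / 8) := by
      have h3 : ∀ r, ‖τ r - P r‖ₑ ^ 2 ≤ indicator (Iic a) (fun r => ENNReal.ofReal (P r) ^ 2) r +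
          indicator (Ioi b) (fun r => ENNReal.ofReal (P r) ^ 2) r := by
        intro r
        by_cases hr : r ∈ Ioc a b
        · simp only [τ, indicator_of_mem hr, sub_self, enorm_zero]
          norm_num
        · simp only [τ, indicator_of_notMem hr, zero_sub, enorm_neg]
          rw [Real.enorm_of_nonneg (h.nonneg r)]
          rcases le_or_gt r a with h4 | h4
          · rw [indicator_of_mem (show r ∈ Iic a from h4)]
            exact le_self_add
          · have h5 : b < r := by
              by_contra! h5
              exact hr ⟨h4, h5⟩
            rw [indicator_of_mem (show r ∈ Ioi b from h5)]
            exact le_add_self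
      refine (lintegral_mono h3).trans ?_
      rw [lintegral_add_left ((h.meas.ennreal_ofReal.pow_const 2).indicator measurableSet_Iic),
        lintegral_indicator measurableSet_Iic, lintegral_indicator measurableSet_Ioi]
      exact add_le_add hEa hEb
    calc ∫⁻ r, ‖Q r - P r‖ₑ ^ 2 ∂(radMeas g)
        ≤ ∫⁻ r, (2 * ‖Q r - τ r‖ₑ ^ 2 + 2 * ‖τ r - P r‖ₑ ^ 2) ∂(radMeas g) :=
          lintegral_mono hsplit
      _ = 2 * ∫⁻ r, ‖Q r - τ r‖ₑ ^ 2 ∂(radMeas g) +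
          2 * ∫⁻ r, ‖τ r - P r‖ₑ ^ 2 ∂(radMeas g) := by
          have m1 : Measurable fun r => ‖Q r - τ r‖ₑ ^ 2 := (hQm.sub hτm).enorm.pow_const 2
          have m2 : Measurable fun r => ‖τ r - P r‖ₑ ^ 2 := (hτm.sub h.meas).enorm.pow_const 2
          rw [lintegral_add_left (m1.const_mul 2), lintegral_const_mul _ m1,
            lintegral_const_mul _ m2]
      _ ≤ 2 * ENNReal.ofReal (ε / 8) + 2 * (ENNReal.ofReal (ε / 8) + ENNReal.ofReal (ε / 8)) := by
          gcongr
      _ ≤ ENNReal.ofReal ε := by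
          rw [show (2 : ℝ≥0∞) = ENNReal.ofReal 2 by norm_num, ← ENNReal.ofReal_add, ←
            ENNReal.ofReal_mul, ← ENNReal.ofReal_mul, ← ENNReal.ofReal_add]
          · exact ENNReal.ofReal_le_ofReal (by linarith)
          all_goals positivity
  · intro r hr
    have h1 : |tailInt Q r - tailInt τ r| ≤ ε / 2 := by
      have e1 : tailInt Q r - tailInt τ r = ∫ s in Ioi r, (Q s - τ s) :=
        (integral_sub hQi.integrableOn hτi.integrableOn).symm
      have h2 : ‖∫ s in Ioi r, (Q s - τ s)‖ₑ ≤ ∫⁻ s in Icc (a / 2) (b + 1), ‖Q s - τ s‖ₑ := by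
        refine (enorm_integral_le_lintegral_enorm _).trans ?_
        rw [← lintegral_indicator (measurableSet_Icc (a := a / 2) (b := b + 1))]
        refine (lintegral_mono' Measure.restrict_le_self le_rfl).trans (lintegral_mono fun s => ?_)
        by_cases hs : s ∈ Icc (a / 2) (b + 1)
        · rw [indicator_of_mem hs]
        · rw [hQτ0 s hs, enorm_zero]
          exact zero_le
      have h3 := sq_lintegral_mul_le (volume.restrict (Icc (a / 2) (b + 1))) (f := fun _ => 1)
        aemeasurable_const (hQm.sub hτm).enorm.aemeasurable
      simp only [one_mul, one_pow, lintegral_const, Measure.restrict_apply_univ,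
        Real.volume_Icc] at h3
      have h4 : ‖∫ s in Ioi r, (Q s - τ s)‖ₑ ^ 2 ≤ ENNReal.ofReal (ε / 2) ^ 2 := by
        refine (pow_le_pow_left' h2 2).trans (h3.trans ?_)
        calc _ ≤ ENNReal.ofReal (b + 1) * ENNReal.ofReal δ := by
              gcongr
              · linarith
              · exact (lintegral_mono' Measure.restrict_le_self le_rfl).trans hQτ
          _ = ENNReal.ofReal ((b + 1) * δ) := (ENNReal.ofReal_mul (by linarith)).symm
          _ ≤ ENNReal.ofReal ((ε / 2) ^ 2) := by
              refine ENNReal.ofReal_le_ofReal ?_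
              calc (b + 1) * δ ≤ (b + 1) * ((ε / 2) ^ 2 / (b + 1)) := by
                    gcongr
                    exact min_le_right _ _
                _ = (ε / 2) ^ 2 := by field_simp
          _ = _ := ENNReal.ofReal_pow (by positivity) 2
      have h5 : ‖∫ s in Ioi r, (Q s - τ s)‖ₑ ≤ ENNReal.ofReal (ε / 2) :=
        (ENNReal.pow_le_pow_left_iff two_ne_zero).1 h4
      rw [e1, ← Real.norm_eq_abs]
      rw [← ofReal_norm] at h5
      exact (ENNReal.ofReal_le_ofReal_iff (by positivity)).1 h5
    have h2 : |tailInt τ r - tailInt P r| ≤ ε / 2 + indicator (Iio ε) (tailInt P) r := by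
      have hτint : ∀ r, tailInt τ r = ∫ s in Ioi r ∩ Ioc a b, P s := fun r => by
        rw [tailInt, setIntegral_indicator measurableSet_Ioc]
      have hbd : tailInt τ r ≤ tailInt P r := by
        rw [hτint]
        exact setIntegral_mono_set (h.tail r hr) (Eventually.of_forall fun s => h.nonneg s)
          inter_subset_left.eventuallyLE
      rw [abs_sub_comm, abs_of_nonneg (sub_nonneg.2 hbd)]
      by_cases hra : r < a
      · rw [indicator_of_mem (show r ∈ Iio ε from hra.trans haε)]
        have : 0 ≤ tailInt τ r := by
          rw [hτint]
          exact integral_nonneg fun s => h.nonneg s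
        linarith
      · have h3 : 0 ≤ indicator (Iio ε) (tailInt P) r :=
          indicator_nonneg (fun s _ => h.tailInt_nonneg s) r
        have h4 : tailInt P r - tailInt τ r ≤ tailInt P b := by
          have hset : Ioi r ∩ Ioc a b = Ioc r b := by
            ext s
            simp only [mem_inter_iff, mem_Ioi, mem_Ioc]
            exact ⟨fun h => ⟨h.1, h.2.2⟩, fun h => ⟨h.1, (not_lt.1 hra).trans_lt h.1, h.2⟩⟩
          rw [hτint, hset]
          rcases le_or_gt r b with hrb | hrb
          · rw [← h.tailInt_sub hr hrb]
            linarith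
          · rw [Ioc_eq_empty (not_lt.2 hrb.le), setIntegral_empty, sub_zero]
            exact h.tailInt_anti (by linarith) hrb.le
        linarith
    calc |tailInt Q r - tailInt P r|
        = |(tailInt Q r - tailInt τ r) + (tailInt τ r - tailInt P r)| := by ring_nf
      _ ≤ |tailInt Q r - tailInt τ r| + |tailInt τ r - tailInt P r| := abs_add_le _ _
      _ ≤ _ := by linarith

end

/-! ### Radial functions in the homogeneous Sobolev space -/

section

variable {n : ℕ} {ψ : ℝ → ℝ} {P : ℝ → ℝ}

/-- Primitives of slopes with finite energy are locally square integrable at the pole: since `g` is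
comparable to `rⁿ⁻¹`, the Cauchy–Schwarz inequality bounds the product of `g` with the square of the
primitive. -/
theorem IsRadialSlope.lintegral_sq_tailInt (hψ : IsModelFunction ψ) (hn : 2 ≤ n)
    (h : IsRadialSlope (dens n ψ) P) {R : ℝ} (hR : 0 < R) :
    ∫⁻ r in Iic R, ENNReal.ofReal (tailInt P r) ^ 2 ∂(radMeas (dens n ψ)) < ⊤ := by
  have hg := hψ.isDensity hn
  obtain ⟨c, C, hc, hb⟩ := hψ.exists_bounds hR
  have hC : 0 < C := by
    have h1 := hb R ⟨hR, le_rfl⟩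
    have h2 : 0 < C * R := (mul_pos hc hR).trans_le (h1.1.trans h1.2)
    exact pos_of_mul_pos_left h2 hR.le
  set E := ∫⁻ r, ENNReal.ofReal (P r) ^ 2 ∂(radMeas (dens n ψ))
  set T := tailInt P R
  have hT : 0 ≤ T := h.tailInt_nonneg R
  set B : ℝ≥0∞ := ENNReal.ofReal ((C * R) ^ (n - 1)) * (2 * ENNReal.ofReal T ^ 2) +
    2 * (ENNReal.ofReal ((C / c) ^ (n - 1)) * (ENNReal.ofReal R * E)) with hB
  have hBfin : B < ⊤ := by
    have hE : E < ⊤ := h.energy.lt_top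
    refine ENNReal.add_lt_top.2 ⟨ENNReal.mul_lt_top ENNReal.ofReal_lt_top
      (ENNReal.mul_lt_top (by simp) (ENNReal.pow_lt_top ENNReal.ofReal_lt_top)),
      ENNReal.mul_lt_top (by simp) (ENNReal.mul_lt_top ENNReal.ofReal_lt_top
        (ENNReal.mul_lt_top ENNReal.ofReal_lt_top hE))⟩
  have hbound : ∀ r ∈ Ioc 0 R,
      ENNReal.ofReal (dens n ψ r) * ENNReal.ofReal (tailInt P r) ^ 2 ≤ B := by
    intro r hr
    set I := ∫⁻ s in Ioc r R, ENNReal.ofReal (P s)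
    have hi : IntegrableOn P (Ioc r R) := (h.tail r hr.1).mono_set Ioc_subset_Ioi_self
    have h1 : ENNReal.ofReal (tailInt P r) = ENNReal.ofReal T + I := by
      have h2 := h.tailInt_sub hr.1 hr.2
      have h3 : ENNReal.ofReal (∫ s in Ioc r R, P s) = I :=
        ofReal_integral_eq_lintegral_ofReal hi (Eventually.of_forall fun s => h.nonneg s)
      rw [← h3, ← ENNReal.ofReal_add hT (integral_nonneg fun s => h.nonneg s), ← h2]
      congr 1
      ring
    have h2 : I ^ 2 ≤ ENNReal.ofReal R * ∫⁻ s in Ioc r R, ENNReal.ofReal (P s) ^ 2 := by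
      have h3 := sq_lintegral_mul_le (volume.restrict (Ioc r R)) (f := fun _ => 1)
        aemeasurable_const h.meas.ennreal_ofReal.aemeasurable
      simp only [one_mul, one_pow, lintegral_const, Measure.restrict_apply_univ,
        Real.volume_Ioc] at h3
      refine h3.trans (mul_le_mul_left (ENNReal.ofReal_le_ofReal ?_) _)
      linarith [hr.1]
    have h3 : ENNReal.ofReal ((c * r) ^ (n - 1)) * ∫⁻ s in Ioc r R, ENNReal.ofReal (P s) ^ 2 ≤ E := by
      refine h.lintegral_Ioc_le hg fun s hs => ?_
      have hs0 : 0 < s := hr.1.trans hs.1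
      rw [dens_of_pos hs0.le]
      refine pow_le_pow_left₀ (mul_pos hc hr.1).le ?_ _
      exact (mul_le_mul_of_nonneg_left hs.1.le hc.le).trans (hb s ⟨hs0, hs.2⟩).1
    have h4 : dens n ψ r ≤ (C * r) ^ (n - 1) := by
      rw [dens_of_pos hr.1.le]
      exact pow_le_pow_left₀ (hψ.pos r hr.1).le (hb r hr).2 _
    have h5 : dens n ψ r ≤ (C * R) ^ (n - 1) :=
      h4.trans (pow_le_pow_left₀ (mul_pos hC hr.1).le (mul_le_mul_of_nonneg_left hr.2 hC.le) _)
    have h6 : ENNReal.ofReal (dens n ψ r) * I ^ 2 ≤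
        ENNReal.ofReal ((C / c) ^ (n - 1)) * (ENNReal.ofReal R * E) := by
      have e : (C * r) ^ (n - 1) = (C / c) ^ (n - 1) * (c * r) ^ (n - 1) := by
        rw [← mul_pow]
        congr 1
        field_simp
      calc ENNReal.ofReal (dens n ψ r) * I ^ 2
          ≤ ENNReal.ofReal ((C / c) ^ (n - 1) * (c * r) ^ (n - 1)) *
            (ENNReal.ofReal R * ∫⁻ s in Ioc r R, ENNReal.ofReal (P s) ^ 2) := by
            rw [← e]
            gcongr
        _ = ENNReal.ofReal ((C / c) ^ (n - 1)) * (ENNReal.ofReal R *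
            (ENNReal.ofReal ((c * r) ^ (n - 1)) *
              ∫⁻ s in Ioc r R, ENNReal.ofReal (P s) ^ 2)) := by
            rw [ENNReal.ofReal_mul (by positivity)]
            ring
        _ ≤ _ := by gcongr
    have h7 : (ENNReal.ofReal T + I) ^ 2 ≤ 2 * ENNReal.ofReal T ^ 2 + 2 * I ^ 2 := by
      have := ENNReal.rpow_add_le_mul_rpow_add_rpow (ENNReal.ofReal T) I
        (one_le_two : (1 : ℝ) ≤ 2)
      norm_num at this
      rwa [mul_add] at this
    calc ENNReal.ofReal (dens n ψ r) * ENNReal.ofReal (tailInt P r) ^ 2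
        ≤ ENNReal.ofReal (dens n ψ r) * (2 * ENNReal.ofReal T ^ 2 + 2 * I ^ 2) := by
          rw [h1]
          gcongr
      _ = ENNReal.ofReal (dens n ψ r) * (2 * ENNReal.ofReal T ^ 2) +
          2 * (ENNReal.ofReal (dens n ψ r) * I ^ 2) := by ring
      _ ≤ B := by
          rw [hB]
          gcongr
  have hmeas : Measurable fun r => ENNReal.ofReal (tailInt P r) ^ 2 :=
    h.measurable_tailInt.ennreal_ofReal.pow_const 2
  calc ∫⁻ r in Iic R, ENNReal.ofReal (tailInt P r) ^ 2 ∂(radMeas (dens n ψ))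
      = ∫⁻ r, ENNReal.ofReal (dens n ψ r) *
          indicator (Iic R) (fun r => ENNReal.ofReal (tailInt P r) ^ 2) r := by
        rw [← lintegral_indicator measurableSet_Iic, hg.lintegral_radMeas]
    _ ≤ ∫⁻ r, indicator (Ioc 0 R) (fun _ => B) r := by
        refine lintegral_mono fun r => ?_
        by_cases hr0 : 0 < r
        · by_cases hr : r ≤ R
          · rw [indicator_of_mem (show r ∈ Iic R from hr),
              indicator_of_mem (show r ∈ Ioc 0 R from ⟨hr0, hr⟩)]
            exact hbound r ⟨hr0, hr⟩
          · rw [indicator_of_notMem (show r ∉ Iic R from hr), mul_zero]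
            exact zero_le
        · rw [hg.zero r (not_lt.1 hr0), ENNReal.ofReal_zero, zero_mul]
          exact zero_le
    _ = B * volume (Ioc 0 R) := by
        rw [lintegral_indicator measurableSet_Ioc, setLIntegral_const]
    _ < ⊤ := ENNReal.mul_lt_top hBfin measure_Ioc_lt_top

/-- The derivative of the distance to the pole. -/
theorem hasFDerivAt_norm_of_ne {x : M n} (hx : x ≠ 0) :
    HasFDerivAt (fun x : M n => ‖x‖) (innerSL ℝ (radialVec x)) x := by
  have h0 : ‖x‖ ≠ 0 := norm_ne_zero_iff.2 hx
  have h1 := (hasStrictFDerivAt_norm_sq x).hasFDerivAt.sqrt (by positivity)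
  have h2 : (fun y : M n => Real.sqrt (‖y‖ ^ 2)) = fun y => ‖y‖ := by
    funext y
    exact Real.sqrt_sq (norm_nonneg y)
  rw [h2, Real.sqrt_sq (norm_nonneg x)] at h1
  have e : innerSL ℝ (radialVec x) = (1 / (2 * ‖x‖)) • (2 • innerSL ℝ x) := by
    ext z
    simp [radialVec]
    field_simp
  rw [e]
  exact h1

/-- The radial function with a smooth slope compactly supported in `(0, ∞)` is a test function. -/
theorem isTestFunction_tailInt {Q : ℝ → ℝ} (hQ : ContDiff ℝ ∞ Q) {a b : ℝ} (ha : 0 < a)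
    (hQ0 : ∀ r, r ∉ Icc a b → Q r = 0) :
    IsTestFunction (fun x : M n => tailInt Q ‖x‖) ∧
      ∀ x : M n, grad ψ (fun x => tailInt Q ‖x‖) x = (-Q ‖x‖) • radialVec x := by
  have hQc : HasCompactSupport Q := HasCompactSupport.intro (isCompact_Icc (a := a) (b := b)) hQ0
  have hQi : Integrable Q := hQ.continuous.integrable_of_hasCompactSupport hQc
  have hprim : ∀ r, tailInt Q r = tailInt Q 0 - ∫ s in (0 : ℝ)..r, Q s := fun r => by
    have := intervalIntegral.integral_Ioi_sub_Ioi' (μ := volume) (a := 0) (b := r)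
      (f := Q) hQi.integrableOn hQi.integrableOn
    rw [tailInt, tailInt, ← this]
    ring
  have hder : ∀ r, HasDerivAt (tailInt Q) (-Q r) r := by
    intro r
    have h1 : HasDerivAt (fun r => ∫ s in (0 : ℝ)..r, Q s) (Q r) r :=
      intervalIntegral.integral_hasDerivAt_right (hQ.continuous.intervalIntegrable _ _)
        (hQ.continuous.stronglyMeasurableAtFilter _ _) hQ.continuous.continuousAt
    have h2 := h1.const_sub (tailInt Q 0)
    rwa [← funext hprim] at h2
  have hsmooth : ContDiff ℝ ∞ (tailInt Q) := by
    rw [contDiff_infty_iff_deriv]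
    refine ⟨fun r => (hder r).differentiableAt, ?_⟩
    have : deriv (tailInt Q) = fun r => -Q r := funext fun r => (hder r).deriv
    rw [this]
    exact hQ.neg
  -- the function is constant near the pole
  have hnear : ∀ r < a, tailInt Q r = tailInt Q 0 := fun r hr => by
    rw [hprim, intervalIntegral.integral_congr (g := fun _ => 0), intervalIntegral.integral_zero,
      sub_zero]
    intro s hs
    refine hQ0 s fun h => ?_
    have := (mem_uIcc.1 hs)
    rcases this with h1 | h1 <;> linarith [h.1, h1.1, h1.2]
  have hnear' : ∀ᶠ x : M n in 𝓝 0, tailInt Q ‖x‖ = tailInt Q 0 := by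
    filter_upwards [Metric.ball_mem_nhds (0 : M n) ha] with x hx
    exact hnear _ (by simpa using hx)
  have hfar : ∀ r, b < r → tailInt Q r = 0 := fun r hr => by
    rw [tailInt, setIntegral_congr_fun (g := fun _ => 0) measurableSet_Ioi, integral_zero]
    intro s hs
    exact hQ0 s fun h => absurd h.2 (not_le.2 (hr.trans hs))
  refine ⟨⟨contDiff_iff_contDiffAt.2 fun x => ?_, ?_⟩, fun x => ?_⟩
  · by_cases hx : x = 0
    · rw [hx]
      exact contDiffAt_const.congr_of_eventuallyEq hnear'
    · exact hsmooth.contDiffAt.comp x (contDiffAt_norm ℝ hx)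
  · refine HasCompactSupport.intro (isCompact_closedBall (0 : M n) b) fun x hx => hfar _ ?_
    simpa using hx
  · by_cases hx : x = 0
    · subst hx
      have h1 : HasGradientAt (fun x : M n => tailInt Q ‖x‖) 0 0 :=
        (hasGradientAt_const (0 : M n) (tailInt Q 0)).congr_of_eventuallyEq hnear'
      rw [grad, if_pos rfl, h1.gradient]
      simp [radialVec]
    · have h1 : HasGradientAt (fun x : M n => tailInt Q ‖x‖) ((-Q ‖x‖) • radialVec x) x := by
        rw [hasGradientAt_iff_hasFDerivAt]
        have := (hder ‖x‖).comp_hasFDerivAt x (hasFDerivAt_norm_of_ne hx)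
        rw [map_smul]
        exact this
      rw [grad, if_neg hx, h1.gradient, dr_smul, dr_radialVec hx, mul_one, sub_self, smul_zero,
        add_zero]

/-- Passing to the limit in integrals against a continuous function with compact support. -/
theorem tendsto_integral_mul_of_tendsto {Y : ℕ → M n → ℝ} {Y₀ ζ : M n → ℝ}
    (hζ : Continuous ζ) (hζc : HasCompactSupport ζ) (hY : ∀ k, LocallyIntegrable (Y k))
    (hY₀ : LocallyIntegrable Y₀)
    (h : Tendsto (fun k => ∫⁻ x in tsupport ζ, ‖Y k x - Y₀ x‖ₑ) atTop (𝓝 0)) :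
    Tendsto (fun k => ∫ x, Y k x * ζ x) atTop (𝓝 (∫ x, Y₀ x * ζ x)) := by
  obtain ⟨C, hC⟩ := hζ.bounded_above_of_compact_support hζc
  have hint : ∀ {Y : M n → ℝ}, LocallyIntegrable Y → Integrable fun x => Y x * ζ x := fun hY => by
    simpa [mul_comm] using hY.integrable_smul_left_of_hasCompactSupport hζ hζc
  refine tendsto_integral_of_L1 _ (hint hY₀).1
    (Eventually.of_forall fun k => hint (hY k)) ?_
  have hlim := ENNReal.Tendsto.const_mul (a := ENNReal.ofReal C) h (Or.inr ENNReal.ofReal_ne_top)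
  rw [mul_zero] at hlim
  refine tendsto_of_tendsto_of_tendsto_of_le_of_le tendsto_const_nhds hlim
    (fun _ => zero_le) fun k => ?_
  simp only
  rw [← lintegral_const_mul' _ _ ENNReal.ofReal_ne_top,
    ← lintegral_indicator (isClosed_tsupport ζ).measurableSet]
  refine lintegral_mono fun x => ?_
  by_cases hx : x ∈ tsupport ζ
  · rw [indicator_of_mem hx, ← sub_mul, enorm_mul, mul_comm]
    refine mul_le_mul_left ?_ _
    rw [← ofReal_norm]
    exact ENNReal.ofReal_le_ofReal (hC x)
  · rw [image_eq_zero_of_notMem_tsupport hx]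
    simp

theorem ae_ne_zero (hn : 2 ≤ n) : ∀ᵐ x : M n, x ≠ 0 := by
  have : Nonempty (Fin n) := ⟨⟨0, by omega⟩⟩
  exact compl_mem_ae_iff.2 (measure_singleton _)

theorem ae_vol_ne_zero (hψ : IsModelFunction ψ) (hn : 2 ≤ n) : ∀ᵐ x ∂(vol n ψ), x ≠ 0 :=
  (vol_absolutelyContinuous hψ hn).ae_le (ae_ne_zero hn)

theorem eLpNorm_two_eq {α E : Type*} [MeasurableSpace α] [NormedAddCommGroup E] (f : α → E)
    (μ : Measure α) : eLpNorm f 2 μ = (∫⁻ x, ‖f x‖ₑ ^ 2 ∂μ) ^ (1 / 2 : ℝ) := by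
  rw [eLpNorm_eq_lintegral_rpow_enorm_toReal two_ne_zero ENNReal.ofNat_ne_top]
  norm_num

/-- The vector field `P(r) ∂_r` has energy given by a one-dimensional integral. -/
theorem energy_radial (hψ : IsModelFunction ψ) (hn : 2 ≤ n) {P : ℝ → ℝ} (hP : Measurable P) :
    energy ψ (fun x : M n => P ‖x‖ • radialVec x) =
      sph n univ * ∫⁻ r, ‖P r‖ₑ ^ 2 ∂(radMeas (dens n ψ)) := by
  rw [← lintegral_vol_norm hψ hn (F := fun r => ‖P r‖ₑ ^ 2) (hP.enorm.pow_const 2), energy]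
  refine lintegral_congr_ae ?_
  filter_upwards [ae_vol_ne_zero hψ hn] with x hx
  rw [metric_radial_self ψ hx, ← sq_abs, ENNReal.ofReal_pow (abs_nonneg _),
    Real.enorm_eq_ofReal_abs]

theorem setLIntegral_norm_le (hψ : IsModelFunction ψ) (hn : 2 ≤ n) {F : ℝ → ℝ≥0∞}
    (hF : Measurable F) {K : Set (M n)} {R : ℝ} (hK : K ⊆ Metric.closedBall 0 R) :
    ∫⁻ x in K, F ‖x‖ ∂(vol n ψ) ≤ sph n univ * ∫⁻ r in Iic R, F r ∂(radMeas (dens n ψ)) := by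
  rw [← lintegral_indicator measurableSet_Iic,
    ← lintegral_vol_norm hψ hn (hF.indicator measurableSet_Iic)]
  calc ∫⁻ x in K, F ‖x‖ ∂(vol n ψ) ≤ ∫⁻ x in Metric.closedBall 0 R, F ‖x‖ ∂(vol n ψ) :=
        lintegral_mono_set hK
    _ = _ := by
        rw [← lintegral_indicator Metric.isClosed_closedBall.measurableSet]
        refine lintegral_congr fun x => ?_
        by_cases hx : ‖x‖ ≤ R
        · rw [indicator_of_mem (by simpa using hx), indicator_of_mem (show ‖x‖ ∈ Iic R from hx)]
        · rw [indicator_of_notMem (by simpa using hx), indicator_of_notMem (show ‖x‖ ∉ Iic R from hx)]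

/-- The square of the primitive of a slope with finite energy has small integral near the pole. -/
theorem IsRadialSlope.tendsto_lintegral_Iio (hψ : IsModelFunction ψ) (hn : 2 ≤ n)
    (h : IsRadialSlope (dens n ψ) P) {ε : ℕ → ℝ} (hε : Tendsto ε atTop (𝓝 0))
    (hε0 : ∀ k, 0 < ε k) (hε1 : ∀ k, ε k ≤ 1) :
    Tendsto (fun k => ∫⁻ r in Iio (ε k), ENNReal.ofReal (tailInt P r) ^ 2
      ∂(radMeas (dens n ψ))) atTop (𝓝 0) := by
  have hg := hψ.isDensity hn
  have h1 := h.lintegral_sq_tailInt hψ hn one_pos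
  have h2 : Tendsto (((radMeas (dens n ψ)).restrict (Iic 1)) ∘ fun k => Iio (ε k)) atTop (𝓝 0) := by
    have h3 : Tendsto (fun k => ENNReal.ofReal (cumVol (dens n ψ) (ε k))) atTop (𝓝 0) := by
      have := (ENNReal.continuous_ofReal.comp hg.continuous_cumVol).tendsto 0
      simp only [Function.comp_apply, cumVol_zero, ENNReal.ofReal_zero] at this
      exact this.comp hε
    refine tendsto_of_tendsto_of_tendsto_of_le_of_le tendsto_const_nhds h3
      (fun _ => zero_le) fun k => ?_
    simp only [Function.comp_apply]
    rw [← hg.radMeas_Iic (hε0 k).le]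
    exact (Measure.restrict_apply_le _ _).trans (measure_mono Iio_subset_Iic_self)
  refine (tendsto_setLIntegral_zero h1.ne h2).congr fun k => ?_
  rw [Measure.restrict_restrict measurableSet_Iio, inter_eq_left.2]
  exact fun r hr => (le_of_lt hr).trans (hε1 k)

/-- A radial function whose slope has finite energy and which vanishes at infinity belongs to the
homogeneous Sobolev space, with gradient `-P(r) ∂_r`. The test functions are the radial functions
whose slopes are the smooth, compactly supported approximations of `P`; the weak gradient identity
passes to the limit from theirs. -/
theorem memHdot_of_ae_eq_tailInt (hψ : IsModelFunction ψ) (hn : 2 ≤ n)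
    (h : IsRadialSlope (dens n ψ) P) {v : M n → ℝ} (hv : v =ᵐ[volume] fun x => tailInt P ‖x‖) :
    MemHdot ψ v ∧ HasWeakGradient ψ v fun x => (-P ‖x‖) • radialVec x := by
  have hg := hψ.isDensity hn
  set W : M n → M n := fun x => (-P ‖x‖) • radialVec x with hW
  have hv' := (vol_absolutelyContinuous hψ hn).ae_le hv
  have hWm : Measurable W := (h.meas.comp measurable_norm).neg.smul measurable_radialVec
  have hvm : AEStronglyMeasurable v volume :=
    (h.measurable_tailInt.comp measurable_norm).aestronglyMeasurable.congr hv.symm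
  have hvL2 : ∀ K : Set (M n), IsCompact K → ∫⁻ x in K, ‖v x‖ₑ ^ 2 ∂(vol n ψ) < ⊤ := by
    intro K hK
    obtain ⟨R, hR0, hR⟩ := hK.isBounded.subset_closedBall_lt 0 0
    have h1 := setLIntegral_norm_le hψ hn
      (F := fun r => ENNReal.ofReal (tailInt P r) ^ 2)
      (h.measurable_tailInt.ennreal_ofReal.pow_const 2) hR
    have h2 : ∫⁻ x in K, ‖v x‖ₑ ^ 2 ∂(vol n ψ) =
        ∫⁻ x in K, ENNReal.ofReal (tailInt P ‖x‖) ^ 2 ∂(vol n ψ) := by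
      refine lintegral_congr_ae (ae_restrict_of_ae ?_)
      filter_upwards [hv'] with x hx
      rw [hx, Real.enorm_of_nonneg (h.tailInt_nonneg _)]
    rw [h2]
    exact h1.trans_lt (ENNReal.mul_lt_top (measure_lt_top _ _) (h.lintegral_sq_tailInt hψ hn hR0))
  have hWen : energy ψ W < ⊤ := by
    rw [hW, energy_radial hψ hn (P := fun r => -P r) h.meas.neg]
    simp only [enorm_neg, Real.enorm_of_nonneg (h.nonneg _)]
    exact ENNReal.mul_lt_top (measure_lt_top _ _) h.energy.lt_top
  have hWL2 : ∀ K : Set (M n), IsCompact K → ∫⁻ x in K, ‖W x‖ₑ ^ 2 ∂(vol n ψ) < ⊤ := by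
    intro K hK
    refine lt_of_le_of_lt ?_ hWen
    refine (setLIntegral_le_lintegral _ _).trans (lintegral_mono_ae ?_)
    filter_upwards [ae_vol_ne_zero hψ hn] with x hx
    rw [hW, metric_radial_self ψ hx, enorm_smul, ← ofReal_norm (radialVec x), norm_radialVec hx,
      ENNReal.ofReal_one, mul_one, ← sq_abs, ENNReal.ofReal_pow (abs_nonneg _),
      Real.enorm_eq_ofReal_abs]
  have hvloc : LocallyIntegrable v := locallyIntegrable_of_sq hψ hn hvm hvL2
  have hWloc : LocallyIntegrable W :=
    locallyIntegrable_of_sq hψ hn hWm.aestronglyMeasurable hWL2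
  -- approximation by test functions
  set ε : ℕ → ℝ := fun k => 1 / ((k : ℝ) + 1)
  have hε0 : ∀ k, 0 < ε k := fun k => Nat.one_div_pos_of_nat
  have hε1 : ∀ k, ε k ≤ 1 := fun k => by
    simp only [ε]
    rw [div_le_one (by positivity)]
    linarith [k.cast_nonneg (α := ℝ)]
  have hεlim : Tendsto ε atTop (𝓝 0) := tendsto_one_div_add_atTop_nhds_zero_nat
  choose Q a b hQs ha _ hQ0 hQe hQt using fun k => h.exists_approx hg (hε0 k)
  set φ : ℕ → M n → ℝ := fun k x => tailInt (Q k) ‖x‖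
  have hφ : ∀ k, IsTestFunction (φ k) := fun k =>
    (isTestFunction_tailInt (ψ := ψ) (hQs k) (ha k) (hQ0 k)).1
  have hφg : ∀ k x, grad ψ (φ k) x = (-Q k ‖x‖) • radialVec x := fun k =>
    (isTestFunction_tailInt (hQs k) (ha k) (hQ0 k)).2
  have hQm : ∀ k, Measurable (Q k) := fun k => (hQs k).continuous.measurable
  have hen : Tendsto (fun k => energy ψ fun x => grad ψ (φ k) x - W x) atTop (𝓝 0) := by
    have h1 : Tendsto (fun k => sph n univ * ENNReal.ofReal (ε k)) atTop (𝓝 0) := by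
      have := ENNReal.Tendsto.const_mul (a := sph n univ) (ENNReal.tendsto_ofReal hεlim)
        (Or.inr (measure_ne_top _ _))
      simpa using this
    refine tendsto_of_tendsto_of_tendsto_of_le_of_le tendsto_const_nhds h1
      (fun _ => zero_le) fun k => ?_
    have h2 : (fun x => grad ψ (φ k) x - W x) = fun x => (-Q k ‖x‖ - -P ‖x‖) • radialVec x := by
      funext x
      rw [hφg, hW, ← sub_smul]
    simp only
    rw [h2, energy_radial hψ hn (P := fun r => -Q k r - -P r) ((hQm k).neg.sub h.meas.neg)]
    refine mul_le_mul_right (le_trans (le_of_eq (lintegral_congr fun r => ?_)) (hQe k)) _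
    rw [← enorm_neg]
    congr 2
    ring
  have hloc : ∀ K : Set (M n), IsCompact K →
      Tendsto (fun k => ∫⁻ x in K, ‖φ k x - v x‖ₑ ^ 2 ∂(vol n ψ)) atTop (𝓝 0) := by
    intro K hK
    obtain ⟨R, hR0, hR⟩ := hK.isBounded.subset_closedBall_lt 0 0
    have h1 := ENNReal.Tendsto.const_mul (a := 2 * sph n univ)
      (h.tendsto_lintegral_Iio hψ hn hεlim hε0 hε1)
      (Or.inr (ENNReal.mul_ne_top ENNReal.ofNat_ne_top (measure_ne_top _ _)))
    have h2 := ENNReal.Tendsto.const_mul (a := 2 * vol n ψ K)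
      (ENNReal.Tendsto.pow (n := 2) (ENNReal.tendsto_ofReal hεlim))
      (Or.inr (ENNReal.mul_ne_top ENNReal.ofNat_ne_top (vol_lt_top_of_isCompact hψ hn hK).ne))
    have h3 := h2.add h1
    simp only [ENNReal.ofReal_zero, ne_eq, OfNat.ofNat_ne_zero, not_false_eq_true, zero_pow,
      mul_zero, add_zero] at h3
    refine tendsto_of_tendsto_of_tendsto_of_le_of_le tendsto_const_nhds h3
      (fun _ => zero_le) fun k => ?_
    set D : ℝ → ℝ≥0∞ := indicator (Iio (ε k)) fun r => ENNReal.ofReal (tailInt P r) ^ 2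
    have hD : Measurable D :=
      (h.measurable_tailInt.ennreal_ofReal.pow_const 2).indicator measurableSet_Iio
    calc ∫⁻ x in K, ‖φ k x - v x‖ₑ ^ 2 ∂(vol n ψ)
        ≤ ∫⁻ x in K, (2 * ENNReal.ofReal (ε k) ^ 2 + 2 * D ‖x‖) ∂(vol n ψ) := by
          refine lintegral_mono_ae (ae_restrict_of_ae ?_)
          filter_upwards [hv', ae_vol_ne_zero hψ hn] with x hx hx0
          rw [hx]
          have h4 := hQt k ‖x‖ (norm_pos_iff.2 hx0)
          have h7 : ∀ s t : ℝ≥0∞, (s + t) ^ 2 ≤ 2 * s ^ 2 + 2 * t ^ 2 := fun s t => by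
            have := ENNReal.rpow_add_le_mul_rpow_add_rpow s t (one_le_two : (1 : ℝ) ≤ 2)
            norm_num at this
            rwa [mul_add] at this
          have h5 : ‖φ k x - tailInt P ‖x‖‖ₑ ≤ ENNReal.ofReal (ε k) +
              indicator (Iio (ε k)) (fun r => ENNReal.ofReal (tailInt P r)) ‖x‖ := by
            rw [Real.enorm_eq_ofReal_abs]
            refine (ENNReal.ofReal_le_ofReal h4).trans (ENNReal.ofReal_add_le.trans ?_)
            refine add_le_add_right (le_of_eq ?_) _
            by_cases hxε : ‖x‖ ∈ Iio (ε k)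
            · rw [indicator_of_mem hxε, indicator_of_mem hxε]
            · rw [indicator_of_notMem hxε, indicator_of_notMem hxε, ENNReal.ofReal_zero]
          refine (pow_le_pow_left' h5 2).trans ((h7 _ _).trans (le_of_eq ?_))
          congr 2
          by_cases hxε : ‖x‖ ∈ Iio (ε k)
          · simp only [D]
            rw [indicator_of_mem hxε, indicator_of_mem hxε]
          · simp only [D]
            rw [indicator_of_notMem hxε, indicator_of_notMem hxε, zero_pow two_ne_zero]
      _ = 2 * vol n ψ K * ENNReal.ofReal (ε k) ^ 2 + 2 * ∫⁻ x in K, D ‖x‖ ∂(vol n ψ) := by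
          rw [lintegral_add_left measurable_const, setLIntegral_const,
            lintegral_const_mul (f := fun x => D ‖x‖) _ (hD.comp measurable_norm)]
          ring
      _ ≤ _ := by
          refine add_le_add_right ?_ _
          rw [mul_assoc]
          refine mul_le_mul_right ?_ _
          refine (setLIntegral_le_lintegral _ _).trans ?_
          rw [lintegral_vol_norm hψ hn hD, lintegral_indicator measurableSet_Iio]
  -- the weak gradient
  have hgrad : HasWeakGradient ψ v W := by
    refine ⟨hvloc, hWloc, fun η hη e => ?_⟩
    have hηd : Continuous fun x => fderiv ℝ η x e :=
      (hη.1.continuous_fderiv (by simp)).clm_apply continuous_const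
    have hηc : HasCompactSupport fun x => fderiv ℝ η x e := hη.2.fderiv_apply ℝ e
    have hφd : ∀ k, Continuous fun x => fderiv ℝ (φ k) x e := fun k =>
      ((hφ k).1.continuous_fderiv (by simp)).clm_apply continuous_const
    have hfd : ∀ k x, fderiv ℝ (φ k) x e = -Q k ‖x‖ * dr x e := fun k x => by
      rw [← metric_grad hψ, hφg, metric_radial]
    have hWe : ∀ x, metric ψ x (W x) e = -P ‖x‖ * dr x e := fun x => metric_radial _ _ _ _
    have lim1 : Tendsto (fun k => ∫ x, φ k x * fderiv ℝ η x e) atTop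
        (𝓝 (∫ x, v x * fderiv ℝ η x e)) := by
      refine tendsto_integral_mul_of_tendsto hηd hηc
        (fun k => (hφ k).1.continuous.locallyIntegrable) hvloc ?_
      refine tendsto_setLIntegral_of_sq hψ hn hηc (fun k => ?_) (hloc _ hηc)
      exact ((hφ k).1.continuous.aestronglyMeasurable.sub hvm).enorm
    have lim2 : Tendsto (fun k => ∫ x, fderiv ℝ (φ k) x e * η x) atTop
        (𝓝 (∫ x, metric ψ x (W x) e * η x)) := by
      refine tendsto_integral_mul_of_tendsto hη.1.continuous hη.2
        (fun k => (hφd k).locallyIntegrable) (locallyIntegrable_metric hψ hWloc e) ?_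
      refine tendsto_setLIntegral_of_sq hψ hn hη.2 (fun k => ?_) ?_
      · exact ((hφd k).aestronglyMeasurable.sub
          (locallyIntegrable_metric hψ hWloc e).aestronglyMeasurable).enorm
      · have h1 := ENNReal.Tendsto.const_mul (a := ‖e‖ₑ ^ 2) hen
          (Or.inr (ENNReal.pow_ne_top enorm_ne_top))
        rw [mul_zero] at h1
        refine tendsto_of_tendsto_of_tendsto_of_le_of_le tendsto_const_nhds h1
          (fun _ => zero_le) fun k => ?_
        simp only
        rw [energy, ← lintegral_const_mul' _ _ (ENNReal.pow_ne_top enorm_ne_top)]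
        refine (setLIntegral_le_lintegral _ _).trans (lintegral_mono_ae ?_)
        filter_upwards [ae_vol_ne_zero hψ hn] with x hx
        have h2 : grad ψ (φ k) x - W x = (-Q k ‖x‖ - -P ‖x‖) • radialVec x := by
          rw [hφg, hW, ← sub_smul]
        rw [h2, metric_radial_self ψ hx, hfd, hWe, ← sub_mul, enorm_mul, mul_pow, mul_comm,
          ← sq_abs (-Q k ‖x‖ - -P ‖x‖), ENNReal.ofReal_pow (abs_nonneg _), Real.enorm_eq_ofReal_abs]
        rw [← Real.enorm_eq_ofReal_abs (-Q k ‖x‖ - -P ‖x‖)]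
        refine mul_le_mul_left (pow_le_pow_left' ?_ 2) _
        rw [← ofReal_norm]
        exact ENNReal.ofReal_le_ofReal (abs_dr_le x e)
    have hparts : ∀ k, ∫ x, φ k x * fderiv ℝ η x e = -∫ x, fderiv ℝ (φ k) x e * η x := by
      intro k
      refine integral_mul_fderiv_eq_neg_fderiv_mul_of_integrable ?_ ?_ ?_
        (fun x _ => (hφ k).1.differentiable (by simp) x)
        (fun x _ => hη.1.differentiable (by simp) x)
      · exact ((hφd k).mul hη.1.continuous).integrable_of_hasCompactSupport hη.2.mul_left
      · exact ((hφ k).1.continuous.mul hηd).integrable_of_hasCompactSupport hηc.mul_left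
      · exact ((hφ k).1.continuous.mul hη.1.continuous).integrable_of_hasCompactSupport
          hη.2.mul_left
    simp only [hparts] at lim1
    exact tendsto_nhds_unique lim1 lim2.neg
  refine ⟨⟨fun K hK => ⟨?_, ?_⟩, W, hgrad, hWen, φ, hφ, hen, fun K hK => ?_⟩, hgrad⟩
  · exact (hvm.mono_ac (vol_absolutelyContinuous hψ hn)).restrict
  · rw [eLpNorm_two_eq]
    exact ENNReal.rpow_lt_top_of_nonneg (by norm_num) (hvL2 K hK).ne
  · simp only [eLpNorm_two_eq]
    have := ((ENNReal.continuous_rpow_const (y := 1 / 2)).tendsto 0).comp (hloc K hK)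
    simpa [Function.comp_def] using this

end

/-! ### The profile of a radial Sobolev function -/

section

variable {n : ℕ} {ψ : ℝ → ℝ}

/-- An exhaustion of `(0, ∞)` by compact intervals containing `1`. -/
def exhaust (N : ℕ) : Set ℝ := Icc (1 / ((N : ℝ) + 2)) ((N : ℝ) + 2)

theorem one_mem_exhaust (N : ℕ) : (1 : ℝ) ∈ exhaust N := by
  have := N.cast_nonneg (α := ℝ)
  refine ⟨?_, by linarith⟩
  rw [div_le_one (by positivity)]
  linarith

theorem measurableSet_exhaust (N : ℕ) : MeasurableSet (exhaust N) := measurableSet_Icc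

theorem exhaust_mono {N K : ℕ} (h : N ≤ K) : exhaust N ⊆ exhaust K := by
  have h' : (N : ℝ) ≤ K := by exact_mod_cast h
  refine Icc_subset_Icc ?_ (by linarith)
  exact one_div_le_one_div_of_le (by positivity) (by linarith)

/-- The intervals `exhaust N` absorb every compact subinterval of `(0, ∞)`. -/
theorem exists_Icc_subset_exhaust {x : ℝ} (hx : 0 < x) (y : ℝ) : ∃ N, Icc x y ⊆ exhaust N := by
  obtain ⟨N, hN⟩ := exists_nat_ge (max (1 / x) y)
  refine ⟨N, Icc_subset_Icc ?_ ?_⟩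
  · have h1 := (le_max_left _ _).trans hN
    rw [div_le_iff₀ hx] at h1
    rw [div_le_iff₀ (by positivity)]
    linarith
  · linarith [(le_max_right (1 / x) y).trans hN]

theorem volume_exhaust_ne_zero (N : ℕ) : volume (exhaust N) ≠ 0 := by
  have h : exhaust 0 ⊆ exhaust N := exhaust_mono N.zero_le
  refine fun h0 => absurd (measure_mono_null h h0) ?_
  rw [exhaust, Real.volume_Icc]
  norm_num

theorem pos_of_mem_exhaust {N : ℕ} {r : ℝ} (h : r ∈ exhaust N) : 0 < r :=
  lt_of_lt_of_le (by positivity) h.1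

/-- A function which is approximated in `L¹` by constants is almost everywhere constant. -/
theorem exists_ae_eq_const {α : Type*} [MeasurableSpace α] {μ : Measure α} (hμ : μ ≠ 0)
    {h : α → ℝ} (hm : AEStronglyMeasurable h μ)
    (happ : ∀ δ : ℝ≥0∞, δ ≠ 0 → ∃ c : ℝ, ∫⁻ x, ‖c - h x‖ₑ ∂μ ≤ δ) :
    ∃ c : ℝ, ∀ᵐ x ∂μ, h x = c := by
  have hδ : ∀ k : ℕ, ((k : ℝ≥0∞))⁻¹ ≠ 0 := fun k => by simp
  choose c hc using fun k : ℕ => happ _ (hδ k)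
  have hlim : Tendsto (fun k => eLpNorm ((fun _ : α => c k) - h) 1 μ) atTop (𝓝 0) := by
    refine tendsto_of_tendsto_of_tendsto_of_le_of_le tendsto_const_nhds
      ENNReal.tendsto_inv_nat_nhds_zero (fun _ => zero_le) fun k => ?_
    simp only [eLpNorm_one_eq_lintegral_enorm]
    exact hc k
  obtain ⟨ns, -, hns⟩ := (tendstoInMeasure_of_tendsto_eLpNorm one_ne_zero
    (fun k => aestronglyMeasurable_const) hm hlim).exists_seq_tendsto_ae
  have : (ae μ).NeBot := ae_neBot.2 hμ
  obtain ⟨x, hx⟩ := hns.exists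
  exact ⟨h x, hns.mono fun y hy => tendsto_nhds_unique hy hx⟩

/-- The one-dimensional closing argument: if `(f, p)` is approximated in `L¹` on compact intervals
by pairs `(φ, φ')`, then `f` is a primitive of `p`. -/
theorem exists_eq_primitive {f p : ℝ → ℝ} (hf : Measurable f) (hp : Measurable p)
    (happ : ∀ (N : ℕ) (δ : ℝ≥0∞), δ ≠ 0 → ∃ φ φ' : ℝ → ℝ, (∀ r, HasDerivAt φ (φ' r) r) ∧
      Continuous φ' ∧ ∫⁻ r in exhaust N, (‖φ r - f r‖ₑ + ‖φ' r - p r‖ₑ) ≤ δ) :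
    (∀ N, IntegrableOn p (exhaust N)) ∧
      ∃ c : ℝ, ∀ᵐ r ∂(volume.restrict (Ioi 0)), f r = c + ∫ t in (1 : ℝ)..r, p t := by
  have hint : ∀ N, IntegrableOn p (exhaust N) := by
    intro N
    obtain ⟨φ, φ', -, hφ', h⟩ := happ N 1 one_ne_zero
    have h1 : IntegrableOn φ' (exhaust N) := hφ'.continuousOn.integrableOn_compact isCompact_Icc
    have h2 : IntegrableOn (fun r => φ' r - p r) (exhaust N) := by
      refine ⟨(hφ'.measurable.sub hp).aestronglyMeasurable, lt_of_le_of_lt ?_ ENNReal.one_lt_top⟩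
      exact (lintegral_mono fun r => le_add_self).trans h
    exact (h1.sub h2).congr (Eventually.of_forall fun r => sub_sub_cancel _ _)
  refine ⟨hint, ?_⟩
  set F := fun r => ∫ t in (1 : ℝ)..r, p t
  have hsub : ∀ {N : ℕ} {r : ℝ}, r ∈ exhaust N → uIoc 1 r ⊆ exhaust N := fun {N r} hr =>
    uIoc_subset_uIcc.trans (ordConnected_Icc.uIcc_subset (one_mem_exhaust N) hr)
  have hFc : ∀ N, ContinuousOn F (exhaust N) := fun N => by
    have h1 := intervalIntegral.continuousOn_primitive_interval' (μ := volume) (f := p)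
      (b₁ := 1 / ((N : ℝ) + 2)) (b₂ := N + 2) (a := 1) ?_ ?_
    · rwa [uIcc_of_le ((one_mem_exhaust N).1.trans (one_mem_exhaust N).2)] at h1
    · rw [intervalIntegrable_iff_integrableOn_Icc_of_le
        ((one_mem_exhaust N).1.trans (one_mem_exhaust N).2)]
      exact hint N
    · rw [uIcc_of_le ((one_mem_exhaust N).1.trans (one_mem_exhaust N).2)]
      exact one_mem_exhaust N
  have hconst : ∀ N, ∃ c : ℝ, ∀ᵐ r ∂(volume.restrict (exhaust N)), f r - F r = c := by
    intro N
    refine exists_ae_eq_const ?_ (hf.aestronglyMeasurable.sub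
      ((hFc N).aestronglyMeasurable (measurableSet_exhaust N))) fun δ hδ => ?_
    · rw [Ne, Measure.restrict_eq_zero]
      exact volume_exhaust_ne_zero N
    set L := volume (exhaust N)
    have hL : L ≠ ⊤ := measure_Icc_lt_top.ne
    obtain ⟨φ, φ', hd, hφ', h⟩ := happ N (δ / (1 + L))
      (ENNReal.div_ne_zero.2 ⟨hδ, ENNReal.add_ne_top.2 ⟨ENNReal.one_ne_top, hL⟩⟩)
    set δ' := δ / (1 + L)
    refine ⟨φ 1, ?_⟩
    have hclose : ∀ r ∈ exhaust N, ‖φ 1 - (f r - F r)‖ₑ ≤ ‖φ r - f r‖ₑ + δ' := by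
      intro r hr
      have h1 : φ r - φ 1 = ∫ t in (1 : ℝ)..r, φ' t :=
        (intervalIntegral.integral_eq_sub_of_hasDerivAt (fun t _ => hd t)
          (hφ'.intervalIntegrable _ _)).symm
      have hpi : IntervalIntegrable p volume 1 r := by
        rw [intervalIntegrable_iff]
        exact (hint N).mono_set (hsub hr)
      have h2 : φ r - φ 1 - F r = ∫ t in (1 : ℝ)..r, (φ' t - p t) := by
        rw [h1, intervalIntegral.integral_sub (hφ'.intervalIntegrable _ _) hpi]
      have h3 : ‖φ r - φ 1 - F r‖ₑ ≤ δ' := by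
        rw [h2, enorm_eq_iff_norm_eq.2 (intervalIntegral.norm_intervalIntegral_eq _ _ _ _)]
        refine (enorm_integral_le_lintegral_enorm _).trans ?_
        refine (lintegral_mono_set (hsub hr)).trans ?_
        exact (lintegral_mono fun t => le_add_self).trans h
      have h4 : φ 1 - (f r - F r) = (φ r - f r) - (φ r - φ 1 - F r) := by ring
      rw [h4]
      exact enorm_sub_le.trans (add_le_add_right h3 _)
    calc ∫⁻ r in exhaust N, ‖φ 1 - (f r - F r)‖ₑ
        ≤ ∫⁻ r in exhaust N, (‖φ r - f r‖ₑ + δ') :=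
          setLIntegral_mono' (measurableSet_exhaust N) hclose
      _ = (∫⁻ r in exhaust N, ‖φ r - f r‖ₑ) + δ' * L := by
          rw [lintegral_add_right _ measurable_const, setLIntegral_const]
      _ ≤ δ' + δ' * L := by
          refine add_le_add_left ?_ _
          exact (lintegral_mono fun t => le_self_add).trans h
      _ = δ' * (1 + L) := by ring
      _ ≤ δ := (ENNReal.div_mul_cancel (by simp)
          (ENNReal.add_ne_top.2 ⟨ENNReal.one_ne_top, hL⟩)).le
  choose c hc using hconst
  have hcc : ∀ N, c N = c 0 := fun N => by
    have h1 : ∀ᵐ r ∂(volume.restrict (exhaust 0)), f r - F r = c N :=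
      ae_restrict_of_ae_restrict_of_subset (exhaust_mono N.zero_le) (hc N)
    have : (ae (volume.restrict (exhaust 0))).NeBot := by
      rw [ae_neBot, Ne, Measure.restrict_eq_zero]
      exact volume_exhaust_ne_zero 0
    obtain ⟨r, hr1, hr2⟩ := (h1.and (hc 0)).exists
    exact hr1.symm.trans hr2
  refine ⟨c 0, ?_⟩
  have hU : Ioi (0 : ℝ) ⊆ ⋃ N, exhaust N := fun r hr => by
    obtain ⟨N, hN⟩ := exists_Icc_subset_exhaust hr r
    exact mem_iUnion.2 ⟨N, hN ⟨le_rfl, le_rfl⟩⟩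
  refine ae_restrict_of_ae_restrict_of_subset hU ((ae_restrict_iUnion_iff _ _).2 fun N => ?_)
  filter_upwards [hc N] with r hr
  rw [← hcc N, ← hr]
  ring

/-- Local `L¹` convergence on the manifold implies `L¹` convergence along rays, on average. -/
theorem tendsto_lintegral_rays (hn : 2 ≤ n) (N : ℕ) {Z : ℕ → M n → ℝ≥0∞}
    (hZ : ∀ k, Measurable (Z k))
    (h : Tendsto (fun k => ∫⁻ x in Metric.closedBall 0 ((N : ℝ) + 2), Z k x) atTop (𝓝 0)) :
    Tendsto (fun k => ∫⁻ θ : Metric.sphere (0 : M n) 1,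
      (∫⁻ r in exhaust N, Z k (r • (θ : M n))) ∂(sph n)) atTop (𝓝 0) := by
  set m : ℝ≥0∞ := ENNReal.ofReal ((1 / ((N : ℝ) + 2)) ^ (n - 1))
  have hm0 : m ≠ 0 := by
    simp only [m, ne_eq, ENNReal.ofReal_eq_zero, not_le]
    positivity
  have h1 := ENNReal.Tendsto.const_mul (a := m⁻¹) h (Or.inr (ENNReal.inv_ne_top.2 hm0))
  rw [mul_zero] at h1
  refine tendsto_of_tendsto_of_tendsto_of_le_of_le tendsto_const_nhds h1
    (fun _ => zero_le) fun k => ?_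
  simp only
  rw [mul_comm, ← div_eq_mul_inv, ENNReal.le_div_iff_mul_le (Or.inl hm0)
    (Or.inl ENNReal.ofReal_ne_top), mul_comm]
  have hmp : Measurable fun q : Metric.sphere (0 : M n) 1 × ℝ => Z k (q.2 • (q.1 : M n)) :=
    (hZ k).comp (by fun_prop)
  rw [lintegral_lintegral_swap hmp.aemeasurable,
    ← lintegral_indicator Metric.isClosed_closedBall.measurableSet, lintegral_volume_polar hn
      ((hZ k).indicator Metric.isClosed_closedBall.measurableSet),
    ← lintegral_const_mul' _ _ ENNReal.ofReal_ne_top]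
  have hsub : exhaust N ⊆ Ioi 0 := fun r hr => pos_of_mem_exhaust hr
  refine le_trans ?_ (lintegral_mono_set hsub)
  refine setLIntegral_mono' (measurableSet_exhaust N) fun r hr => ?_
  have hr0 := pos_of_mem_exhaust hr
  refine mul_le_mul' (ENNReal.ofReal_le_ofReal (pow_le_pow_left₀ (by positivity) hr.1 _)) ?_
  refine lintegral_mono fun θ => ?_
  rw [indicator_of_mem]
  rw [mem_closedBall_zero_iff, norm_polar hr0.le]
  exact hr.2

theorem radialVec_polar {r : ℝ} (hr : 0 < r) (θ : Metric.sphere (0 : M n) 1) :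
    radialVec (r • (θ : M n)) = θ := by
  rw [radialVec, norm_polar hr.le, smul_smul, inv_mul_cancel₀ hr.ne', one_smul]

theorem measurable_dr_grad (hψ : IsModelFunction ψ) {φ : M n → ℝ} (hφ : IsTestFunction φ) :
    Measurable fun x => dr x (grad ψ φ x) := by
  have h1 : (fun x => dr x (grad ψ φ x)) = fun x => fderiv ℝ φ x (radialVec x) := by
    funext x
    rw [← metric_grad hψ, metric_comm]
    have := metric_radial ψ x 1 (grad ψ φ x)
    rw [one_smul, one_mul] at this
    exact this.symm
  rw [h1]
  have h2 : Measurable fun x => fderiv ℝ φ x := (hφ.1.continuous_fderiv (by simp)).measurable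
  exact (ContinuousLinearMap.measurable_apply₂).comp (h2.prodMk measurable_radialVec)

/-- Along a ray, the radial component of the gradient is the derivative. -/
theorem hasDerivAt_ray {φ : M n → ℝ} (hφ : IsTestFunction φ) (θ : Metric.sphere (0 : M n) 1)
    (r : ℝ) : HasDerivAt (fun r : ℝ => φ (r • (θ : M n))) (fderiv ℝ φ (r • (θ : M n)) θ) r := by
  have h1 : HasDerivAt (fun r : ℝ => r • (θ : M n)) (θ : M n) r := by
    simpa using (hasDerivAt_id r).smul_const (θ : M n)
  exact ((hφ.1.differentiable (by simp) _).hasFDerivAt).comp_hasDerivAt r h1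

theorem dr_grad_polar (hψ : IsModelFunction ψ) (φ : M n → ℝ) (θ : Metric.sphere (0 : M n) 1)
    {r : ℝ} (hr : 0 < r) :
    dr (r • (θ : M n)) (grad ψ φ (r • (θ : M n))) = fderiv ℝ φ (r • (θ : M n)) θ := by
  have := metric_radial ψ (r • (θ : M n)) 1 (grad ψ φ (r • (θ : M n)))
  rw [one_smul, one_mul, metric_comm, metric_grad hψ, radialVec_polar hr] at this
  exact this.symm

/-- A radial function of the homogeneous Sobolev space agrees with a locally absolutely continuous
function of the radius whose slope has no more energy. It is read off along a suitable ray, on which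
the approximating test functions converge. -/
theorem exists_profile (hψ : IsModelFunction ψ) (hn : 2 ≤ n) {v : M n → ℝ} (hrad : IsRadial ψ v)
    (hv : MemHdot ψ v) :
    ∃ (u : ℝ → ℝ) (q : ℝ → ℝ≥0∞), IsUpperGradient u q ∧
      (∀ᵐ x ∂(vol n ψ), |v x| = u ‖x‖) ∧
      ∀ W, HasWeakGradient ψ v W →
        sph n univ * ∫⁻ r, q r ^ 2 ∂(radMeas (dens n ψ)) ≤ energy ψ W := by
  have hg := hψ.isDensity hn
  obtain ⟨-, W, hW, hWen, φ, hφ, hen, hloc⟩ := hv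
  obtain ⟨f, hf⟩ := hrad
  have hvm := hW.1.aestronglyMeasurable.aemeasurable
  have hWm := hW.2.1.aestronglyMeasurable.aemeasurable
  set v' := hvm.mk v with hv'
  set W' := hWm.mk W with hW'
  have hv'm : Measurable v' := hvm.measurable_mk
  have hW'm : Measurable W' := hWm.measurable_mk
  have hvv' : v =ᵐ[volume] v' := hvm.ae_eq_mk
  have hWW' : W =ᵐ[volume] W' := hWm.ae_eq_mk
  have hac := (vol_absolutelyContinuous hψ hn).ae_le
  set w : M n → ℝ := fun x => dr x (W' x)
  have hwm : Measurable w := measurable_dr hW'm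
  set Z : ℕ → M n → ℝ≥0∞ := fun k x => ‖φ k x - v' x‖ₑ + ‖dr x (grad ψ (φ k) x) - w x‖ₑ
  have hZ : ∀ k, Measurable (Z k) := fun k =>
    ((hφ k).1.continuous.measurable.sub hv'm).enorm.add
      ((measurable_dr_grad hψ (hφ k)).sub hwm).enorm
  have hZlim : ∀ K : Set (M n), IsCompact K →
      Tendsto (fun k => ∫⁻ x in K, Z k x) atTop (𝓝 0) := by
    intro K hK
    have h1 : Tendsto (fun k => ∫⁻ x in K, ‖φ k x - v' x‖ₑ) atTop (𝓝 0) := by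
      refine tendsto_setLIntegral_of_sq hψ hn hK (fun k =>
        ((hφ k).1.continuous.measurable.sub hv'm).enorm.aemeasurable) ?_
      have h2 := hloc K hK
      simp only [eLpNorm_two_eq] at h2
      have h3 := ((ENNReal.continuous_rpow_const (y := 2)).tendsto 0).comp h2
      rw [ENNReal.zero_rpow_of_pos two_pos] at h3
      refine h3.congr fun k => ?_
      simp only [Function.comp_apply]
      rw [← ENNReal.rpow_mul]
      norm_num
      refine lintegral_congr_ae (ae_restrict_of_ae ?_)
      filter_upwards [hac hvv'] with x hx
      rw [hx]
    have h2 : Tendsto (fun k => ∫⁻ x in K, ‖dr x (grad ψ (φ k) x) - w x‖ₑ) atTop (𝓝 0) := by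
      refine tendsto_setLIntegral_of_sq hψ hn hK (fun k =>
        ((measurable_dr_grad hψ (hφ k)).sub hwm).enorm.aemeasurable) ?_
      refine tendsto_of_tendsto_of_tendsto_of_le_of_le tendsto_const_nhds hen
        (fun _ => zero_le) fun k => ?_
      refine (setLIntegral_le_lintegral _ _).trans (lintegral_mono_ae ?_)
      filter_upwards [hac hWW', ae_vol_ne_zero hψ hn] with x hx hx0
      rw [← dr_sub, ← hx, Real.enorm_eq_ofReal_abs, ← ENNReal.ofReal_pow (abs_nonneg _), sq_abs]
      exact ENNReal.ofReal_le_ofReal (sq_dr_le_metric ψ hx0 _)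
    have h3 := h1.add h2
    rw [add_zero] at h3
    refine h3.congr fun k => ?_
    exact (lintegral_add_left ((hφ k).1.continuous.measurable.sub hv'm).enorm _).symm
  -- almost every ray carries arbitrarily good approximations
  have hray : ∀ᵐ θ : Metric.sphere (0 : M n) 1 ∂(sph n), ∀ N : ℕ, ∀ δ : ℝ≥0∞, δ ≠ 0 →
      ∃ k, ∫⁻ r in exhaust N, Z k (r • (θ : M n)) ≤ δ := by
    refine ae_all_iff.2 fun N => ?_
    set A : ℕ → Metric.sphere (0 : M n) 1 → ℝ≥0∞ := fun k θ =>
      ∫⁻ r in exhaust N, Z k (r • (θ : M n))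
    have hA : ∀ k, Measurable (A k) := fun k =>
      Measurable.lintegral_prod_right' (f := fun q : Metric.sphere (0 : M n) 1 × ℝ =>
        Z k (q.2 • (q.1 : M n))) ((hZ k).comp (by fun_prop))
    have hAlim := tendsto_lintegral_rays hn N hZ (hZlim _ (isCompact_closedBall _ _))
    have h0 : ∫⁻ θ, liminf (fun k => A k θ) atTop ∂(sph n) = 0 := by
      refine le_antisymm ((lintegral_liminf_le hA).trans ?_) zero_le
      rw [hAlim.liminf_eq]
    rw [lintegral_eq_zero_iff (Measurable.liminf hA)] at h0
    filter_upwards [h0] with θ hθ δ hδ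
    by_contra! hcon
    have h1 : δ ≤ liminf (fun k => A k θ) atTop :=
      le_liminf_of_le (by isBoundedDefault) (Eventually.of_forall fun k => (hcon k).le)
    rw [hθ] at h1
    exact hδ (le_antisymm h1 zero_le)
  have hfray := ae_ae_polar hψ hn (show ∀ᵐ x ∂(vol n ψ), v' x = f ‖x‖ by
    filter_upwards [hac hvv', hf] with x h1 h2
    rw [← h1, h2])
  -- choice of a ray carrying at most the average energy
  set e : Metric.sphere (0 : M n) 1 → ℝ≥0∞ := fun θ =>
    ∫⁻ r, ‖w (r • (θ : M n))‖ₑ ^ 2 ∂(radMeas (dens n ψ))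
  have := hg.isLocallyFinite
  have hem : Measurable e :=
    Measurable.lintegral_prod_right' (f := fun q : Metric.sphere (0 : M n) 1 × ℝ =>
        ‖w (q.2 • (q.1 : M n))‖ₑ ^ 2) ((hwm.comp (by fun_prop)).enorm.pow_const 2)
  have hsph : sph n ≠ 0 := fun h0 => sph_ne_zero hn (by rw [h0]; rfl)
  obtain ⟨θ, hθN, hθe⟩ := exists_notMem_null_le_laverage hsph hem.aemeasurable
    (ae_iff.1 (hray.and hfray))
  simp only [mem_ofPred_eq, not_not] at hθN
  obtain ⟨hθ1, hθ2⟩ := hθN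
  have henergy : sph n univ * e θ ≤ energy ψ W := by
    rw [laverage_eq, ENNReal.le_div_iff_mul_le (Or.inl (sph_ne_zero hn))
      (Or.inl (measure_ne_top _ _)), mul_comm, ← lintegral_vol' hψ hn
      (F := fun x => ‖w x‖ₑ ^ 2) (hwm.enorm.pow_const 2)] at hθe
    refine hθe.trans (lintegral_mono_ae ?_)
    filter_upwards [hac hWW', ae_vol_ne_zero hψ hn] with x hx hx0
    rw [hx, Real.enorm_eq_ofReal_abs, ← ENNReal.ofReal_pow (abs_nonneg _), sq_abs]
    exact ENNReal.ofReal_le_ofReal (sq_dr_le_metric ψ hx0 _)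
  have hcurve : Measurable fun r : ℝ => r • (θ : M n) := by fun_prop
  set p : ℝ → ℝ := fun r => w (r • (θ : M n))
  have hp : Measurable p := hwm.comp hcurve
  obtain ⟨hpi, c, hc⟩ := exists_eq_primitive (f := fun r => v' (r • (θ : M n))) (p := p)
    (hv'm.comp hcurve) hp fun N δ hδ => by
      obtain ⟨k, hk⟩ := hθ1 N δ hδ
      refine ⟨fun r => φ k (r • (θ : M n)), fun r => fderiv ℝ (φ k) (r • (θ : M n)) θ,
        hasDerivAt_ray (hφ k) θ, ?_, le_trans (le_of_eq ?_) hk⟩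
      · exact (((hφ k).1.continuous_fderiv (by simp)).comp (by fun_prop)).clm_apply
          continuous_const
      · refine setLIntegral_congr_fun (measurableSet_exhaust N) fun r hr => ?_
        simp only [Z]
        rw [dr_grad_polar hψ _ _ (pos_of_mem_exhaust hr)]
  have hIcc : ∀ x y, 0 < x → IntegrableOn p (Icc x y) := fun x y hx => by
    obtain ⟨N, hN⟩ := exists_Icc_subset_exhaust hx y
    exact (hpi N).mono_set hN
  have hii : ∀ x y, 0 < x → 0 < y → IntervalIntegrable p volume x y := fun x y hx hy => by
    rw [intervalIntegrable_iff]
    exact (hIcc (min x y) (max x y) (lt_min hx hy)).mono_set uIoc_subset_uIcc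
  set F : ℝ → ℝ := fun r => c + ∫ t in (1 : ℝ)..r, p t
  have hFsub : ∀ x y, 0 < x → 0 < y → F y - F x = ∫ t in x..y, p t := fun x y hx hy => by
    have := intervalIntegral.integral_interval_sub_left (hii 1 y one_pos hy) (hii 1 x one_pos hx)
    rw [← this]
    simp only [F]
    ring
  have hFc : ContinuousOn F (Ioi 0) := by
    refine continuousOn_const.add fun r hr => ?_
    have hr0 : 0 < r := hr
    obtain ⟨N, hN⟩ := exists_Icc_subset_exhaust (show 0 < r / 2 by positivity) (r + 1)
    have h1 := intervalIntegral.continuousOn_primitive_interval' (μ := volume) (f := p)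
      (b₁ := 1 / ((N : ℝ) + 2)) (b₂ := N + 2) (a := 1) ?_ ?_
    · refine (h1.continuousAt ?_).continuousWithinAt
      rw [uIcc_of_le ((one_mem_exhaust N).1.trans (one_mem_exhaust N).2)]
      exact Filter.mem_of_superset (Icc_mem_nhds (by linarith) (by linarith)) hN
    · rw [intervalIntegrable_iff_integrableOn_Icc_of_le
        ((one_mem_exhaust N).1.trans (one_mem_exhaust N).2)]
      exact hpi N
    · rw [uIcc_of_le ((one_mem_exhaust N).1.trans (one_mem_exhaust N).2)]
      exact one_mem_exhaust N
  have hFm : Measurable (indicator (Ioi 0) fun r => |F r|) := by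
    classical
    rw [← Set.piecewise_eq_indicator]
    exact ContinuousOn.measurable_piecewise hFc.abs continuousOn_const measurableSet_Ioi
  refine ⟨indicator (Ioi 0) fun r => |F r|, fun r => ‖p r‖ₑ, ⟨hFm, ?_, hp.enorm, ?_, ?_⟩, ?_, ?_⟩
  · exact hFc.abs.congr fun r hr => indicator_of_mem hr _
  · intro x y hx
    exact ((hIcc x y hx).mono_set Ioc_subset_Icc_self).2.ne
  · intro x y hx hxy
    rw [indicator_of_mem (show y ∈ Ioi 0 from hx.trans_le hxy),
      indicator_of_mem (show x ∈ Ioi 0 from hx)]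
    refine (ENNReal.ofReal_le_ofReal (abs_abs_sub_abs_le_abs_sub _ _)).trans ?_
    rw [hFsub x y hx (hx.trans_le hxy), intervalIntegral.integral_of_le hxy,
      ← Real.enorm_eq_ofReal_abs]
    exact enorm_integral_le_lintegral_enorm _
  · have h1 : ∀ᵐ r ∂(radMeas (dens n ψ)), f r = F r := by
      filter_upwards [hθ2, hg.ae_pos, radMeas_absolutelyContinuous.ae_le
        ((ae_restrict_iff' measurableSet_Ioi).1 hc)] with r h1 h2 h3
      rw [norm_polar h2.le] at h1
      rw [← h1]
      exact h3 h2
    filter_upwards [hf, ae_vol_norm hψ hn h1, ae_vol_ne_zero hψ hn] with x h2 h3 h4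
    rw [indicator_of_mem (show ‖x‖ ∈ Ioi 0 from norm_pos_iff.2 h4), h2, h3]
  · intro W₂ hW₂
    rw [hW₂.energy_eq hψ hn hW]
    exact henergy

end

/-! ### The Schwarz rearrangement of a radial function -/

section

variable {n : ℕ} {ψ : ℝ → ℝ}

theorem vol_ball (hψ : IsModelFunction ψ) (hn : 2 ≤ n) {r : ℝ} (hr : 0 ≤ r) :
    vol n ψ (Metric.ball 0 r) = sph n univ * ENNReal.ofReal (cumVol (dens n ψ) r) := by
  have h1 : Metric.ball (0 : M n) r = {x | ‖x‖ ∈ Iio r} := by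
    ext x
    simp
  rw [h1, vol_norm_preimage hψ hn measurableSet_Iio, ← (hψ.isDensity hn).radMeas_Iic hr,
    measure_congr (radMeas_absolutelyContinuous.ae_le Iio_ae_eq_Iic)]

theorem distrib_eq (hψ : IsModelFunction ψ) (hn : 2 ≤ n) {v : M n → ℝ} {u : ℝ → ℝ}
    (hu : Measurable u) (h : ∀ᵐ x ∂(vol n ψ), |v x| = u ‖x‖) (t : ℝ) :
    distrib ψ v t = sph n univ * radMeas (dens n ψ) {r | t < u r} := by
  rw [distrib, ← vol_norm_preimage hψ hn (measurableSet_lt measurable_const hu)]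
  refine measure_congr ?_
  filter_upwards [h] with x hx
  change (t < |v x|) = (t < u ‖x‖)
  rw [hx]

/-- The one-dimensional rearrangement at the volume of a ball is the length of the set of levels
whose superlevel sets are larger than the ball. -/
theorem rearr_eq_volume (hψ : IsModelFunction ψ) (hn : 2 ≤ n) {v : M n → ℝ} {u : ℝ → ℝ}
    (hu : Measurable u) (h : ∀ᵐ x ∂(vol n ψ), |v x| = u ‖x‖) {r : ℝ} (hr : 0 ≤ r) :
    rearr ψ v (vol n ψ (Metric.ball 0 r)) =
      volume {t | 0 < t ∧ ENNReal.ofReal (cumVol (dens n ψ) r) <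
        radMeas (dens n ψ) {r | t < u r}} := by
  have hiff : ∀ t, vol n ψ (Metric.ball 0 r) < distrib ψ v t ↔
      ENNReal.ofReal (cumVol (dens n ψ) r) < radMeas (dens n ψ) {r | t < u r} := fun t => by
    rw [vol_ball hψ hn hr, distrib_eq hψ hn hu h,
      ENNReal.mul_lt_mul_iff_right (sph_ne_zero hn) (measure_ne_top _ _)]
  refine le_antisymm (sSup_le ?_) ?_
  · rintro _ ⟨t, ht0, ht, rfl⟩
    have hsub : Ioc 0 t ⊆ {t | 0 < t ∧ ENNReal.ofReal (cumVol (dens n ψ) r) <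
        radMeas (dens n ψ) {r | t < u r}} := fun s hs =>
      ⟨hs.1, ((hiff t).1 ht).trans_le (measure_mono fun ρ hρ => hs.2.trans_lt hρ)⟩
    have := measure_mono (μ := volume) hsub
    rwa [Real.volume_Ioc, sub_zero] at this
  · set b := rearr ψ v (vol n ψ (Metric.ball 0 r)) with hb
    rcases eq_or_ne b ⊤ with hbt | hbt
    · rw [hbt]
      exact le_top
    have hsub : {t | 0 < t ∧ ENNReal.ofReal (cumVol (dens n ψ) r) <
        radMeas (dens n ψ) {r | t < u r}} ⊆ Ioc 0 b.toReal := fun t ht =>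
      ⟨ht.1, (ENNReal.ofReal_le_iff_le_toReal hbt).1
        (le_sSup ⟨t, ht.1.le, (hiff t).2 ht.2, rfl⟩)⟩
    have := measure_mono (μ := volume) hsub
    rwa [Real.volume_Ioc, sub_zero, ENNReal.ofReal_toReal hbt] at this

/-- The radial Pólya–Szegő inequality under the subadditivity of the volumes of spheres. -/
theorem VolumeSubadditive.supportsRadialPolyaSzego (hψ : IsModelFunction ψ) (hn : 2 ≤ n)
    (hsub : VolumeSubadditive n ψ) : SupportsRadialPolyaSzego n ψ := by
  intro v hrad hmem hL0
  have hg := hψ.isDensity hn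
  obtain ⟨u, q, h, hvu, hE⟩ := exists_profile hψ hn hrad hmem
  have hfin : ∀ t, 0 < t → radMeas (dens n ψ) {r | t < u r} ≠ ⊤ := fun t ht => by
    have h1 := hL0.2 t ht
    rw [distrib_eq hψ hn h.meas_fun hvu] at h1
    exact fun h2 => h1.ne (by rw [h2, ENNReal.mul_top (sph_ne_zero hn)])
  obtain ⟨p, hp, hptail, hplevel, hpen⟩ :=
    h.exists_rearrangement_density hg hsub.densitySubadditive hfin
  set P : ℝ → ℝ := fun r => (p r).toReal
  have hPp : ∀ r, ENNReal.ofReal (P r) ≤ p r := fun r => ENNReal.ofReal_toReal_le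
  have hPen : ∫⁻ r, ENNReal.ofReal (P r) ^ 2 ∂(radMeas (dens n ψ)) ≤
      ∫⁻ r, q r ^ 2 ∂(radMeas (dens n ψ)) :=
    (lintegral_mono fun r => pow_le_pow_left' (hPp r) 2).trans hpen
  have hqfin : ∫⁻ r, q r ^ 2 ∂(radMeas (dens n ψ)) ≠ ⊤ := fun h2 => by
    obtain ⟨-, W, hW, hWen, -⟩ := hmem
    have h1 := (hE W hW).trans_lt hWen
    rw [h2, ENNReal.mul_top (sph_ne_zero hn)] at h1
    exact lt_irrefl _ h1
  have hP : IsRadialSlope (dens n ψ) P :=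
    ⟨hp.ennreal_toReal, fun r => ENNReal.toReal_nonneg,
      fun r hr => integrable_toReal_of_lintegral_ne_top hp.aemeasurable (hptail r hr),
      (hPen.trans_lt hqfin.lt_top).ne⟩
  have hschwarz : ∀ x : M n, x ≠ 0 → schwarz ψ v x = tailInt P ‖x‖ := fun x hx => by
    have hx0 := norm_pos_iff.2 hx
    rw [schwarz, rearr_eq_volume hψ hn h.meas_fun hvu (norm_nonneg x), hplevel _ hx0, tailInt,
      integral_toReal hp.aemeasurable (ae_lt_top hp (hptail _ hx0))]
  have hae : schwarz ψ v =ᵐ[volume] fun x => tailInt P ‖x‖ := by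
    filter_upwards [ae_ne_zero hn] with x hx using hschwarz x hx
  have hae' : schwarz ψ v =ᵐ[vol n ψ] fun x => tailInt P ‖x‖ :=
    (vol_absolutelyContinuous hψ hn).ae_le hae
  obtain ⟨hmem', hgrad⟩ := memHdot_of_ae_eq_tailInt hψ hn hP hae
  refine ⟨hmem', ⟨(hP.measurable_tailInt.comp measurable_norm).aemeasurable.congr hae'.symm,
    fun t ht => ?_⟩, fun W W' hW hW' => ?_⟩
  · rw [distrib_eq hψ hn hP.measurable_tailInt (by
      filter_upwards [hae'] with x hx
      rw [hx, abs_of_nonneg (hP.tailInt_nonneg _)])]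
    obtain ⟨R, hR0, hR⟩ := ((eventually_gt_atTop 0).and
      (hP.tendsto_tailInt.eventually (eventually_lt_nhds ht))).exists
    refine ENNReal.mul_lt_top (measure_lt_top _ _)
      ((measure_mono (t := Iic R) fun r hr => ?_).trans_lt ?_)
    · by_contra hrR
      rw [mem_Iic, not_le] at hrR
      rw [mem_ofPred_eq] at hr
      exact absurd hr (not_lt.2 ((hP.tailInt_anti hR0 hrR.le).trans hR.le))
    · rw [hg.radMeas_Iic hR0.le]
      exact ENNReal.ofReal_lt_top
  · rw [hW'.energy_eq hψ hn hgrad, energy_radial hψ hn (P := fun r => -P r) hP.meas.neg]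
    simp only [enorm_neg, Real.enorm_of_nonneg (hP.nonneg _)]
    exact (mul_le_mul_right hPen _).trans (hE W hW)

end

end ModelManifold

end

theorem proposition3p8 (n : ℕ) (hn : 2 ≤ n) (ψ : ℝ → ℝ)
    (hψ : ModelManifold.IsModelFunction ψ) :
    (ModelManifold.VolumeSubadditive n ψ → ModelManifold.SupportsRadialPolyaSzego n ψ) ∧
    (MonotoneOn ψ (Set.Ici 0) →
      ModelManifold.VolumeSubadditive n ψ ∧ ModelManifold.SupportsRadialPolyaSzego n ψ) := by
  refine ⟨fun h => h.supportsRadialPolyaSzego hψ hn, fun hmono => ?_⟩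
  have h := hψ.volumeSubadditive hn hmono
  exact ⟨h, h.supportsRadialPolyaSzego hψ hn⟩
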